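/- Let $(M,\omega,J)$ be a compact Kähler manifold of real dimension $2n$, with Kähler metric $B=\omega(\cdot,J\cdot)$ and $|v|^2=B(v,v)$. For a function $u$ define $\operatorname{grad}u$ by $B(\operatorname{grad} u,\cdot)=du$, for a vector field $X$ put $\operatorname{div}X=\mathcal L_X\omega^n/\omega^n$, and let $\Delta u=\operatorname{div}\operatorname{grad}u$. Let $G$ be a compact Lie group of dimension $d\ge 1$ with Lie algebra $\mathfrak g$, acting smoothly on $M$, preserving $\omega$ and $J$, and Hamiltonian with equivariant moment map $\Phi:M\to\mathfrak g^*$: the components $\phi_\xi=\langle\Phi,\xi\rangle$ satisfy $d\phi_\xi=\omega(X^\xi,\cdot)$, where $X^\xi$ is the vector field on $M$ generated by $\xi\in\mathfrak g$. Suppose that $0$ is a regular value of $\Phi$, that $G$ acts freely on $\Phi^{-1}(0)$, and let $x_0\in\Phi^{-1}(0)$. Let $t\mapsto e^{it\xi}x_0$ denote the integral curve of $JX^\xi$ starting at $x_0$; it exists for all $t\in\mathbb R$. Fix a basis of $\mathfrak g$ (for instance an orthonormal basis for an $\mathrm{Ad}$-invariant inner product), let $d^d\xi$ be Lebesgue measure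 in the corresponding coordinates, $S^{d-1}\subset\mathfrak g$ the unit sphere for the inner product making this basis orthonormal, and $d\Omega$ its surface measure (counting measure if $d=1$). For $a\in\mathbb R$ put $$\mathfrak j_a(k,x_0)=\int_{\mathfrak g}\exp\Big\{\int_0^1\big(-2k\,\phi_\xi(e^{it\xi}x_0)+a\,\Delta\phi_\xi(e^{it\xi}x_0)\big)\,dt\Big\}\,d^d\xi .$$ For integers $j,l,m,r\ge1$ let $$\mathcal P_{j,l}=\Big\{(n_1,\dots,n_l)\in\mathbb Z_{\ge0}^l:\ \textstyle\sum_p n_p=j-l+1,\ \sum_p p\,n_p=j\Big\},\qquad \mathcal Q_{m,r}=\Big\{(n_1,\dots,n_r)\in\mathbb Z_{\ge1}^r:\ \textstyle\sum_i n_i=m\Big\},$$ $$c(j;n_1,\dots,n_l)=\frac{j!}{\prod_{p=1}^l (p!)^{n_p}\,n_p!},\qquad \binom{\alpha}{r}=\frac{\alpha(\alpha-1)\cdots(\alpha-r+1)}{r!},$$ and let $$B_j(x_1,\dots,x_j)=\sum_{l=1}^j\sum_{\vec n\in\mathcal P_{j,l}}c(j;\vec n)\,x_1^{n_1}\cdots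 x_l^{n_l},\qquad \mathcal C_{m,r}(x_1,\dots,x_m)=\sum_{\vec n\in\mathcal Q_{m,r}}x_{n_1}\cdots x_{n_r}$$ be the complete Bell polynomials and the polynomials $\mathcal C_{m,r}$. Below, the sums $\sum_{l=1}^{0}$ and $\sum_{r=1}^{0}$ are understood to be $1$; in particular $B_0=1$. **Theorem.** The integral $\mathfrak j_a(k,x_0)$ converges absolutely for all sufficiently large real $k$, $|X^\xi_{x_0}|>0$ for every $\xi\ne0$, and, as $k\to\infty$, $$\mathfrak j_a(k,x_0)=k^{-d/2}\sum_{j=0}^{\infty}\zeta^{(a)}_{2j}(x_0)\,k^{-j}+o(k^{-\infty}),$$ that is, for every $N\ge 0$, $\mathfrak j_a(k,x_0)-k^{-d/2}\sum_{j=0}^{N}\zeta^{(a)}_{2j}(x_0)k^{-j}=o(k^{-d/2-N})$. Here, for all $j\ge0$, the (absolutely convergent) coefficients are $$\begin{aligned}\zeta_j^{(a)}(x_0)=\tfrac12\,\Gamma\!\left(\tfrac{d+j}{2}\right)\int_{S^{d-1}}\Bigg[&|X^\Omega|^{-(d+j)}\sum_{m=0}^{j}\frac{1}{(j-m)!}\Bigg(\sum_{l=1}^{j-m}\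 \sum_{\vec n\in\mathcal P_{j-m,l}}c(j-m;\vec n)\,a^{n_1+\cdots+n_l}\prod_{p=1}^{l}\big((JX^\Omega)^{p-1}\Delta\phi_\Omega\big)^{n_p}\Bigg)\\ &\times\Bigg(\sum_{r=1}^{m}\binom{-\frac{d+j}{2}}{r}|X^\Omega|^{-2r}\sum_{\vec n\in\mathcal Q_{m,r}}\frac{2^r}{(n_1+2)!\cdots(n_r+2)!}\prod_{i=1}^{r}(JX^\Omega)^{n_i+1}\phi_\Omega\Bigg)\Bigg]_{x_0}d\Omega ,\end{aligned}$$ and $\zeta_j^{(a)}(x_0)=0$ for every odd $j$. Equivalently, put $f(\rho,\Omega)=2\int_0^\rho\phi_\Omega(e^{it\Omega}x_0)\,dt$, $h(\rho,\Omega)=\int_0^\rho\Delta\phi_\Omega(e^{it\Omega}x_0)\,dt$, $g=e^{ah}$, $f_j=\frac1{(j+2)!}\partial_\rho^{j+2}f|_{\rho=0}$, $g_j=\frac1{j!}\partial_\rho^jg|_{\rho=0}$ and $h_j=\frac1{j!}\partial_\rho^jh|_{\rho=0}$. Then $$\begin{aligned}\zeta_j^{(a)}(x_0)&=\tfrac12\Gamma\!\left(\tfrac{d+j}2\right)\int_{S^{d-1}}f_0^{-(d+j)/2}\sum_{m=0}^j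 g_{j-m}\sum_{r=1}^m\binom{-\frac{d+j}2}{r}\frac{\mathcal C_{m,r}(f_1,\dots,f_m)}{f_0^{\,r}}\,d\Omega\\&=\tfrac12\Gamma\!\left(\tfrac{d+j}2\right)\int_{S^{d-1}}f_0^{-(d+j)/2}\sum_{m=0}^j\frac{B_{j-m}\big(a\,1!\,h_1,\,a\,2!\,h_2,\dots,a\,(j-m)!\,h_{j-m}\big)}{(j-m)!}\sum_{r=1}^m\binom{-\frac{d+j}2}{r}\frac{\mathcal C_{m,r}(f_1,\dots,f_m)}{f_0^{\,r}}\,d\Omega ,\end{aligned}$$ where $p!\,h_p=(JX^\Omega)^{p-1}\Delta\phi_\Omega(x_0)$ for $p\ge1$ and $f_p=\frac{2}{(p+2)!}(JX^\Omega)^{p+1}\phi_\Omega(x_0)=\frac{2}{(p+2)!}\big((JX^\Omega)^{p}|X^\Omega|^2\big)(x_0)$ for $p\ge0$. -/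

import Mathlib

open scoped Manifold ContDiff Topology

noncomputable section

namespace KahlerReduction

/-! ## Combinatorics -/

/-- A finite sum, with the convention that an empty sum equals `1`. -/
def sumOrOne {ι : Type*} (s : Finset ι) (F : ι → ℝ) : ℝ :=
  open scoped Classical in if s.Nonempty then ∑ i ∈ s, F i else 1

/-- The generalized binomial coefficient `α (α - 1) ⋯ (α - r + 1) / r!`. -/
def genBinom (α : ℝ) (r : ℕ) : ℝ :=
  (∏ i ∈ Finset.range r, (α - i)) / (r.factorial : ℝ)

/-- The set `P_{j,l}` of tuples `(n_1, …, n_l)` of nonnegative integers such that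
`n_1 + ⋯ + n_l = j - l + 1` and `n_1 + 2 n_2 + ⋯ + l n_l = j`.
The entry `n_p` is stored at the index `p - 1`. -/
def bellIndex (j l : ℕ) : Finset (Fin l → ℕ) :=
  (Fintype.piFinset fun _ => Finset.range (j + 1)).filter fun n =>
    (∑ p, n p) + l = j + 1 ∧ ∑ p : Fin l, ((p : ℕ) + 1) * n p = j

theorem mem_bellIndex {j l : ℕ} {n : Fin l → ℕ} :
    n ∈ bellIndex j l ↔
      (∑ p, n p) + l = j + 1 ∧ ∑ p : Fin l, ((p : ℕ) + 1) * n p = j := by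
  simp only [bellIndex, Finset.mem_filter, Fintype.mem_piFinset, Finset.mem_range,
    and_iff_right_iff_imp]
  rintro ⟨-, h⟩ p
  have h1 : ((p : ℕ) + 1) * n p ≤ ∑ q : Fin l, ((q : ℕ) + 1) * n q :=
    Finset.single_le_sum (f := fun q : Fin l => ((q : ℕ) + 1) * n q)
      (fun _ _ => Nat.zero_le _) (Finset.mem_univ p)
  nlinarith [Nat.zero_le ((p : ℕ) * n p)]

/-- The set `Q_{m,r}` of tuples `(n_1, …, n_r)` of positive integers with sum `m`. -/
def compIndex (m r : ℕ) : Finset (Fin r → ℕ) :=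
  (Fintype.piFinset fun _ => Finset.Icc 1 m).filter fun n => ∑ i, n i = m

theorem mem_compIndex {m r : ℕ} {n : Fin r → ℕ} :
    n ∈ compIndex m r ↔ (∀ i, 1 ≤ n i) ∧ ∑ i, n i = m := by
  simp only [compIndex, Finset.mem_filter, Fintype.mem_piFinset, Finset.mem_Icc]
  constructor
  · rintro ⟨h, h'⟩
    exact ⟨fun i => (h i).1, h'⟩
  · rintro ⟨h, h'⟩
    refine ⟨fun i => ⟨h i, ?_⟩, h'⟩
    rw [← h']
    exact Finset.single_le_sum (fun _ _ => Nat.zero_le _) (Finset.mem_univ i)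

/-- `c(j; n_1, …, n_l) = j! / ((1!)^{n_1} n_1! ⋯ (l!)^{n_l} n_l!)`. -/
def bellCoeff (j : ℕ) {l : ℕ} (n : Fin l → ℕ) : ℝ :=
  (j.factorial : ℝ) /
    ∏ p : Fin l, ((((p : ℕ) + 1).factorial : ℝ) ^ n p * ((n p).factorial : ℝ))

/-- The partial Bell polynomial
`𝓑_{j,l}(x_1, …, x_l) = ∑_{P_{j,l}} c(j; n) x_1^{n_1} ⋯ x_l^{n_l}`. -/
def partialBell (j l : ℕ) (x : ℕ → ℝ) : ℝ :=
  ∑ n ∈ bellIndex j l, bellCoeff j n * ∏ p : Fin l, x ((p : ℕ) + 1) ^ n p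

/-- The complete Bell polynomial `B_j(x_1, …, x_j) = ∑_{l=1}^j 𝓑_{j,l}(x_1, …, x_l)`, with
`B_0 = 1`. -/
def completeBell (j : ℕ) (x : ℕ → ℝ) : ℝ :=
  sumOrOne (Finset.Icc 1 j) fun l => partialBell j l x

/-- The polynomial `C_{m,r}(x_1, …, x_m) = ∑_{Q_{m,r}} x_{n_1} ⋯ x_{n_r}`. -/
def compPoly (m r : ℕ) (x : ℕ → ℝ) : ℝ :=
  ∑ n ∈ compIndex m r, ∏ i, x (n i)

/-! ## Kähler manifolds -/

section Kahler

variable {n : ℕ} {M : Type*} [TopologicalSpace M]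
  [ChartedSpace (EuclideanSpace ℝ (Fin (2 * n))) M]

/-- The derivative `V f` of a function along a vector field. -/
def dirDeriv (V : ∀ x : M, TangentSpace (𝓡 (2 * n)) x) (f : M → ℝ) (x : M) : ℝ :=
  mfderiv (𝓡 (2 * n)) 𝓘(ℝ, ℝ) f x (V x)

/-- The iterated derivative `V^p f` of a function along a vector field. -/
def iterDirDeriv (V : ∀ x : M, TangentSpace (𝓡 (2 * n)) x) (p : ℕ) (f : M → ℝ) : M → ℝ :=
  (dirDeriv V)^[p] f

/-- A vector field is smooth. -/
def SmoothField [IsManifold (𝓡 (2 * n)) ∞ M]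
    (V : ∀ x : M, TangentSpace (𝓡 (2 * n)) x) : Prop :=
  ContMDiff (𝓡 (2 * n)) (𝓡 (2 * n)).tangent ∞
    fun x => (⟨x, V x⟩ : TangentBundle (𝓡 (2 * n)) M)

/-- The time-`t` flow of a vector field, for a vector field all of whose maximal integral curves
are defined on `ℝ`. -/
def flow (V : ∀ x : M, TangentSpace (𝓡 (2 * n)) x) (x : M) : ℝ → M :=
  open scoped Classical in
  if h : ∃ γ : ℝ → M, γ 0 = x ∧ IsMIntegralCurve (I := 𝓡 (2 * n)) γ V then h.choose
  else fun _ => x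

/-- The differential at `y` of a map `z` to `ℂ^n`, defined near `y`. -/
def coordDeriv (z : M → (Fin n → ℂ)) (y : M) (v : TangentSpace (𝓡 (2 * n)) y) : Fin n → ℂ :=
  mfderiv (𝓡 (2 * n)) 𝓘(ℝ, Fin n → ℂ) z y v

variable (n M) in
/-- A Kähler structure on a smooth manifold of real dimension `2 n`: a symplectic form `ω` and a
complex structure `J`, compatible with each other. -/
structure KahlerStructure [IsManifold (𝓡 (2 * n)) ∞ M] where
  /-- the symplectic form -/
  form : ∀ x : M, TangentSpace (𝓡 (2 * n)) x →L[ℝ] TangentSpace (𝓡 (2 * n)) x →L[ℝ] ℝ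
  /-- the complex structure -/
  J : ∀ x : M, TangentSpace (𝓡 (2 * n)) x →L[ℝ] TangentSpace (𝓡 (2 * n)) x
  smooth_form : ContMDiff (𝓡 (2 * n)) ((𝓡 (2 * n)).prod
      𝓘(ℝ, EuclideanSpace ℝ (Fin (2 * n)) →L[ℝ] EuclideanSpace ℝ (Fin (2 * n)) →L[ℝ] ℝ)) ∞
    fun x => Bundle.TotalSpace.mk'
      (EuclideanSpace ℝ (Fin (2 * n)) →L[ℝ] EuclideanSpace ℝ (Fin (2 * n)) →L[ℝ] ℝ)
      (E := fun x : M =>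
        TangentSpace (𝓡 (2 * n)) x →L[ℝ] TangentSpace (𝓡 (2 * n)) x →L[ℝ] ℝ) x (form x)
  smooth_J : ContMDiff (𝓡 (2 * n)) ((𝓡 (2 * n)).prod
      𝓘(ℝ, EuclideanSpace ℝ (Fin (2 * n)) →L[ℝ] EuclideanSpace ℝ (Fin (2 * n)))) ∞
    fun x => Bundle.TotalSpace.mk'
      (EuclideanSpace ℝ (Fin (2 * n)) →L[ℝ] EuclideanSpace ℝ (Fin (2 * n)))
      (E := fun x : M => TangentSpace (𝓡 (2 * n)) x →L[ℝ] TangentSpace (𝓡 (2 * n)) x) x (J x)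
  form_self : ∀ x v, form x v v = 0
  /-- `dω = 0`, through the invariant formula for the exterior derivative -/
  form_closed : ∀ X Y Z : ∀ x : M, TangentSpace (𝓡 (2 * n)) x,
    SmoothField X → SmoothField Y → SmoothField Z → ∀ x,
      dirDeriv X (fun y => form y (Y y) (Z y)) x - dirDeriv Y (fun y => form y (X y) (Z y)) x
        + dirDeriv Z (fun y => form y (X y) (Y y)) x
        - form x (VectorField.mlieBracket (𝓡 (2 * n)) X Y x) (Z x)
        + form x (VectorField.mlieBracket (𝓡 (2 * n)) X Z x) (Y x)
        - form x (VectorField.mlieBracket (𝓡 (2 * n)) Y Z x) (X x) = 0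
  J_sq : ∀ x v, J x (J x v) = -v
  /-- `J` is a complex structure: there are holomorphic coordinates near every point -/
  J_integrable : ∀ x : M, ∃ U : Set M, IsOpen U ∧ x ∈ U ∧ ∃ z : M → (Fin n → ℂ),
    ContMDiffOn (𝓡 (2 * n)) 𝓘(ℝ, Fin n → ℂ) ∞ z U ∧
      ∀ y ∈ U, Function.Bijective (coordDeriv z y) ∧
        ∀ v, coordDeriv z y (J y v) = Complex.I • coordDeriv z y v
  form_J : ∀ x v w, form x (J x v) (J x w) = form x v w
  pos : ∀ x v, v ≠ 0 → 0 < form x v (J x v)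

namespace KahlerStructure

variable [IsManifold (𝓡 (2 * n)) ∞ M] (K : KahlerStructure n M)

/-- The Kähler metric `B = ω(·, J ·)`. -/
def metric (x : M) (v w : TangentSpace (𝓡 (2 * n)) x) : ℝ := K.form x v (K.J x w)

/-- The length of a tangent vector for the Kähler metric. -/
def length (x : M) (v : TangentSpace (𝓡 (2 * n)) x) : ℝ := Real.sqrt (K.metric x v v)

theorem exists_grad (f : M → ℝ) (x : M) : ∃ v : TangentSpace (𝓡 (2 * n)) x,
    ∀ w, K.metric x v w = mfderiv (𝓡 (2 * n)) 𝓘(ℝ, ℝ) f x w := by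
  let E := EuclideanSpace ℝ (Fin (2 * n))
  let A : E →ₗ[ℝ] Module.Dual ℝ E :=
    { toFun := fun v =>
        { toFun := fun w => K.metric x v w
          map_add' := fun w w' => by
            simp only [metric]; exact (congrArg (K.form x v) (map_add (K.J x) w w')).trans
              (map_add (K.form x v) _ _)
          map_smul' := fun c w => by
            simp only [metric]; exact (congrArg (K.form x v) (map_smul (K.J x) c w)).trans
              (map_smul (K.form x v) c _) }
      map_add' := fun v v' => by
        ext w; exact congrArg (fun L => L (K.J x w)) (map_add (K.form x) v v')
      map_smul' := fun c v => by
        ext w; exact congrArg (fun L => L (K.J x w)) (map_smul (K.form x) c v) }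
  have hA : Function.Injective A := by
    rw [injective_iff_map_eq_zero]
    intro v hv
    by_contra h
    have h1 := K.pos x v h
    have h2 : K.form x v (K.J x v) = 0 := congrArg (fun L : Module.Dual ℝ E => L v) hv
    exact h1.ne' h2
  have hS : Function.Surjective A :=
    (LinearMap.injective_iff_surjective_of_finrank_eq_finrank
      (Subspace.dual_finrank_eq (K := ℝ) (V := E)).symm).1 hA
  let L : Module.Dual ℝ E :=
    { toFun := fun w => mfderiv (𝓡 (2 * n)) 𝓘(ℝ, ℝ) f x w
      map_add' := fun w w' => map_add (mfderiv (𝓡 (2 * n)) 𝓘(ℝ, ℝ) f x) w w'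
      map_smul' := fun c w => map_smul (mfderiv (𝓡 (2 * n)) 𝓘(ℝ, ℝ) f x) c w }
  obtain ⟨v, hv⟩ := hS L
  exact ⟨v, fun w => congrArg (fun T : Module.Dual ℝ E => T w) hv⟩

/-- The gradient of `f`, the vector field such that `B(grad f, ·) = df`. -/
def grad (f : M → ℝ) (x : M) : TangentSpace (𝓡 (2 * n)) x :=
  (K.exists_grad f x).choose

/-- The `2 n`-form `ω^n = ω ∧ ⋯ ∧ ω`. -/
def omegaPow (x : M) (v : Fin (2 * n) → TangentSpace (𝓡 (2 * n)) x) : ℝ :=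
  (1 / 2 ^ n : ℝ) * ∑ σ : Equiv.Perm (Fin (2 * n)),
    ((Equiv.Perm.sign σ : ℤ) : ℝ) *
      ∏ i : Fin n, K.form x (v (σ ⟨2 * (i : ℕ), by omega⟩)) (v (σ ⟨2 * (i : ℕ) + 1, by omega⟩))

/-- The value at `x` of `(L_X ω^n)(Y_1, …, Y_{2n})`, that is,
`X (ω^n (Y_1, …, Y_{2n})) - ∑_i ω^n (Y_1, …, [X, Y_i], …, Y_{2n})`. -/
def lieDerivOmegaPow (X : ∀ x : M, TangentSpace (𝓡 (2 * n)) x)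
    (Y : Fin (2 * n) → ∀ x : M, TangentSpace (𝓡 (2 * n)) x) (x : M) : ℝ :=
  dirDeriv X (fun y => K.omegaPow y fun i => Y i y) x -
    ∑ i, K.omegaPow x
      (Function.update (fun j => Y j x) i (VectorField.mlieBracket (𝓡 (2 * n)) X (Y i) x))

/-- The coordinate vector fields of the preferred chart at `x`. -/
def coordFrame (x : M) (i : Fin (2 * n)) (y : M) : TangentSpace (𝓡 (2 * n)) y :=
  (trivializationAt (EuclideanSpace ℝ (Fin (2 * n)))
    (TangentSpace (𝓡 (2 * n)) : M → Type _) x).localFrame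
      (EuclideanSpace.basisFun (Fin (2 * n)) ℝ).toBasis i y

/-- The divergence `div X = L_X ω^n / ω^n`. The quotient of the two top degree forms is computed at
`x` on a coordinate frame around `x`. -/
def divergence (X : ∀ x : M, TangentSpace (𝓡 (2 * n)) x) (x : M) : ℝ :=
  K.lieDerivOmegaPow X (coordFrame x) x / K.omegaPow x fun i => coordFrame x i x

/-- The Laplacian `Δ f = div grad f`. -/
def laplacian (f : M → ℝ) (x : M) : ℝ := K.divergence (K.grad f) x

end KahlerStructure

/-! ## Hamiltonian actions -/

variable {d : ℕ} {G : Type*} [Group G] [TopologicalSpace G]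
  [ChartedSpace (EuclideanSpace ℝ (Fin d)) G]

/-- The infinitesimal action: `X^ξ` is the derivative at `1` of `g ↦ g • x` in direction `ξ`. -/
def infAction [MulAction G M] (ξ : GroupLieAlgebra (𝓡 d) G) (x : M) :
    TangentSpace (𝓡 (2 * n)) x :=
  (mfderiv (𝓡 d) (𝓡 (2 * n)) (fun g : G => g • x) 1 ξ : EuclideanSpace ℝ (Fin (2 * n)))

/-- The adjoint action of `g` on the Lie algebra: the derivative at `1` of `h ↦ g h g⁻¹`. -/
def adjoint (g : G) (ξ : GroupLieAlgebra (𝓡 d) G) : GroupLieAlgebra (𝓡 d) G :=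
  (mfderiv (𝓡 d) (𝓡 d) (fun h : G => g * h * g⁻¹) 1 ξ : EuclideanSpace ℝ (Fin d))

variable [IsManifold (𝓡 (2 * n)) ∞ M]

/-- The action of `G` on `M` (assumed smooth separately) preserves the Kähler structure and is
Hamiltonian with moment map `Φ`, whose components are `φ_ξ = Φ(·)(ξ)`. -/
structure IsHamiltonian [MulAction G M] (K : KahlerStructure n M)
    (Φ : M → Module.Dual ℝ (GroupLieAlgebra (𝓡 d) G)) : Prop where
  map_form : ∀ (g : G) (x : M) (v w : TangentSpace (𝓡 (2 * n)) x),
    K.form (g • x) (mfderiv (𝓡 (2 * n)) (𝓡 (2 * n)) (fun y : M => g • y) x v)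
      (mfderiv (𝓡 (2 * n)) (𝓡 (2 * n)) (fun y : M => g • y) x w) = K.form x v w
  map_J : ∀ (g : G) (x : M) (v : TangentSpace (𝓡 (2 * n)) x),
    K.J (g • x) (mfderiv (𝓡 (2 * n)) (𝓡 (2 * n)) (fun y : M => g • y) x v) =
      mfderiv (𝓡 (2 * n)) (𝓡 (2 * n)) (fun y : M => g • y) x (K.J x v)
  smooth_Φ : ∀ ξ, ContMDiff (𝓡 (2 * n)) 𝓘(ℝ, ℝ) ∞ fun x => Φ x ξ
  /-- `dφ_ξ = ω(X^ξ, ·)` -/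
  hamilton : ∀ (ξ : GroupLieAlgebra (𝓡 d) G) (x : M) (v : TangentSpace (𝓡 (2 * n)) x),
    mfderiv (𝓡 (2 * n)) 𝓘(ℝ, ℝ) (fun y => Φ y ξ) x v = K.form x (infAction ξ x) v
  equivariant : ∀ (g : G) (x : M) (ξ : GroupLieAlgebra (𝓡 d) G),
    Φ (g • x) (adjoint g ξ) = Φ x ξ

/-- `0` is a regular value of `Φ`: the differential of `Φ` is onto at every point of `Φ⁻¹(0)`. -/
def ZeroIsRegularValue (Φ : M → Module.Dual ℝ (GroupLieAlgebra (𝓡 d) G)) : Prop :=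
  ∀ x, Φ x = 0 → ∀ α : Module.Dual ℝ (GroupLieAlgebra (𝓡 d) G),
    ∃ v : TangentSpace (𝓡 (2 * n)) x,
      ∀ ξ, mfderiv (𝓡 (2 * n)) 𝓘(ℝ, ℝ) (fun y => Φ y ξ) x v = α ξ

variable [MulAction G M] (K : KahlerStructure n M)
  (Φ : M → Module.Dual ℝ (GroupLieAlgebra (𝓡 d) G))

/-- The vector field `J X^ξ`, the infinitesimal action of `√-1 ξ`. -/
def imagField (ξ : GroupLieAlgebra (𝓡 d) G) (x : M) : TangentSpace (𝓡 (2 * n)) x :=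
  K.J x (infAction ξ x)

/-- The curve `t ↦ e^{i t ξ} x`, that is, the flow of `J X^ξ`. -/
def imagExp (ξ : GroupLieAlgebra (𝓡 d) G) (x : M) (t : ℝ) : M :=
  flow (imagField K ξ) x t

/-- The Laplacian `Δφ_ξ` of the component `φ_ξ` of the moment map. -/
def lapMoment (ξ : GroupLieAlgebra (𝓡 d) G) : M → ℝ :=
  K.laplacian fun y => Φ y ξ

/-- `f(ρ) = 2 ∫_0^ρ φ_Ω(e^{itΩ} x₀) dt`. -/
def radialF (ξ : GroupLieAlgebra (𝓡 d) G) (x₀ : M) (ρ : ℝ) : ℝ :=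
  2 * ∫ t in (0 : ℝ)..ρ, Φ (imagExp K ξ x₀ t) ξ

/-- `h(ρ) = ∫_0^ρ Δφ_Ω(e^{itΩ} x₀) dt`. -/
def radialH (ξ : GroupLieAlgebra (𝓡 d) G) (x₀ : M) (ρ : ℝ) : ℝ :=
  ∫ t in (0 : ℝ)..ρ, lapMoment K Φ ξ (imagExp K ξ x₀ t)

/-- `f_j = (1 / (j+2)!) ∂^{j+2} f / ∂ρ^{j+2}` at `ρ = 0`. -/
def coeffF (ξ : GroupLieAlgebra (𝓡 d) G) (x₀ : M) (j : ℕ) : ℝ :=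
  iteratedDeriv (j + 2) (radialF K Φ ξ x₀) 0 / ((j + 2).factorial : ℝ)

/-- The Taylor coefficients of `g = exp (a h)` at `ρ = 0`. -/
def coeffG (a : ℝ) (ξ : GroupLieAlgebra (𝓡 d) G) (x₀ : M) (j : ℕ) : ℝ :=
  iteratedDeriv j (fun ρ => Real.exp (a * radialH K Φ ξ x₀ ρ)) 0 / (j.factorial : ℝ)

/-- The Taylor coefficients of `h` at `ρ = 0`. -/
def coeffH (ξ : GroupLieAlgebra (𝓡 d) G) (x₀ : M) (j : ℕ) : ℝ :=
  iteratedDeriv j (radialH K Φ ξ x₀) 0 / (j.factorial : ℝ)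

/-- The vector `∑ ξ^i e_i` of the Lie algebra with coordinates `ξ` in the basis `e`. -/
def lieVec (e : Module.Basis (Fin d) ℝ (GroupLieAlgebra (𝓡 d) G))
    (ξ : EuclideanSpace ℝ (Fin d)) : GroupLieAlgebra (𝓡 d) G :=
  ∑ i, ξ i • e i

variable (e : Module.Basis (Fin d) ℝ (GroupLieAlgebra (𝓡 d) G))

/-- The integrand
`exp (∫_0^1 (-2 k φ_ξ(e^{itξ} x₀) + a Δφ_ξ(e^{itξ} x₀)) dt)` of the density. -/
def densityIntegrand (a k : ℝ) (x₀ : M) (ξ : EuclideanSpace ℝ (Fin d)) : ℝ :=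
  Real.exp (∫ t in (0 : ℝ)..1,
    (-2 * k * Φ (imagExp K (lieVec e ξ) x₀ t) (lieVec e ξ)
      + a * lapMoment K Φ (lieVec e ξ) (imagExp K (lieVec e ξ) x₀ t)))

/-- The density `j_a(k, x₀)`. -/
def density (a k : ℝ) (x₀ : M) : ℝ :=
  ∫ ξ : EuclideanSpace ℝ (Fin d), densityIntegrand K Φ e a k x₀ ξ

/-- The integrand of `ζ_j^{(a)}(x₀)`, as a function of the vector `Ω` of the Lie algebra. -/
def zetaIntegrand (a : ℝ) (x₀ : M) (j : ℕ) (Ω : GroupLieAlgebra (𝓡 d) G) : ℝ :=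
  (K.length x₀ (infAction Ω x₀) ^ (d + j))⁻¹ *
    ∑ m ∈ Finset.range (j + 1),
      (1 / ((j - m).factorial : ℝ)) *
      sumOrOne (Finset.Icc 1 (j - m)) (fun l =>
        ∑ q ∈ bellIndex (j - m) l, bellCoeff (j - m) q * a ^ (∑ p, q p) *
          ∏ p : Fin l, iterDirDeriv (imagField K Ω) (p : ℕ) (lapMoment K Φ Ω) x₀ ^ q p) *
      sumOrOne (Finset.Icc 1 m) (fun r =>
        genBinom (-(((d : ℝ) + j) / 2)) r *
          (K.length x₀ (infAction Ω x₀) ^ (2 * r))⁻¹ *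
          ∑ q ∈ compIndex m r, 2 ^ r / (∏ i, ((q i + 2).factorial : ℝ)) *
            ∏ i, iterDirDeriv (imagField K Ω) (q i + 1) (fun y => Φ y Ω) x₀)

/-- The coefficient `ζ_j^{(a)}(x₀)`. -/
def zeta (a : ℝ) (x₀ : M) (j : ℕ) : ℝ :=
  (1 / 2) * Real.Gamma (((d : ℝ) + j) / 2) *
    ∫ Ω : Metric.sphere (0 : EuclideanSpace ℝ (Fin d)) 1,
      zetaIntegrand K Φ a x₀ j (lieVec e Ω)
        ∂(MeasureTheory.volume : MeasureTheory.Measure (EuclideanSpace ℝ (Fin d))).toSphere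

end Kahler

end KahlerReduction

end

open KahlerReduction

noncomputable section

namespace KahlerReduction

/-! ## Formal exponentials -/

/-! Put `ε = k^(-1/2)` and replace `ξ` by `εξ`. Since `e^{it(εξ)} = e^{i(εt)ξ}`, the density becomes
`k^(-d/2)` times the integral of `exp (-f(ε,ξ)/ε² + a h(ε,ξ))`, with `f(ρ,ξ)` and `h(ρ,ξ)` the
integrals of `2φ_ξ` and `Δφ_ξ` along the curve up to time `ρ` (`IsHamiltonian.density_eq`).

The gradient of `φ_ξ` is `JX^ξ`, so `φ_ξ` has derivative `|X^ξ|²` along the curve and `f` is convex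
in `ρ`. At a zero of the moment map `f` starts with `f_0 ρ²`, where `f_0 = |X^ξ|²` is a positive
definite quadratic form in `ξ` because `0` is a regular value. Convexity and compactness of the
sphere give `f ≥ c s²/(1+s)` with `s = ε‖ξ‖`, while `h` is at most linear in `s`. For all small `ε`
the integrand is therefore dominated by a multiple of `exp (-‖ξ‖)`
(`IsHamiltonian.exists_radialF_lower_bound`, `le_sq_div_sub`).

The Taylor coefficients `f_j`, `h_j` are homogeneous in `ξ` of degrees `j+2` and `j`, and since `M`
is compact the remainders are polynomially bounded in `ξ`. Exponentiating the formal series and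
integrating against `exp (-f_0)` gives an expansion in powers of `ε`
(`exists_abs_integral_exp_sub_le`), whose odd terms vanish under `ξ ↦ -ξ`.

In polar coordinates, a product containing `r` factors `f_i` has degree `j+2r` and contributes
`Γ((d+j)/2 + r)`; `Gamma_mul_genBinom` turns this into `Γ((d+j)/2)` times a binomial coefficient,
which is the stated formula. Bell polynomials enter as the coefficients of a formal exponential
(`completeBell_eq`).

The geometric inputs are that `Δφ_ξ` is smooth and linear in `ξ` (tensoriality of `L_X ω^n`), and
that the flow of `JX^ξ` is complete and depends continuously on `ξ` (`continuous_flow`). -/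

open PowerSeries in
/-- The exponential of a formal power series without constant term. -/
def expSeries (U : PowerSeries ℝ) : PowerSeries ℝ :=
  PowerSeries.mk fun j => ∑ k ∈ Finset.range (j + 1), coeff j (U ^ k) / (k.factorial : ℝ)

theorem coeff_pow_eq_zero_of_lt {U : PowerSeries ℝ} (hU : PowerSeries.constantCoeff U = 0)
    {j k : ℕ} (h : j < k) : PowerSeries.coeff j (U ^ k) = 0 := by
  refine PowerSeries.coeff_of_lt_order _ (lt_of_lt_of_le ?_ (PowerSeries.le_order_pow_of_constantCoeff_eq_zero k hU))
  exact_mod_cast h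

/-- Without constant term, `U ^ k` starts in degree `k`, so any cut-off beyond `j` gives the same
sum. The freedom in `N` lets several coefficients share one range. -/
theorem coeff_expSeries {U : PowerSeries ℝ} (hU : PowerSeries.constantCoeff U = 0)
    {j N : ℕ} (h : j < N) : PowerSeries.coeff j (expSeries U) =
      ∑ k ∈ Finset.range N, PowerSeries.coeff j (U ^ k) / (k.factorial : ℝ) := by
  rw [expSeries, PowerSeries.coeff_mk]
  refine Finset.sum_subset (Finset.range_subset_range.2 h) fun k _ hk => ?_
  rw [coeff_pow_eq_zero_of_lt hU (by simpa using hk), zero_div]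

theorem constantCoeff_expSeries (U : PowerSeries ℝ) :
    PowerSeries.constantCoeff (expSeries U) = 1 := by
  rw [← PowerSeries.coeff_zero_eq_constantCoeff_apply, expSeries, PowerSeries.coeff_mk]
  simp

theorem derivative_expSeries {U : PowerSeries ℝ} (hU : PowerSeries.constantCoeff U = 0) :
    PowerSeries.derivative ℝ (expSeries U) = PowerSeries.derivative ℝ U * expSeries U := by
  ext j
  rw [PowerSeries.coeff_derivative, coeff_expSeries hU (Nat.lt_succ_self (j + 1)), Finset.sum_mul,
    Finset.sum_range_succ']
  have h0 : PowerSeries.coeff (j + 1) (U ^ 0) = 0 := by simp [PowerSeries.coeff_one]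
  rw [h0, zero_div, zero_mul, add_zero]
  have h1 : ∀ k, PowerSeries.coeff (j + 1) (U ^ (k + 1)) / ((k + 1).factorial : ℝ) * ((j : ℝ) + 1) =
      PowerSeries.coeff j (PowerSeries.derivative ℝ U * U ^ k) / (k.factorial : ℝ) := by
    intro k
    have := PowerSeries.coeff_derivative (R := ℝ) (U ^ (k + 1)) j
    rw [div_mul_eq_mul_div, ← this, Derivation.leibniz_pow]
    simp only [Nat.add_sub_cancel, smul_eq_mul, Nat.factorial_succ, nsmul_eq_mul]
    rw [mul_comm (U ^ k), ← nsmul_eq_mul, map_nsmul, nsmul_eq_mul]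
    push_cast
    field_simp
  simp_rw [h1]
  simp only [PowerSeries.coeff_mul, Finset.sum_div]
  rw [Finset.sum_comm]
  refine Finset.sum_congr rfl fun p hp => ?_
  rw [coeff_expSeries hU (show p.2 < j + 1 by have := Finset.HasAntidiagonal.mem_antidiagonal.1 hp; omega),
    Finset.mul_sum]
  exact Finset.sum_congr rfl fun k _ => by ring

/-- The equation `E' = U' E` determines the coefficient of degree `j + 1` from the lower ones. This
uniqueness identifies `expSeries` with products of exponentials and with Taylor series of
exponentials. -/
theorem eq_of_derivative_eq_mul {U E₁ E₂ : PowerSeries ℝ}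
    (h0 : PowerSeries.constantCoeff E₁ = PowerSeries.constantCoeff E₂)
    (h1 : PowerSeries.derivative ℝ E₁ = PowerSeries.derivative ℝ U * E₁)
    (h2 : PowerSeries.derivative ℝ E₂ = PowerSeries.derivative ℝ U * E₂) : E₁ = E₂ := by
  ext j
  induction j using Nat.strong_induction_on with
  | _ j ih =>
    cases j with
    | zero => simpa using h0
    | succ j =>
      have e1 := congrArg (PowerSeries.coeff j) h1
      have e2 := congrArg (PowerSeries.coeff j) h2
      rw [PowerSeries.coeff_derivative, PowerSeries.coeff_mul] at e1 e2
      have hj : ((j : ℝ) + 1) ≠ 0 := by positivity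
      refine mul_right_cancel₀ hj (e1.trans (Eq.trans ?_ e2.symm))
      refine Finset.sum_congr rfl fun p hp => ?_
      rw [ih p.2 (by have := Finset.HasAntidiagonal.mem_antidiagonal.1 hp; omega)]

theorem expSeries_add {U V : PowerSeries ℝ} (hU : PowerSeries.constantCoeff U = 0)
    (hV : PowerSeries.constantCoeff V = 0) : expSeries (U + V) = expSeries U * expSeries V := by
  refine eq_of_derivative_eq_mul (U := U + V) ?_ (derivative_expSeries (by simp [hU, hV])) ?_
  · simp [constantCoeff_expSeries]
  · rw [Derivation.leibniz, derivative_expSeries hU, derivative_expSeries hV, map_add]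
    simp only [smul_eq_mul]
    ring

/-! ## Asymptotic expansions with weights -/

theorem mul_pow_mul_le {A y B : ℝ} {m n : ℕ} (hA : 0 ≤ A) (hy : 1 ≤ y) (h : m ≤ n) (hB : 0 ≤ B) :
    A * y ^ m * B ≤ A * y ^ n * B :=
  mul_le_mul_of_nonneg_right (mul_le_mul_of_nonneg_left (pow_le_pow_right₀ hy h) hA) hB

/-- `u x ε` has the expansion `∑ c_j(x) ε ^ j` as `ε → 0`, with remainders bounded by powers of the
weight `w x`. -/
def HasExpansion {X : Type*} (w : X → ℝ) (u : X → ℝ → ℝ) (c : X → PowerSeries ℝ) : Prop :=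
  ∀ J : ℕ, ∃ C : ℝ, ∃ M : ℕ, 0 ≤ C ∧ ∀ x, ∀ ε : ℝ, 0 < ε → ε ≤ 1 →
    |u x ε - ∑ j ∈ Finset.range J, PowerSeries.coeff j (c x) * ε ^ j| ≤ C * w x ^ M * ε ^ J

namespace HasExpansion

variable {X : Type*} {w : X → ℝ} {u v : X → ℝ → ℝ} {c b : X → PowerSeries ℝ}

/-- The coefficient of degree `j` is the difference of the remainders of orders `j` and `j + 1` at
`ε = 1`. -/
theorem coeff_le (hw : ∀ x, 1 ≤ w x) (hu : HasExpansion w u c) (j : ℕ) :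
    ∃ C : ℝ, ∃ M : ℕ, 0 ≤ C ∧ ∀ x, |PowerSeries.coeff j (c x)| ≤ C * w x ^ M := by
  obtain ⟨C, M, hC, h⟩ := hu j
  obtain ⟨C', M', hC', h'⟩ := hu (j + 1)
  refine ⟨C + C', M + M', by positivity, fun x => ?_⟩
  have e1 := h x 1 one_pos le_rfl
  have e2 := h' x 1 one_pos le_rfl
  rw [Finset.sum_range_succ] at e2
  simp only [one_pow, mul_one] at e1 e2
  have hw0 := hw x
  have m1 : w x ^ M ≤ w x ^ (M + M') := pow_le_pow_right₀ hw0 (by omega)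
  have m2 : w x ^ M' ≤ w x ^ (M + M') := pow_le_pow_right₀ hw0 (by omega)
  have n1 := mul_le_mul_of_nonneg_left m1 hC
  have n2 := mul_le_mul_of_nonneg_left m2 hC'
  rw [abs_le] at e1 e2 ⊢
  constructor <;> nlinarith

theorem add (hw : ∀ x, 1 ≤ w x) (hu : HasExpansion w u c) (hv : HasExpansion w v b) :
    HasExpansion w (fun x ε => u x ε + v x ε) (fun x => c x + b x) := by
  intro J
  obtain ⟨C, M, hC, h⟩ := hu J
  obtain ⟨C', M', hC', h'⟩ := hv J
  refine ⟨C + C', M + M', by positivity, fun x ε h0 h1 => ?_⟩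
  have hw0 := hw x
  have m1 : w x ^ M ≤ w x ^ (M + M') := pow_le_pow_right₀ hw0 (by omega)
  have m2 : w x ^ M' ≤ w x ^ (M + M') := pow_le_pow_right₀ hw0 (by omega)
  simp only [map_add, add_mul, Finset.sum_add_distrib]
  rw [add_sub_add_comm]
  refine (abs_add_le _ _).trans (add_le_add ((h x ε h0 h1).trans ?_) ((h' x ε h0 h1).trans ?_)) <;>
  gcongr

theorem const_mul (hu : HasExpansion w u c) (a : ℝ) :
    HasExpansion w (fun x ε => a * u x ε) (fun x => a • c x) := by
  intro J
  obtain ⟨C, M, hC, h⟩ := hu J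
  refine ⟨|a| * C, M, by positivity, fun x ε h0 h1 => ?_⟩
  have e : a * u x ε - ∑ j ∈ Finset.range J, PowerSeries.coeff j (a • c x) * ε ^ j =
      a * (u x ε - ∑ j ∈ Finset.range J, PowerSeries.coeff j (c x) * ε ^ j) := by
    rw [mul_sub, Finset.mul_sum]
    congr 1
    exact Finset.sum_congr rfl fun j _ => by simp [mul_assoc]
  rw [e, abs_mul]
  calc |a| * _ ≤ |a| * (C * w x ^ M * ε ^ J) := by gcongr; exact h x ε h0 h1
    _ = _ := by ring

theorem one : HasExpansion w (fun _ _ => 1) (fun _ => 1) := by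
  intro J
  refine ⟨1, 0, by positivity, fun x ε h0 h1 => ?_⟩
  cases J with
  | zero => simp
  | succ J =>
    rw [Finset.sum_range_succ']
    simp [PowerSeries.coeff_one]
    positivity

theorem mul (hw : ∀ x, 1 ≤ w x) (hu : HasExpansion w u c) (hv : HasExpansion w v b) :
    HasExpansion w (fun x ε => u x ε * v x ε) (fun x => c x * b x) := by
  intro J
  obtain ⟨C, M, hC, h⟩ := hu J
  -- At order `0` the subtracted sum is empty, so this is a bound for `v` itself.
  obtain ⟨D, N, hD, h'⟩ := hv 0
  choose A P hA hAP using hu.coeff_le hw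
  choose B Q hB hBQ using hv
  set T := ∑ i ∈ Finset.range J, (P i + Q (J - i)) with hT
  refine ⟨C * D + ∑ i ∈ Finset.range J, A i * B (J - i), M + N + T, ?_, fun x ε h0 h1 => ?_⟩
  · have := Finset.sum_nonneg fun i (_ : i ∈ Finset.range J) => mul_nonneg (hA i) (hB (J - i))
    positivity
  have hw0 := hw x
  -- The `i`-th term of `u` already carries `ε ^ i`, so `v` need only be expanded to order `J - i`
  -- against it; every summand is then of order `ε ^ J`.
  have e : u x ε * v x ε - ∑ j ∈ Finset.range J, PowerSeries.coeff j (c x * b x) * ε ^ j =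
      (u x ε - ∑ j ∈ Finset.range J, PowerSeries.coeff j (c x) * ε ^ j) * v x ε +
      ∑ i ∈ Finset.range J, PowerSeries.coeff i (c x) * ε ^ i *
        (v x ε - ∑ j ∈ Finset.range (J - i), PowerSeries.coeff j (b x) * ε ^ j) := by
    have e1 : ∑ j ∈ Finset.range J, PowerSeries.coeff j (c x * b x) * ε ^ j =
        ∑ i ∈ Finset.range J, ∑ j ∈ Finset.range (J - i),
          (PowerSeries.coeff i (c x) * ε ^ i) * (PowerSeries.coeff j (b x) * ε ^ j) := by
      rw [← Finset.sum_range_diag_flip J fun i j =>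
        (PowerSeries.coeff i (c x) * ε ^ i) * (PowerSeries.coeff j (b x) * ε ^ j)]
      refine Finset.sum_congr rfl fun j _ => ?_
      rw [PowerSeries.coeff_mul, Finset.Nat.sum_antidiagonal_eq_sum_range_succ
        (fun p q => PowerSeries.coeff p (c x) * PowerSeries.coeff q (b x)), Finset.sum_mul]
      refine Finset.sum_congr rfl fun i hi => ?_
      have : ε ^ j = ε ^ i * ε ^ (j - i) := by
        rw [← pow_add]; congr 1; have := Finset.mem_range.1 hi; omega
      rw [this]; ring
    rw [e1]
    simp only [mul_sub, Finset.sum_sub_distrib, Finset.mul_sum, sub_mul, Finset.sum_mul]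
    ring
  rw [e]
  have b1 : |(u x ε - ∑ j ∈ Finset.range J, PowerSeries.coeff j (c x) * ε ^ j) * v x ε| ≤
      C * D * w x ^ (M + N + T) * ε ^ J := by
    have k1 := h x ε h0 h1
    have k2 := h' x ε h0 h1
    simp only [Finset.range_zero, Finset.sum_empty, sub_zero, pow_zero, mul_one] at k2
    rw [abs_mul]
    calc _ ≤ (C * w x ^ M * ε ^ J) * (D * w x ^ N) := by gcongr
      _ = C * D * w x ^ (M + N) * ε ^ J := by ring
      _ ≤ _ := mul_pow_mul_le (by positivity) hw0 (by omega) (by positivity)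
  have b2 : ∀ i ∈ Finset.range J, |PowerSeries.coeff i (c x) * ε ^ i *
        (v x ε - ∑ j ∈ Finset.range (J - i), PowerSeries.coeff j (b x) * ε ^ j)| ≤
      A i * B (J - i) * w x ^ (M + N + T) * ε ^ J := by
    intro i hi
    have k1 := hAP i x
    have k2 := hBQ (J - i) x ε h0 h1
    have hle : P i + Q (J - i) ≤ T :=
      Finset.single_le_sum (f := fun i => P i + Q (J - i)) (fun _ _ => Nat.zero_le _) hi
    have := hA i
    have := hB (J - i)
    rw [abs_mul, abs_mul, abs_of_pos (pow_pos h0 i)]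
    calc _ ≤ (A i * w x ^ P i * ε ^ i) * (B (J - i) * w x ^ Q (J - i) * ε ^ (J - i)) := by gcongr
      _ = A i * B (J - i) * w x ^ (P i + Q (J - i)) * ε ^ (i + (J - i)) := by ring
      _ = A i * B (J - i) * w x ^ (P i + Q (J - i)) * ε ^ J := by
        congr 2; have := Finset.mem_range.1 hi; omega
      _ ≤ _ := mul_pow_mul_le (by positivity) hw0 (by omega) (by positivity)
  refine (abs_add_le _ _).trans ?_
  rw [add_mul, add_mul, Finset.sum_mul, Finset.sum_mul]
  exact add_le_add b1 ((Finset.abs_sum_le_sum_abs _ _).trans (Finset.sum_le_sum b2))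

theorem pow (hw : ∀ x, 1 ≤ w x) (hu : HasExpansion w u c) (k : ℕ) :
    HasExpansion w (fun x ε => u x ε ^ k) (fun x => c x ^ k) := by
  induction k with
  | zero => simpa using one
  | succ k ih => simpa only [pow_succ] using ih.mul hw hu

theorem sum {ι : Type*} (hw : ∀ x, 1 ≤ w x) (s : Finset ι) {u : ι → X → ℝ → ℝ}
    {c : ι → X → PowerSeries ℝ} (hu : ∀ i ∈ s, HasExpansion w (u i) (c i)) :
    HasExpansion w (fun x ε => ∑ i ∈ s, u i x ε) (fun x => ∑ i ∈ s, c i x) := by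
  classical
  induction s using Finset.induction_on with
  | empty =>
    intro J
    refine ⟨0, 0, le_rfl, fun x ε _ _ => by simp⟩
  | insert i s hi ih =>
    simp only [Finset.sum_insert hi]
    exact (hu i (by simp)).add hw (ih fun k hk => hu k (by simp [hk]))

end HasExpansion

/-- The derivative of the remainder of order `J + 1` is the remainder of order `J`, so the mean
value inequality on `[x, 0]` gains one factor `|x|`. -/
theorem abs_exp_sub_sum_le_of_nonpos (J : ℕ) {x : ℝ} (hx : x ≤ 0) :
    |Real.exp x - ∑ k ∈ Finset.range J, x ^ k / (k.factorial : ℝ)| ≤ |x| ^ J := by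
  induction J generalizing x with
  | zero => simpa using Real.exp_le_one_iff.2 hx
  | succ J ih =>
    set r : ℝ → ℝ := fun y => Real.exp y - ∑ k ∈ Finset.range (J + 1), y ^ k / (k.factorial : ℝ)
    have hr : ∀ y, HasDerivAt r
        (Real.exp y - ∑ k ∈ Finset.range J, y ^ k / (k.factorial : ℝ)) y := by
      intro y
      refine (Real.hasDerivAt_exp y).sub ?_
      have : HasDerivAt (fun y : ℝ => ∑ k ∈ Finset.range (J + 1), y ^ k / (k.factorial : ℝ))
          (∑ k ∈ Finset.range (J + 1), (k * y ^ (k - 1)) / (k.factorial : ℝ)) y :=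
        HasDerivAt.fun_sum fun k _ => (hasDerivAt_pow k y).div_const _
      refine this.congr_deriv ?_
      rw [Finset.sum_range_succ']
      simp only [Nat.cast_zero, zero_mul, zero_div, add_zero]
      refine Finset.sum_congr rfl fun k _ => ?_
      rw [Nat.factorial_succ]
      push_cast
      have : (k : ℝ) + 1 ≠ 0 := by positivity
      field_simp
    have h0 : r 0 = 0 := by
      simp only [r]
      rw [Finset.sum_range_succ']
      simp
    have := (convex_Icc x 0).norm_image_sub_le_of_norm_hasDerivWithin_le (f := r) (C := |x| ^ J)
      (fun y _ => (hr y).hasDerivWithinAt) (fun y hy => (ih hy.2).trans (by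
        gcongr 1
        rw [abs_of_nonpos hy.2, abs_of_nonpos hx]
        linarith [hy.1])) (Set.right_mem_Icc.2 hx) (Set.left_mem_Icc.2 hx)
    rw [h0, sub_zero, sub_zero] at this
    simpa [pow_succ] using this

/-- The factor is `1 + exp x` and not `exp |x|`: after multiplication by `exp (-q)` only `exp (-q)`
and `exp (-q + u)` are known to be integrable. -/
theorem abs_exp_sub_sum_le (J : ℕ) (x : ℝ) :
    |Real.exp x - ∑ k ∈ Finset.range J, x ^ k / (k.factorial : ℝ)| ≤ |x| ^ J * (1 + Real.exp x) := by
  rcases le_total x 0 with hx | hx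
  · refine (abs_exp_sub_sum_le_of_nonpos J hx).trans ?_
    have := Real.exp_pos x
    exact le_mul_of_one_le_right (by positivity) (by linarith)
  · have h := Complex.norm_exp_sub_sum_le_norm_mul_exp (x : ℂ) J
    have e : Complex.exp x - ∑ m ∈ Finset.range J, (x : ℂ) ^ m / (m.factorial : ℂ) =
        ((Real.exp x - ∑ k ∈ Finset.range J, x ^ k / (k.factorial : ℝ) : ℝ) : ℂ) := by
      push_cast; rfl
    rw [e, Complex.norm_real, Complex.norm_real, Real.norm_eq_abs, Real.norm_eq_abs] at h
    refine h.trans ?_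
    rw [abs_of_nonneg hx]
    gcongr
    linarith

/-- The exponential of a function with an expansion without constant term. -/
theorem HasExpansion.exp_sub_le {X : Type*} {w : X → ℝ} {u : X → ℝ → ℝ} {c : X → PowerSeries ℝ}
    (hw : ∀ x, 1 ≤ w x) (hu : HasExpansion w u c)
    (hc : ∀ x, PowerSeries.constantCoeff (c x) = 0) (J : ℕ) :
    ∃ C : ℝ, ∃ M : ℕ, 0 ≤ C ∧ ∀ x, ∀ ε : ℝ, 0 < ε → ε ≤ 1 →
      |Real.exp (u x ε) - ∑ j ∈ Finset.range J, PowerSeries.coeff j (expSeries (c x)) * ε ^ j| ≤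
        C * w x ^ M * ε ^ J * (1 + Real.exp (u x ε)) := by
  -- As the constant term vanishes, order `1` gives `|u| ≤ C w ^ M ε`, so the `J`-th power in the
  -- exponential remainder is of order `ε ^ J`.
  obtain ⟨C, M, hC, h⟩ := hu 1
  -- The truncated exponential is a polynomial in `u`, hence has an expansion; below degree `J` its
  -- coefficients are those of `expSeries`.
  obtain ⟨D, N, hD, h'⟩ := HasExpansion.sum hw (Finset.range J) (fun k _ =>
    (hu.pow hw k).const_mul ((k.factorial : ℝ)⁻¹)) J
  refine ⟨C ^ J + D, M * J + N, by positivity, fun x ε h0 h1 => ?_⟩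
  have k1 := h x ε h0 h1
  have k2 := h' x ε h0 h1
  have hw0 := hw x
  have hpos := Real.exp_pos (u x ε)
  simp only [Finset.range_one, Finset.sum_singleton, pow_zero, mul_one, pow_one,
    PowerSeries.coeff_zero_eq_constantCoeff, hc, sub_zero] at k1
  have e : ∑ j ∈ Finset.range J, PowerSeries.coeff j (expSeries (c x)) * ε ^ j =
      ∑ j ∈ Finset.range J, PowerSeries.coeff j
        (∑ k ∈ Finset.range J, ((k.factorial : ℝ)⁻¹) • c x ^ k) * ε ^ j := by
    refine Finset.sum_congr rfl fun j hj => ?_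
    rw [coeff_expSeries (hc x) (Finset.mem_range.1 hj), map_sum]
    congr 1
    exact Finset.sum_congr rfl fun k _ => by simp [div_eq_inv_mul]
  rw [e]
  have e2 : ∑ k ∈ Finset.range J, u x ε ^ k / (k.factorial : ℝ) =
      ∑ k ∈ Finset.range J, (k.factorial : ℝ)⁻¹ * u x ε ^ k :=
    Finset.sum_congr rfl fun k _ => by rw [div_eq_inv_mul]
  have k3 := abs_exp_sub_sum_le J (u x ε)
  rw [e2] at k3
  have k4 : |u x ε| ^ J ≤ C ^ J * w x ^ (M * J + N) * ε ^ J := by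
    calc |u x ε| ^ J ≤ (C * w x ^ M * ε) ^ J := by gcongr
      _ = C ^ J * w x ^ (M * J) * ε ^ J := by rw [mul_pow, mul_pow, ← pow_mul]
      _ ≤ _ := mul_pow_mul_le (by positivity) hw0 (by omega) (by positivity)
  have k5 : D * w x ^ N * ε ^ J ≤ D * w x ^ (M * J + N) * ε ^ J := by
    exact mul_pow_mul_le (by positivity) hw0 (by omega) (by positivity)
  have k6 := abs_sub_le (Real.exp (u x ε)) (∑ k ∈ Finset.range J, (k.factorial : ℝ)⁻¹ * u x ε ^ k)
    (∑ j ∈ Finset.range J, PowerSeries.coeff j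
        (∑ k ∈ Finset.range J, ((k.factorial : ℝ)⁻¹) • c x ^ k) * ε ^ j)
  have k7 : D * w x ^ (M * J + N) * ε ^ J ≤
      D * w x ^ (M * J + N) * ε ^ J * (1 + Real.exp (u x ε)) :=
    le_mul_of_one_le_right (by positivity) (by linarith)
  calc _ ≤ C ^ J * w x ^ (M * J + N) * ε ^ J * (1 + Real.exp (u x ε)) +
        D * w x ^ (M * J + N) * ε ^ J * (1 + Real.exp (u x ε)) := by
        refine k6.trans (add_le_add (k3.trans ?_) (k2.trans (k5.trans k7)))
        gcongr
    _ = _ := by ring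

/-! ## Laplace's method after rescaling -/

theorem HasExpansion.coeff_expSeries_le {X : Type*} {w : X → ℝ} {u : X → ℝ → ℝ}
    {c : X → PowerSeries ℝ} (hw : ∀ x, 1 ≤ w x) (hu : HasExpansion w u c)
    (hc : ∀ x, PowerSeries.constantCoeff (c x) = 0) (j : ℕ) :
    ∃ C : ℝ, ∃ M : ℕ, 0 ≤ C ∧ ∀ x, |PowerSeries.coeff j (expSeries (c x))| ≤ C * w x ^ M := by
  obtain ⟨C, M, hC, h⟩ := (HasExpansion.sum hw (Finset.range (j + 1)) (fun k _ =>
    (hu.pow hw k).const_mul ((k.factorial : ℝ)⁻¹))).coeff_le hw j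
  refine ⟨C, M, hC, fun x => ?_⟩
  convert h x using 2
  rw [coeff_expSeries (hc x) (Nat.lt_succ_self j), map_sum]
  exact Finset.sum_congr rfl fun k _ => by simp [div_eq_inv_mul]

section Laplace

variable {E : Type*} [NormedAddCommGroup E] [NormedSpace ℝ E] [FiniteDimensional ℝ E]
  [MeasurableSpace E] [BorelSpace E] (μ : MeasureTheory.Measure E) [μ.IsAddHaarMeasure]

theorem one_add_pow_mul_exp_neg_le {t : ℝ} (ht : 0 ≤ t) (K : ℕ) :
    (1 + t) ^ K * Real.exp (-t) ≤ K.factorial * Real.exp 1 := by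
  have h := Real.pow_div_factorial_le_exp (1 + t) (by positivity) K
  rw [div_le_iff₀ (by positivity), Real.exp_add] at h
  calc (1 + t) ^ K * Real.exp (-t) ≤ (Real.exp 1 * Real.exp t * K.factorial) * Real.exp (-t) := by
        gcongr
    _ = K.factorial * Real.exp 1 * (Real.exp t * Real.exp (-t)) := by ring
    _ = _ := by rw [← Real.exp_add]; simp

theorem integrable_one_add_norm_pow_mul_exp_neg (M : ℕ) :
    MeasureTheory.Integrable (fun x : E => (1 + ‖x‖) ^ M * Real.exp (-‖x‖)) μ := by
  -- The exponential absorbs `r` additional powers of `1 + ‖x‖`, and `(1 + ‖x‖) ^ (-r)` is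
  -- integrable as soon as `r` exceeds the dimension.
  set r : ℕ := Module.finrank ℝ E + 1
  have h := (integrable_one_add_norm (E := E) (μ := μ) (r := (r : ℝ)) (by simp [r])).const_mul
    (((M + r).factorial : ℝ) * Real.exp 1)
  refine h.mono' (by fun_prop) (Filter.Eventually.of_forall fun x => ?_)
  have hp : 0 < 1 + ‖x‖ := by positivity
  rw [Real.norm_eq_abs, abs_of_nonneg (by positivity), Real.rpow_neg hp.le, Real.rpow_natCast,
    ← div_eq_mul_inv, le_div_iff₀ (by positivity)]
  calc _ = (1 + ‖x‖) ^ (M + r) * Real.exp (-‖x‖) := by rw [pow_add]; ring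
    _ ≤ _ := one_add_pow_mul_exp_neg_le (norm_nonneg x) _

/-- Expansion of `∫ exp (-q + u ε)` for a function `u` with an expansion without constant term. -/
theorem exists_abs_integral_exp_sub_le {q : E → ℝ} {u : E → ℝ → ℝ} {c : E → PowerSeries ℝ}
    (hu : HasExpansion (fun x : E => 1 + ‖x‖) u c)
    (hc : ∀ x, PowerSeries.constantCoeff (c x) = 0) {B ε₀ : ℝ} (hε₀ : ε₀ ≤ 1)
    (hq : ∀ x, ‖x‖ - B ≤ q x)
    (hqu : ∀ x, ∀ ε, 0 < ε → ε ≤ ε₀ → ‖x‖ - B ≤ q x - u x ε)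
    (mq : Continuous q) (mu : ∀ ε, 0 < ε → Continuous fun x => u x ε)
    (mc : ∀ j, Continuous fun x => PowerSeries.coeff j (expSeries (c x))) :
    (∀ ε, 0 < ε → ε ≤ ε₀ → MeasureTheory.Integrable (fun x => Real.exp (-q x + u x ε)) μ) ∧
    (∀ j, MeasureTheory.Integrable
      (fun x => Real.exp (-q x) * PowerSeries.coeff j (expSeries (c x))) μ) ∧
    ∀ J : ℕ, ∃ C, ∀ ε, 0 < ε → ε ≤ ε₀ →
      |∫ x, Real.exp (-q x + u x ε) ∂μ - ∑ j ∈ Finset.range J,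
        (∫ x, Real.exp (-q x) * PowerSeries.coeff j (expSeries (c x)) ∂μ) * ε ^ j| ≤ C * ε ^ J := by
  have hw : ∀ x : E, 1 ≤ 1 + ‖x‖ := fun x => by linarith [norm_nonneg x]
  have hexp : ∀ {x : E} {y : ℝ}, y ≤ B - ‖x‖ → Real.exp y ≤ Real.exp B * Real.exp (-‖x‖) := by
    intro x y h
    rw [← Real.exp_add]
    exact Real.exp_le_exp.2 (by linarith)
  have i1 : ∀ ε, 0 < ε → ε ≤ ε₀ →
      MeasureTheory.Integrable (fun x => Real.exp (-q x + u x ε)) μ := by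
    intro ε h0 h1
    have := mu ε h0
    refine ((integrable_one_add_norm_pow_mul_exp_neg μ 0).const_mul (Real.exp B)).mono'
      (by fun_prop) (Filter.Eventually.of_forall fun x => ?_)
    rw [Real.norm_eq_abs, Real.abs_exp, pow_zero, one_mul]
    exact hexp (by linarith [hqu x ε h0 h1])
  have i2 : ∀ j, MeasureTheory.Integrable
      (fun x => Real.exp (-q x) * PowerSeries.coeff j (expSeries (c x))) μ := by
    intro j
    obtain ⟨C, M, hC, h⟩ := hu.coeff_expSeries_le hw hc j
    have := mc j
    refine ((integrable_one_add_norm_pow_mul_exp_neg μ M).const_mul (Real.exp B * C)).mono'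
      (by fun_prop) (Filter.Eventually.of_forall fun x => ?_)
    rw [Real.norm_eq_abs, abs_mul, Real.abs_exp]
    calc _ ≤ (Real.exp B * Real.exp (-‖x‖)) * (C * (1 + ‖x‖) ^ M) :=
          mul_le_mul (hexp (by linarith [hq x])) (h x) (abs_nonneg _) (by positivity)
      _ = _ := by ring
  refine ⟨i1, i2, fun J => ?_⟩
  obtain ⟨C, M, hC, h⟩ := hu.exp_sub_le hw hc J
  refine ⟨∫ x, 2 * C * Real.exp B * ((1 + ‖x‖) ^ M * Real.exp (-‖x‖)) ∂μ, fun ε h0 h1 => ?_⟩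
  have e : ∫ x, Real.exp (-q x + u x ε) ∂μ - ∑ j ∈ Finset.range J,
        (∫ x, Real.exp (-q x) * PowerSeries.coeff j (expSeries (c x)) ∂μ) * ε ^ j =
      ∫ x, (Real.exp (-q x + u x ε) - ∑ j ∈ Finset.range J,
        Real.exp (-q x) * PowerSeries.coeff j (expSeries (c x)) * ε ^ j) ∂μ := by
    rw [MeasureTheory.integral_sub (i1 ε h0 h1)
      (MeasureTheory.integrable_finsetSum _ fun j _ => (i2 j).mul_const _),
      MeasureTheory.integral_finsetSum _ fun j _ => (i2 j).mul_const _]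
    simp only [MeasureTheory.integral_mul_const]
  rw [e, ← MeasureTheory.integral_mul_const, ← Real.norm_eq_abs]
  refine MeasureTheory.norm_integral_le_of_norm_le
    (((integrable_one_add_norm_pow_mul_exp_neg μ M).const_mul _).mul_const _)
    (Filter.Eventually.of_forall fun x => ?_)
  have e2 : Real.exp (-q x + u x ε) - ∑ j ∈ Finset.range J,
        Real.exp (-q x) * PowerSeries.coeff j (expSeries (c x)) * ε ^ j =
      Real.exp (-q x) * (Real.exp (u x ε) -
        ∑ j ∈ Finset.range J, PowerSeries.coeff j (expSeries (c x)) * ε ^ j) := by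
    rw [Real.exp_add, mul_sub, Finset.mul_sum]
    simp only [mul_assoc]
  rw [e2, Real.norm_eq_abs, abs_mul, Real.abs_exp]
  have k1 := h x ε h0 (h1.trans hε₀)
  -- The two summands are `exp (-q)` and `exp (-(q - u))`, controlled by `hq` and `hqu`
  -- respectively.
  have k2 : Real.exp (-q x) * (1 + Real.exp (u x ε)) ≤ 2 * (Real.exp B * Real.exp (-‖x‖)) := by
    rw [mul_add, mul_one, ← Real.exp_add, two_mul]
    exact add_le_add (hexp (by linarith [hq x])) (hexp (by linarith [hqu x ε h0 h1]))
  calc _ ≤ Real.exp (-q x) * (C * (1 + ‖x‖) ^ M * ε ^ J * (1 + Real.exp (u x ε))) := by gcongr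
    _ = C * (1 + ‖x‖) ^ M * ε ^ J * (Real.exp (-q x) * (1 + Real.exp (u x ε))) := by ring
    _ ≤ C * (1 + ‖x‖) ^ M * ε ^ J * (2 * (Real.exp B * Real.exp (-‖x‖))) := by gcongr
    _ = _ := by ring

end Laplace

theorem sum_range_two_mul_of_odd_eq_zero {z : ℕ → ℝ} (hz : ∀ j, Odd j → z j = 0) (N : ℕ) (ε : ℝ) :
    ∑ j ∈ Finset.range (2 * N), z j * ε ^ j =
      ∑ j ∈ Finset.range N, z (2 * j) * ε ^ (2 * j) := by
  induction N with
  | zero => simp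
  | succ N ih =>
    rw [Finset.sum_range_succ, ← ih, show 2 * (N + 1) = 2 * N + 1 + 1 by ring,
      Finset.sum_range_succ, Finset.sum_range_succ, hz (2 * N + 1) ⟨N, rfl⟩]
    ring

/-- From an expansion in powers of `ε = k ^ (-1/2)` to an expansion in powers of `k`. -/
theorem isLittleO_of_expansion {D I : ℝ → ℝ} {z : ℕ → ℝ} {s ε₀ : ℝ} (hε₀ : 0 < ε₀)
    (hz : ∀ j, Odd j → z j = 0)
    (hI : ∀ J : ℕ, ∃ C, ∀ ε, 0 < ε → ε ≤ ε₀ →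
      |I ε - ∑ j ∈ Finset.range J, z j * ε ^ j| ≤ C * ε ^ J)
    (hD : ∀ k : ℝ, 0 < k → D k = k ^ s * I (k ^ (-(1 / 2) : ℝ))) (N : ℕ) :
    (fun k : ℝ => D k - k ^ s * ∑ j ∈ Finset.range (N + 1), z (2 * j) * k ^ (-(j : ℝ)))
      =o[Filter.atTop] fun k : ℝ => k ^ (s - N) := by
  -- With the vanishing odd terms, order `2(N+1)` in `ε` leaves exactly the terms up to `k ^ (-N)`
  -- and an error `k ^ (s-N-1)`, one full power better than required.
  obtain ⟨C, hC⟩ := hI (2 * (N + 1))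
  have h1 : (fun k : ℝ => D k - k ^ s * ∑ j ∈ Finset.range (N + 1), z (2 * j) * k ^ (-(j : ℝ)))
      =O[Filter.atTop] fun k : ℝ => k ^ (s - N - 1) := by
    refine Asymptotics.IsBigO.of_bound C ?_
    have ht : Filter.Tendsto (fun k : ℝ => k ^ (-(1 / 2) : ℝ)) Filter.atTop (𝓝 0) :=
      tendsto_rpow_neg_atTop (by norm_num)
    filter_upwards [Filter.eventually_gt_atTop 0, ht.eventually_le_const hε₀] with k hk hk'
    have hpos : 0 < k ^ (-(1 / 2) : ℝ) := Real.rpow_pos_of_pos hk _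
    have h := hC _ hpos hk'
    have hpow : ∀ j : ℕ, (k ^ (-(1 / 2) : ℝ)) ^ (2 * j) = k ^ (-(j : ℝ)) := by
      intro j
      rw [← Real.rpow_natCast, ← Real.rpow_mul hk.le]
      congr 1
      push_cast
      ring
    rw [sum_range_two_mul_of_odd_eq_zero hz, hpow] at h
    simp only [hpow] at h
    rw [hD k hk, ← mul_sub, norm_mul, Real.norm_eq_abs, Real.norm_eq_abs, Real.norm_eq_abs,
      abs_of_pos (Real.rpow_pos_of_pos hk _), abs_of_pos (Real.rpow_pos_of_pos hk _)]
    calc _ ≤ k ^ s * (C * k ^ (-((N + 1 : ℕ) : ℝ))) := by gcongr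
      _ = C * (k ^ s * k ^ (-((N + 1 : ℕ) : ℝ))) := by ring
      _ = _ := by
        rw [← Real.rpow_add hk]
        congr 2
        push_cast
        ring
  refine h1.trans_isLittleO ?_
  have h2 : (fun k : ℝ => k ^ (s - N - 1)) =ᶠ[Filter.atTop]
      fun k : ℝ => k ^ (-1 : ℝ) * k ^ (s - N) := by
    filter_upwards [Filter.eventually_gt_atTop 0] with k hk
    rw [← Real.rpow_add hk]
    congr 1
    ring
  refine h2.trans_isLittleO ?_
  have h3 : (fun k : ℝ => k ^ (-1 : ℝ)) =o[Filter.atTop] fun _ => (1 : ℝ) :=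
    (Asymptotics.isLittleO_one_iff ℝ).2 (tendsto_rpow_neg_atTop (by norm_num))
  simpa using h3.mul_isBigO (Asymptotics.isBigO_refl (fun k : ℝ => k ^ (s - N)) Filter.atTop)

/-- A lower bound for the exponent after rescaling. -/
theorem le_sq_div_sub {c D s ε : ℝ} (hc : 0 < c) (hs : 0 ≤ s) (hε : 0 < ε)
    (h1 : ε ≤ c / 4) (h2 : D * ε ≤ 1) :
    s - 2 / c ≤ c * s ^ 2 / (1 + ε * s) - D * (ε * s) := by
  have hD : D * (ε * s) ≤ s := by nlinarith
  -- The perturbation `D (ε s)` costs at most `s`, so slope `2` is needed from the main term. For `ε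
  -- s ≤ 1` the quadratic `c s²/2` lies above its tangent line `2s - 2/c`; for `ε s ≥ 1` the
  -- quotient is at least `c s/(2ε) ≥ 2s` since `ε ≤ c/4`.
  suffices h : 2 * s - 2 / c ≤ c * s ^ 2 / (1 + ε * s) by linarith
  have hpos : 0 < 1 + ε * s := by positivity
  have hc2 : 0 < 2 / c := by positivity
  rcases le_total (ε * s) 1 with h | h
  · have k1 : c * s ^ 2 / 2 ≤ c * s ^ 2 / (1 + ε * s) := by gcongr; linarith
    have k2 : 2 * s - 2 / c ≤ c * s ^ 2 / 2 := by
      have : c * s ^ 2 / 2 - 2 * s + 2 / c = c / 2 * (s - 2 / c) ^ 2 := by field_simp; ring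
      nlinarith [sq_nonneg (s - 2 / c)]
    linarith
  · have k1 : 2 * s ≤ c * s ^ 2 / (1 + ε * s) := by
      rw [le_div_iff₀ hpos]
      have : 1 + ε * s ≤ 2 * (ε * s) := by linarith
      have : 2 * s * (1 + ε * s) ≤ 2 * s * (2 * (ε * s)) := by gcongr
      nlinarith [mul_le_mul_of_nonneg_right h1 (sq_nonneg s)]
    linarith

/-! ## Bell polynomials as coefficients -/

/-- The power series `∑_{j ≥ 1} y_j X ^ j`. -/
def tailSeries (y : ℕ → ℝ) : PowerSeries ℝ :=
  PowerSeries.mk fun j => if j = 0 then 0 else y j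

theorem coeff_tailSeries (y : ℕ → ℝ) (j : ℕ) :
    PowerSeries.coeff j (tailSeries y) = if j = 0 then 0 else y j :=
  PowerSeries.coeff_mk _ _

theorem constantCoeff_tailSeries (y : ℕ → ℝ) :
    PowerSeries.constantCoeff (tailSeries y) = 0 := by
  rw [← PowerSeries.coeff_zero_eq_constantCoeff_apply, coeff_tailSeries, if_pos rfl]

theorem smul_tailSeries (a : ℝ) (y : ℕ → ℝ) :
    a • tailSeries y = tailSeries fun p => a * y p := by
  ext j
  simp only [map_smul, coeff_tailSeries, smul_eq_mul]
  split_ifs <;> simp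

/-- Expanding the `r`-fold product sums over all `r`-tuples of total degree `m`; those with a zero
entry drop out because the series has no constant term. -/
theorem coeff_tailSeries_pow (y : ℕ → ℝ) (m r : ℕ) :
    PowerSeries.coeff m (tailSeries y ^ r) = compPoly m r y := by
  classical
  have h : tailSeries y ^ r = ∏ _i : Fin r, tailSeries y := by simp
  rw [h, PowerSeries.coeff_prod, compPoly]
  symm
  refine Finset.sum_of_injOn (fun n => Finsupp.equivFunOnFinite.symm n)
    (fun _ _ _ _ h => Finsupp.equivFunOnFinite.symm.injective h) ?_ ?_ ?_
  · intro n hn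
    have := (mem_compIndex.1 hn).2
    simpa [Finset.mem_finsuppAntidiag] using this
  · intro n hn hn'
    by_contra hne
    refine hn' ⟨n, ?_, by ext; simp⟩
    refine mem_compIndex.2 ⟨fun i => ?_, by simpa [Finset.mem_finsuppAntidiag] using hn⟩
    have := Finset.prod_ne_zero_iff.1 hne i (Finset.mem_univ i)
    rw [coeff_tailSeries] at this
    by_contra h0
    exact this (if_pos (by omega))
  · intro n hn
    refine Finset.prod_congr rfl fun i _ => ?_
    have := (mem_compIndex.1 hn).1 i
    simp only [coeff_tailSeries, Finsupp.equivFunOnFinite_symm_apply_apply]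
    rw [if_neg (by omega)]

/-- If `r` positive integers add up to `m`, the other `r - 1` entries take at least `r - 1`, so each
entry is at most `m - r + 1`. -/
theorem compPoly_congr {m r : ℕ} {y y' : ℕ → ℝ} (h : ∀ p, 1 ≤ p → p + r ≤ m + 1 → y p = y' p) :
    compPoly m r y = compPoly m r y' := by
  refine Finset.sum_congr rfl fun n hn => Finset.prod_congr rfl fun i _ => ?_
  obtain ⟨h1, h2⟩ := mem_compIndex.1 hn
  refine h _ (h1 i) ?_
  have h3 : ∑ q ∈ Finset.univ.erase i, 1 ≤ ∑ q ∈ Finset.univ.erase i, n q :=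
    Finset.sum_le_sum fun q _ => h1 q
  have h4 := Finset.add_sum_erase Finset.univ n (Finset.mem_univ i)
  simp only [Finset.sum_const, smul_eq_mul, mul_one,
    Finset.card_erase_of_mem (Finset.mem_univ i), Finset.card_univ, Fintype.card_fin] at h3
  omega

/-- In this indexing `l` counts the variables and `j + 1 - l` the blocks. The multinomial theorem
for the power `j + 1 - l` of `∑ x_p X ^ p / p!` produces the coefficients `c(j; n)`. -/
theorem partialBell_eq {j l : ℕ} (hlj : l ≤ j) (x : ℕ → ℝ) :
    partialBell j l x = (j.factorial : ℝ) / ((j + 1 - l).factorial : ℝ) *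
      compPoly j (j + 1 - l) (fun p => x p / (p.factorial : ℝ)) := by
  set y : ℕ → ℝ := fun p => x p / (p.factorial : ℝ) with hy
  set k := j + 1 - l with hk
  -- With `j + 1 - l` parts no part exceeds `l`, so cutting the series at degree `l` is harmless and
  -- leaves a finite sum of monomials.
  set y' : ℕ → ℝ := fun p => if p ≤ l then y p else 0 with hy'
  have h1 : compPoly j k y = compPoly j k y' := by
    refine compPoly_congr fun p _ hp => ?_
    simp only [hy']
    rw [if_pos (by omega)]
  have h2 : tailSeries y' = ∑ p : Fin l, PowerSeries.monomial ((p : ℕ) + 1) (y ((p : ℕ) + 1)) := by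
    ext i
    rw [coeff_tailSeries, map_sum]
    simp only [PowerSeries.coeff_monomial]
    rcases Nat.eq_zero_or_pos i with rfl | hi
    · simp
    rw [if_neg (by omega)]
    simp only [hy']
    by_cases hil : i ≤ l
    · rw [if_pos hil, Finset.sum_eq_single (⟨i - 1, by omega⟩ : Fin l)]
      · simp only [Nat.sub_add_cancel hi, if_true]
      · intro p _ hp
        rw [if_neg]
        rintro rfl
        exact hp (by ext; simp)
      · simp
    · rw [if_neg hil, Finset.sum_eq_zero]
      intro p _
      rw [if_neg]
      have := p.2
      omega
  rw [h1, ← coeff_tailSeries_pow, h2, Finset.sum_pow_eq_sum_piAntidiag, map_sum, Finset.mul_sum,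
    partialBell]
  -- The multinomial sum runs over all exponents with the right number of factors; only those of
  -- weighted degree `j`, which form `bellIndex`, contribute.
  refine Finset.sum_subset_zero_on_sdiff ?_ ?_ ?_
  · intro n hn
    have := (mem_bellIndex.1 hn).1
    simp only [Finset.mem_piAntidiag, Finset.mem_univ, implies_true, and_true]
    change ∑ p, n p = k
    omega
  · intro n hn
    simp only [Finset.mem_sdiff, Finset.mem_piAntidiag, mem_bellIndex, not_and] at hn
    have h3 : ∑ p : Fin l, ((p : ℕ) + 1) * n p ≠ j := hn.2 (by
      have : ∑ p, n p = k := hn.1.1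
      omega)
    rw [← map_natCast (PowerSeries.C (R := ℝ)), PowerSeries.coeff_C_mul]
    simp only [PowerSeries.monomial_pow]
    rw [PowerSeries.prod_monomial, PowerSeries.coeff_monomial, if_neg, mul_zero, mul_zero]
    intro h
    refine h3 (h.trans ?_).symm
    exact Finset.sum_congr rfl fun p _ => mul_comm _ _
  · intro n hn
    obtain ⟨h3, h4⟩ := mem_bellIndex.1 hn
    rw [← map_natCast (PowerSeries.C (R := ℝ)), PowerSeries.coeff_C_mul]
    simp only [PowerSeries.monomial_pow]
    rw [PowerSeries.prod_monomial, PowerSeries.coeff_monomial, if_pos]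
    swap
    · rw [← h4]
      exact Finset.sum_congr rfl fun p _ => mul_comm _ _
    have h5 := Nat.multinomial_spec Finset.univ n
    rw [show ∑ i, n i = k by omega] at h5
    have h6 : (∏ i, ((n i).factorial : ℝ)) * (Nat.multinomial Finset.univ n : ℝ) =
        (k.factorial : ℝ) := by exact_mod_cast h5
    have h7 : (∏ i, ((n i).factorial : ℝ)) ≠ 0 :=
      Finset.prod_ne_zero_iff.2 fun i _ => by positivity
    have h8 : (∏ p : Fin l, ((((p : ℕ) + 1).factorial : ℝ) ^ n p)) ≠ 0 :=
      Finset.prod_ne_zero_iff.2 fun i _ => by positivity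
    have h9 : (k.factorial : ℝ) ≠ 0 := by positivity
    rw [bellCoeff, hy]
    simp only [div_pow, Finset.prod_div_distrib, Finset.prod_mul_distrib]
    rw [← h6] at h9 ⊢
    have h10 := right_ne_zero_of_mul h9
    field_simp

/-- The exponential formula: summing over `l` is summing over the number `j + 1 - l` of blocks, that
is, over the powers in the exponential series. For `j = 0` the value `1` is the zeroth power. -/
theorem completeBell_eq (j : ℕ) (x : ℕ → ℝ) :
    completeBell j x = (j.factorial : ℝ) *
      PowerSeries.coeff j (expSeries (tailSeries fun p => x p / (p.factorial : ℝ))) := by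
  set Y := tailSeries fun p => x p / (p.factorial : ℝ)
  rw [completeBell, sumOrOne, coeff_expSeries (constantCoeff_tailSeries _) (Nat.lt_succ_self j)]
  rcases Nat.eq_zero_or_pos j with rfl | hj
  · simp
  rw [if_pos (Finset.nonempty_Icc.2 hj), Finset.sum_range_succ']
  have h0 : PowerSeries.coeff j (Y ^ 0) = 0 := by
    rw [pow_zero, PowerSeries.coeff_one, if_neg (by omega)]
  rw [h0, zero_div, add_zero, Finset.mul_sum, Finset.range_eq_Ico]
  refine Finset.sum_nbij' (fun l => j - l) (fun k => j - k) ?_ ?_ ?_ ?_ ?_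
  · intro l hl; simp only [Finset.mem_Icc, Finset.mem_Ico] at hl ⊢; omega
  · intro l hl; simp only [Finset.mem_Icc, Finset.mem_Ico] at hl ⊢; omega
  · intro l hl; simp only [Finset.mem_Icc] at hl; omega
  · intro l hl; simp only [Finset.mem_Ico] at hl; omega
  · intro l hl
    simp only [Finset.mem_Icc] at hl
    rw [partialBell_eq hl.2, coeff_tailSeries_pow, show j + 1 - l = j - l + 1 by omega]
    ring

/-! ## Taylor coefficients of an exponential -/

/-- The Taylor series at `0` of a function of one variable. -/
def taylorSeries (u : ℝ → ℝ) : PowerSeries ℝ :=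
  PowerSeries.mk fun j => iteratedDeriv j u 0 / (j.factorial : ℝ)

theorem derivative_taylorSeries (u : ℝ → ℝ) :
    PowerSeries.derivative ℝ (taylorSeries u) = taylorSeries (deriv u) := by
  ext j
  rw [PowerSeries.coeff_derivative, taylorSeries, taylorSeries, PowerSeries.coeff_mk,
    PowerSeries.coeff_mk, iteratedDeriv_succ', Nat.factorial_succ]
  have : (j : ℝ) + 1 ≠ 0 := by positivity
  push_cast
  field_simp

theorem taylorSeries_mul {u v : ℝ → ℝ} (hu : ContDiff ℝ ∞ u) (hv : ContDiff ℝ ∞ v) :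
    taylorSeries (fun t => u t * v t) = taylorSeries u * taylorSeries v := by
  ext j
  rw [PowerSeries.coeff_mul, taylorSeries, PowerSeries.coeff_mk]
  have h := iteratedDeriv_fun_mul (n := j) (x := (0 : ℝ)) (f := u) (g := v)
    (hu.contDiffAt.of_le (by exact_mod_cast le_top)) (hv.contDiffAt.of_le (by exact_mod_cast le_top))
  rw [h, Finset.Nat.sum_antidiagonal_eq_sum_range_succ (fun p q =>
    PowerSeries.coeff p (taylorSeries u) * PowerSeries.coeff q (taylorSeries v)), Finset.sum_div]
  refine Finset.sum_congr rfl fun i hi => ?_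
  have hij : i ≤ j := by have := Finset.mem_range.1 hi; omega
  rw [taylorSeries, taylorSeries, PowerSeries.coeff_mk, PowerSeries.coeff_mk,
    Nat.cast_choose ℝ hij]
  have : (j.factorial : ℝ) ≠ 0 := by positivity
  field_simp

/-- Both sides solve `E' = U' E` with constant term `1`, so uniqueness replaces the formula for
iterated derivatives of a composition. -/
theorem taylorSeries_exp {u : ℝ → ℝ} (hu : ContDiff ℝ ∞ u) (h0 : u 0 = 0) :
    taylorSeries (fun t => Real.exp (u t)) = expSeries (taylorSeries u) := by
  have hc : PowerSeries.constantCoeff (taylorSeries u) = 0 := by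
    rw [← PowerSeries.coeff_zero_eq_constantCoeff_apply, taylorSeries, PowerSeries.coeff_mk]
    simp [h0]
  refine eq_of_derivative_eq_mul (U := taylorSeries u) ?_ ?_ (derivative_expSeries hc)
  · rw [constantCoeff_expSeries, ← PowerSeries.coeff_zero_eq_constantCoeff_apply, taylorSeries,
      PowerSeries.coeff_mk]
    simp [h0]
  · have hd : deriv (fun t => Real.exp (u t)) = fun t => deriv u t * Real.exp (u t) := by
      funext t
      have := ((hu.differentiable (by simp)) t).hasDerivAt.exp
      rw [this.deriv, mul_comm]
    rw [derivative_taylorSeries, derivative_taylorSeries, hd,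
      taylorSeries_mul ((contDiff_infty_iff_deriv.1 hu).2) hu.exp]

/-! ## Gaussian integrals in polar coordinates -/

section Polar

open MeasureTheory

variable {E : Type*} [NormedAddCommGroup E] [NormedSpace ℝ E] [FiniteDimensional ℝ E]
  [MeasurableSpace E] [BorelSpace E] (μ : Measure E) [μ.IsAddHaarMeasure]

theorem integral_eq_integral_sphere_prod [Nontrivial E] (g : E → ℝ) :
    ∫ x, g x ∂μ = ∫ p : Metric.sphere (0 : E) 1 × Set.Ioi (0 : ℝ), g ((p.2 : ℝ) • (p.1 : E))
      ∂(μ.toSphere.prod (Measure.volumeIoiPow (Module.finrank ℝ E - 1))) := by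
  have h := μ.measurePreserving_homeomorphUnitSphereProd.integral_comp
    (Homeomorph.measurableEmbedding _) (fun p : Metric.sphere (0 : E) 1 × Set.Ioi (0 : ℝ) =>
      g ((p.2 : ℝ) • (p.1 : E)))
  rw [← h]
  calc ∫ x, g x ∂μ = ∫ x : ({0}ᶜ : Set E), g x ∂(μ.comap (↑)) := by
        rw [integral_subtype_comap (measurableSet_singleton _).compl, restrict_compl_singleton]
    _ = _ := by
        refine integral_congr_ae (Filter.Eventually.of_forall fun x => ?_)
        have hx : ‖(x : E)‖ ≠ 0 := norm_ne_zero_iff.2 x.2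
        simp [smul_smul, hx]

theorem integrable_sphere_prod {g : E → ℝ} (hg : Integrable g μ) :
    Integrable (fun p : Metric.sphere (0 : E) 1 × Set.Ioi (0 : ℝ) => g ((p.2 : ℝ) • (p.1 : E)))
      (μ.toSphere.prod (Measure.volumeIoiPow (Module.finrank ℝ E - 1))) := by
  rw [← μ.measurePreserving_homeomorphUnitSphereProd.integrable_comp_emb
    (Homeomorph.measurableEmbedding _)]
  have h : Integrable (fun x : ({0}ᶜ : Set E) => g x) (μ.comap (↑)) := by
    have := hg.integrableOn (s := ({0}ᶜ : Set E))
    rwa [integrableOn_iff_comap_subtypeVal (by measurability)] at this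
  refine h.congr (Filter.Eventually.of_forall fun x => ?_)
  have hx : ‖(x : E)‖ ≠ 0 := norm_ne_zero_iff.2 x.2
  simp [smul_smul, hx]

theorem integral_volumeIoiPow (n : ℕ) (f : ℝ → ℝ) :
    ∫ x : Set.Ioi (0 : ℝ), f x ∂(Measure.volumeIoiPow n) = ∫ x in Set.Ioi (0 : ℝ), x ^ n * f x := by
  simp only [Measure.volumeIoiPow, ENNReal.ofReal]
  rw [integral_withDensity_eq_integral_smul,
    integral_subtype_comap measurableSet_Ioi fun a ↦ Real.toNNReal (a ^ n) • f a]
  · refine setIntegral_congr_fun measurableSet_Ioi fun x hx ↦ ?_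
    simp only [NNReal.smul_def, Real.coe_toNNReal _ (pow_nonneg (Set.mem_Ioi.1 hx).le n), smul_eq_mul]
  · exact (measurable_subtype_coe.pow_const _).real_toNNReal

theorem integral_pow_mul_exp_neg_mul_sq {b : ℝ} (hb : 0 < b) (n : ℕ) :
    ∫ x in Set.Ioi (0 : ℝ), x ^ n * Real.exp (-(b * x ^ 2)) =
      1 / 2 * Real.Gamma (((n : ℝ) + 1) / 2) * b ^ (-(((n : ℝ) + 1) / 2)) := by
  have h := integral_rpow_mul_exp_neg_mul_rpow (p := 2) (q := n) (by norm_num)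
    (by have := n.cast_nonneg (α := ℝ); linarith) hb
  simp only [Real.rpow_natCast, Real.rpow_ofNat, neg_mul] at h
  rw [h, neg_div]
  ring

/-- In polar coordinates the radial integral at `Ω` is that of `x ^ (d-1+m) exp (-q(Ω) x²)`, a Gamma
value times a power of `q(Ω)`. -/
theorem integral_exp_neg_mul_homogeneous [Nontrivial E] {q p : E → ℝ} {m : ℕ}
    (hq : ∀ (s : ℝ) (x : E), q (s • x) = s ^ 2 * q x)
    (hp : ∀ (s : ℝ) (x : E), p (s • x) = s ^ m * p x)
    (hpos : ∀ x, x ≠ 0 → 0 < q x) (hi : Integrable (fun x => Real.exp (-q x) * p x) μ) :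
    ∫ x, Real.exp (-q x) * p x ∂μ =
      1 / 2 * Real.Gamma (((Module.finrank ℝ E : ℝ) + m) / 2) *
        ∫ Ω : Metric.sphere (0 : E) 1,
          q Ω ^ (-(((Module.finrank ℝ E : ℝ) + m) / 2)) * p Ω ∂μ.toSphere := by
  rw [integral_eq_integral_sphere_prod, integral_prod _ (integrable_sphere_prod μ hi),
    ← integral_const_mul]
  refine integral_congr_ae (Filter.Eventually.of_forall fun Ω => ?_)
  have hΩ : 0 < q Ω := hpos _ (ne_of_mem_of_not_mem Ω.2 (by simp))
  have hd : 1 ≤ Module.finrank ℝ E := Module.finrank_pos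
  simp only [hq, hp]
  rw [integral_volumeIoiPow _ fun x => Real.exp (-(x ^ 2 * q Ω)) * (x ^ m * p Ω)]
  have e : ∀ x : ℝ, x ^ (Module.finrank ℝ E - 1) *
      (Real.exp (-(x ^ 2 * q Ω)) * (x ^ m * p Ω)) =
      x ^ (Module.finrank ℝ E - 1 + m) * Real.exp (-(q Ω * x ^ 2)) * p Ω := by
    intro x
    rw [pow_add, mul_comm (q (Ω : E))]
    ring
  simp only [e]
  rw [integral_mul_const, integral_pow_mul_exp_neg_mul_sq hΩ]
  have e2 : (((Module.finrank ℝ E - 1 + m : ℕ) : ℝ) + 1) = (Module.finrank ℝ E : ℝ) + m := by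
    rw [← Nat.cast_succ, ← Nat.cast_add]
    congr 1
    omega
  rw [e2]
  ring

end Polar

/-! ## The coefficients as Gaussian integrals -/

/-- Both sides equal `(-1) ^ r / r!` times `α(α+1)⋯(α+r-1) Γ(α)`. This is how the binomial
coefficients arise: the sign and factorial come from the exponential series, `Γ(α + r)` from the
radial integral. -/
theorem Gamma_mul_genBinom {α : ℝ} (hα : 0 < α) (r : ℕ) :
    Real.Gamma α * genBinom (-α) r = (-1) ^ r / (r.factorial : ℝ) * Real.Gamma (α + r) := by
  induction r with
  | zero => simp [genBinom]
  | succ r ih =>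
    have h1 : genBinom (-α) (r + 1) = genBinom (-α) r * ((-α - r) / ((r : ℝ) + 1)) := by
      rw [genBinom, genBinom, Finset.prod_range_succ, Nat.factorial_succ]
      have : (r : ℝ) + 1 ≠ 0 := by positivity
      push_cast
      field_simp
    have h2 : Real.Gamma (α + ((r + 1 : ℕ) : ℝ)) = (α + r) * Real.Gamma (α + r) := by
      rw [Nat.cast_succ, ← add_assoc, Real.Gamma_add_one (by positivity)]
    rw [h1, ← mul_assoc, ih, h2, Nat.factorial_succ]
    have : (r : ℝ) + 1 ≠ 0 := by positivity
    push_cast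
    field_simp
    ring

/-- The convention for the empty sum is the term `r = 0`: it is `1` when `m = 0`, and vanishes when
`m > 0`. -/
theorem sumOrOne_genBinom_eq (α : ℝ) (m : ℕ) (f : ℕ → ℝ) :
    sumOrOne (Finset.Icc 1 m) (fun r => genBinom (-α) r * (compPoly m r f / f 0 ^ r)) =
      ∑ r ∈ Finset.range (m + 1), genBinom (-α) r *
        (PowerSeries.coeff m (tailSeries f ^ r) / f 0 ^ r) := by
  rw [sumOrOne]
  rcases Nat.eq_zero_or_pos m with rfl | hm
  · simp [genBinom]
  rw [if_pos (Finset.nonempty_Icc.2 hm), Finset.range_eq_Ico, Finset.sum_eq_sum_Ico_succ_bot (by omega)]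
  rw [pow_zero, PowerSeries.coeff_one, if_neg (by omega), zero_div, mul_zero, zero_add]
  refine Finset.sum_congr ?_ fun r _ => by rw [coeff_tailSeries_pow]
  ext r
  simp only [Finset.mem_Icc, Finset.mem_Ico]
  omega

/-- The combination of Taylor coefficients integrated over the sphere to obtain `ζ_j`. -/
def sphereCoeff (d j : ℕ) (a : ℝ) (f h : ℕ → ℝ) : ℝ :=
  f 0 ^ (-(((d : ℝ) + j) / 2)) * ∑ m ∈ Finset.range (j + 1),
    PowerSeries.coeff (j - m) (expSeries (a • tailSeries h)) *
      sumOrOne (Finset.Icc 1 m) (fun r => genBinom (-(((d : ℝ) + j) / 2)) r *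
        (compPoly m r f / f 0 ^ r))

section Coefficients

section Topological

variable {E : Type*} [TopologicalSpace E]

theorem continuous_coeff_pow {c : E → PowerSeries ℝ}
    (hc : ∀ j, Continuous fun x => PowerSeries.coeff j (c x)) (k j : ℕ) :
    Continuous fun x => PowerSeries.coeff j (c x ^ k) := by
  induction k generalizing j with
  | zero => simp only [pow_zero]; exact continuous_const
  | succ k ih =>
    simp only [pow_succ, PowerSeries.coeff_mul]
    exact continuous_finsetSum _ fun p _ => (ih p.1).mul (hc p.2)

theorem continuous_coeff_expSeries {c : E → PowerSeries ℝ}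
    (hc : ∀ j, Continuous fun x => PowerSeries.coeff j (c x)) (j : ℕ) :
    Continuous fun x => PowerSeries.coeff j (expSeries (c x)) := by
  simp only [expSeries, PowerSeries.coeff_mk]
  exact continuous_finsetSum _ fun k _ => (continuous_coeff_pow hc k j).div_const _

theorem continuous_coeff_tailSeries {f : ℕ → E → ℝ} (hf : ∀ j, Continuous (f j)) (j : ℕ) :
    Continuous fun x => PowerSeries.coeff j (tailSeries fun i => f i x) := by
  simp only [coeff_tailSeries]
  split_ifs
  · exact continuous_const
  · exact hf j

end Topological

variable {E : Type*} [NormedAddCommGroup E] [NormedSpace ℝ E]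

theorem coeff_expSeries_rescale (s : ℝ) (U : PowerSeries ℝ) (j : ℕ) :
    PowerSeries.coeff j (expSeries (PowerSeries.rescale s U)) =
      s ^ j * PowerSeries.coeff j (expSeries U) := by
  simp only [expSeries, PowerSeries.coeff_mk, ← map_pow, PowerSeries.coeff_rescale,
    Finset.mul_sum, mul_div_assoc]

variable {f h : ℕ → E → ℝ}

theorem coeff_tailSeries_pow_smul (hf : ∀ j (s : ℝ) x, f j (s • x) = s ^ (j + 2) * f j x)
    (m r : ℕ) (s : ℝ) (x : E) :
    PowerSeries.coeff m ((tailSeries fun i => f i (s • x)) ^ r) =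
      s ^ (m + 2 * r) * PowerSeries.coeff m ((tailSeries fun i => f i x) ^ r) := by
  have e : (tailSeries fun i => f i (s • x)) =
      s ^ 2 • PowerSeries.rescale s (tailSeries fun i => f i x) := by
    ext j
    rw [coeff_tailSeries, map_smul, PowerSeries.coeff_rescale, coeff_tailSeries, hf]
    split_ifs
    · simp
    · simp only [smul_eq_mul]; ring
  rw [e, smul_pow, map_smul, ← map_pow, PowerSeries.coeff_rescale, smul_eq_mul]
  ring

theorem coeff_expSeries_tailSeries_smul (hh : ∀ j (s : ℝ) x, h j (s • x) = s ^ j * h j x)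
    (a : ℝ) (j : ℕ) (s : ℝ) (x : E) :
    PowerSeries.coeff j (expSeries (a • tailSeries fun i => h i (s • x))) =
      s ^ j * PowerSeries.coeff j (expSeries (a • tailSeries fun i => h i x)) := by
  rw [← coeff_expSeries_rescale]
  congr 2
  ext i
  rw [map_smul, PowerSeries.coeff_rescale, map_smul, coeff_tailSeries, coeff_tailSeries, hh]
  split_ifs
  · simp
  · simp only [smul_eq_mul]; ring

/-- Only the factor coming from `f` is expanded into powers, because the power `r` decides the
homogeneity; the other factor stays an exponential, whose coefficients are the `g_{j-m}`. -/
theorem coeff_expSeries_neg_add (a : ℝ) (j : ℕ) (y z : ℕ → ℝ) :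
    PowerSeries.coeff j (expSeries ((-1 : ℝ) • tailSeries y + a • tailSeries z)) =
      ∑ m ∈ Finset.range (j + 1), ∑ r ∈ Finset.range (m + 1), (-1) ^ r / (r.factorial : ℝ) *
        (PowerSeries.coeff (j - m) (expSeries (a • tailSeries z)) *
          PowerSeries.coeff m (tailSeries y ^ r)) := by
  have h1 : PowerSeries.constantCoeff ((-1 : ℝ) • tailSeries y) = 0 := by
    rw [smul_tailSeries, constantCoeff_tailSeries]
  have h2 : PowerSeries.constantCoeff (a • tailSeries z) = 0 := by
    rw [smul_tailSeries, constantCoeff_tailSeries]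
  rw [expSeries_add h1 h2, PowerSeries.coeff_mul, Finset.Nat.sum_antidiagonal_eq_sum_range_succ
    (fun p q => PowerSeries.coeff p (expSeries ((-1 : ℝ) • tailSeries y)) *
      PowerSeries.coeff q (expSeries (a • tailSeries z)))]
  refine Finset.sum_congr rfl fun m _ => ?_
  rw [coeff_expSeries h1 (Nat.lt_succ_self m), Finset.sum_mul]
  refine Finset.sum_congr rfl fun r _ => ?_
  rw [smul_pow, map_smul, smul_eq_mul]
  ring

variable [FiniteDimensional ℝ E] [MeasurableSpace E] [BorelSpace E]
  (μ : MeasureTheory.Measure E) [μ.IsAddHaarMeasure]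

theorem integrable_toSphere_of_continuous {g : Metric.sphere (0 : E) 1 → ℝ} (hg : Continuous g) :
    MeasureTheory.Integrable g μ.toSphere := by
  have : ProperSpace E := FiniteDimensional.proper_real E
  have : CompactSpace (Metric.sphere (0 : E) 1) :=
    isCompact_iff_compactSpace.1 (isCompact_sphere _ _)
  exact hg.integrable_of_hasCompactSupport (HasCompactSupport.of_compactSpace g)

/-- The coefficient is a finite sum of homogeneous functions, of degree `j + 2r` for the terms with
`r` factors `f_i`. Each is integrated in polar coordinates and the results are collected by
`Gamma_mul_genBinom`. -/
theorem integral_exp_neg_mul_coeff_expSeries [Nontrivial E] (cf : ∀ j, Continuous (f j))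
    (ch : ∀ j, Continuous (h j))
    (hf : ∀ j (s : ℝ) x, f j (s • x) = s ^ (j + 2) * f j x)
    (hh : ∀ j (s : ℝ) x, h j (s • x) = s ^ j * h j x)
    (hpos : ∀ x, x ≠ 0 → 0 < f 0 x)
    (hi : ∀ g : E → ℝ, ∀ n : ℕ, Continuous g → (∀ (s : ℝ) x, g (s • x) = s ^ n * g x) →
      MeasureTheory.Integrable (fun x => Real.exp (-f 0 x) * g x) μ) (a : ℝ) (j : ℕ) :
    ∫ x, Real.exp (-f 0 x) * PowerSeries.coeff j
        (expSeries ((-1 : ℝ) • (tailSeries fun i => f i x) + a • tailSeries fun i => h i x)) ∂μ =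
      1 / 2 * Real.Gamma (((Module.finrank ℝ E : ℝ) + j) / 2) *
        ∫ Ω : Metric.sphere (0 : E) 1, sphereCoeff (Module.finrank ℝ E) j a
          (fun i => f i Ω) (fun i => h i Ω) ∂μ.toSphere := by
  set d := Module.finrank ℝ E
  have hd : 0 < d := Module.finrank_pos
  set α : ℝ := ((d : ℝ) + j) / 2 with hα
  have hαpos : 0 < α := by positivity
  set P : ℕ → ℕ → E → ℝ := fun m r x =>
    PowerSeries.coeff (j - m) (expSeries (a • tailSeries fun i => h i x)) *
          PowerSeries.coeff m ((tailSeries fun i => f i x) ^ r) with hP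
  have cP : ∀ m r, Continuous (P m r) := fun m r =>
    (continuous_coeff_expSeries (fun i => by
      simp only [map_smul]
      exact (continuous_coeff_tailSeries ch i).const_smul a) _).mul
      (continuous_coeff_pow (continuous_coeff_tailSeries cf) r m)
  -- The degree does not depend on `m`: the exponential factor has degree `j - m`, the power of the
  -- tail of `f` has degree `m + 2r`.
  have sP : ∀ m ∈ Finset.range (j + 1), ∀ r (s : ℝ) x, P m r (s • x) = s ^ (j + 2 * r) * P m r x := by
    intro m hm r s x
    simp only [hP]
    rw [coeff_expSeries_tailSeries_smul hh, coeff_tailSeries_pow_smul hf]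
    have : j + 2 * r = (j - m) + (m + 2 * r) := by have := Finset.mem_range.1 hm; omega
    rw [this, pow_add s (j - m)]
    ring
  have hsph : ∀ Ω : Metric.sphere (0 : E) 1, (Ω : E) ≠ 0 := fun Ω =>
    ne_of_mem_of_not_mem Ω.2 (by simp)
  have key : ∀ m ∈ Finset.range (j + 1), ∀ r,
      ∫ x, Real.exp (-f 0 x) * P m r x ∂μ = 1 / 2 * Real.Gamma (α + r) *
        ∫ Ω : Metric.sphere (0 : E) 1, f 0 Ω ^ (-α) * (P m r Ω / f 0 Ω ^ r) ∂μ.toSphere := by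
    intro m hm r
    have e : ((d : ℝ) + ((j + 2 * r : ℕ) : ℝ)) / 2 = α + r := by
      rw [hα]; push_cast; ring
    rw [integral_exp_neg_mul_homogeneous μ (fun s x => by simpa using hf 0 s x) (sP m hm r) hpos
      (hi _ _ (cP m r) (sP m hm r)), e]
    congr 1
    refine MeasureTheory.integral_congr_ae (Filter.Eventually.of_forall fun Ω => ?_)
    have h0 := hpos _ (hsph Ω)
    simp only
    rw [neg_add, Real.rpow_add h0, Real.rpow_neg h0.le (r : ℝ), Real.rpow_natCast]
    field_simp
  have hint : ∀ m r, MeasureTheory.Integrable (fun Ω : Metric.sphere (0 : E) 1 =>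
      f 0 Ω ^ (-α) * (P m r Ω / f 0 Ω ^ r)) μ.toSphere := by
    intro m r
    refine integrable_toSphere_of_continuous μ ?_
    have c0 : Continuous fun Ω : Metric.sphere (0 : E) 1 => f 0 Ω :=
      (cf 0).comp continuous_subtype_val
    refine (c0.rpow_const fun Ω => Or.inl (hpos _ (hsph Ω)).ne').mul
      (((cP m r).comp continuous_subtype_val).div (c0.pow r)
        fun Ω => pow_ne_zero _ (hpos _ (hsph Ω)).ne')
  have e1 : ∀ x, Real.exp (-f 0 x) * PowerSeries.coeff j
      (expSeries ((-1 : ℝ) • (tailSeries fun i => f i x) + a • tailSeries fun i => h i x)) =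
      ∑ m ∈ Finset.range (j + 1), ∑ r ∈ Finset.range (m + 1), (-1) ^ r / (r.factorial : ℝ) *
        (Real.exp (-f 0 x) * P m r x) := by
    intro x
    rw [coeff_expSeries_neg_add, Finset.mul_sum]
    refine Finset.sum_congr rfl fun m _ => ?_
    rw [Finset.mul_sum]
    exact Finset.sum_congr rfl fun r _ => by simp only [hP]; ring
  have e2 : ∀ Ω : Metric.sphere (0 : E) 1, sphereCoeff d j a
          (fun i => f i Ω) (fun i => h i Ω) =
      ∑ m ∈ Finset.range (j + 1), ∑ r ∈ Finset.range (m + 1), genBinom (-α) r *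
        (f 0 Ω ^ (-α) * (P m r Ω / f 0 Ω ^ r)) := by
    intro Ω
    rw [sphereCoeff, Finset.mul_sum]
    refine Finset.sum_congr rfl fun m _ => ?_
    rw [sumOrOne_genBinom_eq, Finset.mul_sum, Finset.mul_sum]
    exact Finset.sum_congr rfl fun r _ => by simp only [hP]; ring
  simp only [e1, e2]
  rw [MeasureTheory.integral_finsetSum _ fun m hm => MeasureTheory.integrable_finsetSum _ fun r _ =>
      (hi _ _ (cP m r) (sP m hm r)).const_mul _,
    MeasureTheory.integral_finsetSum _ fun m hm => MeasureTheory.integrable_finsetSum _ fun r _ =>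
      (hint m r).const_mul _, Finset.mul_sum]
  refine Finset.sum_congr rfl fun m hm => ?_
  rw [MeasureTheory.integral_finsetSum _ fun r _ => (hi _ _ (cP m r) (sP m hm r)).const_mul _,
    MeasureTheory.integral_finsetSum _ fun r _ => (hint m r).const_mul _, Finset.mul_sum]
  refine Finset.sum_congr rfl fun r _ => ?_
  rw [MeasureTheory.integral_const_mul, MeasureTheory.integral_const_mul, key m hm r]
  have := Gamma_mul_genBinom hαpos r
  linear_combination (-(1 / 2 : ℝ) * ∫ Ω : Metric.sphere (0 : E) 1, f 0 Ω ^ (-α) * (P m r Ω / f 0 Ω ^ r) ∂μ.toSphere) * this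

theorem integral_exp_neg_mul_coeff_expSeries_odd
    (hf : ∀ j (s : ℝ) x, f j (s • x) = s ^ (j + 2) * f j x)
    (hh : ∀ j (s : ℝ) x, h j (s • x) = s ^ j * h j x) (a : ℝ) {j : ℕ} (hj : Odd j) :
    ∫ x, Real.exp (-f 0 x) * PowerSeries.coeff j
        (expSeries ((-1 : ℝ) • (tailSeries fun i => f i x) + a • tailSeries fun i => h i x)) ∂μ =
      0 := by
  set F : E → ℝ := fun x => Real.exp (-f 0 x) * PowerSeries.coeff j
    (expSeries ((-1 : ℝ) • (tailSeries fun i => f i x) + a • tailSeries fun i => h i x)) with hF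
  have hneg : ∀ x, F (-x) = -F x := by
    intro x
    rw [← neg_one_smul ℝ x]
    -- The shift by `2` in the degree of `f_i` does not affect parity, so reflecting `x` is the
    -- substitution `X ↦ -X` in the series, which changes the sign of odd coefficients.
    have e : ((-1 : ℝ) • (tailSeries fun i => f i ((-1 : ℝ) • x)) +
          a • tailSeries fun i => h i ((-1 : ℝ) • x)) =
        PowerSeries.rescale (-1)
          ((-1 : ℝ) • (tailSeries fun i => f i x) + a • tailSeries fun i => h i x) := by
      ext i
      simp only [map_add, map_smul, PowerSeries.coeff_rescale, coeff_tailSeries, hf, hh,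
        smul_eq_mul]
      split_ifs
      · simp
      · ring
    simp only [hF]
    rw [e, coeff_expSeries_rescale, hf, hj.neg_one_pow]
    ring_nf
  have h1 := MeasureTheory.integral_neg_eq_self F μ
  simp only [hneg, MeasureTheory.integral_neg] at h1
  linarith

end Coefficients

/-! ## Vector fields and directional derivatives -/

section Fields

variable {n : ℕ} {M : Type*} [TopologicalSpace M]
  [ChartedSpace (EuclideanSpace ℝ (Fin (2 * n))) M]

theorem dirDeriv_add_field (V W : ∀ x : M, TangentSpace (𝓡 (2 * n)) x) (f : M → ℝ) (x : M) :
    dirDeriv (V + W) f x = dirDeriv V f x + dirDeriv W f x :=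
  map_add (mfderiv (𝓡 (2 * n)) 𝓘(ℝ, ℝ) f x) (V x) (W x)

theorem dirDeriv_smul_field (c : ℝ) (V : ∀ x : M, TangentSpace (𝓡 (2 * n)) x) (f : M → ℝ) (x : M) :
    dirDeriv (c • V) f x = c * dirDeriv V f x :=
  map_smul (mfderiv (𝓡 (2 * n)) 𝓘(ℝ, ℝ) f x) c (V x)

theorem dirDeriv_sum_field {ι : Type*} (s : Finset ι) (c : ι → ℝ)
    (V : ι → ∀ x : M, TangentSpace (𝓡 (2 * n)) x) (f : M → ℝ) (x : M) :
    dirDeriv (fun y => ∑ i ∈ s, c i • V i y) f x = ∑ i ∈ s, c i * dirDeriv (V i) f x := by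
  unfold dirDeriv
  rw [map_sum]
  exact Finset.sum_congr rfl fun i _ => map_smul _ _ _

theorem dirDeriv_add {V : ∀ x : M, TangentSpace (𝓡 (2 * n)) x} {f g : M → ℝ} {x : M}
    (hf : MDifferentiableAt (𝓡 (2 * n)) 𝓘(ℝ, ℝ) f x)
    (hg : MDifferentiableAt (𝓡 (2 * n)) 𝓘(ℝ, ℝ) g x) :
    dirDeriv V (fun y => f y + g y) x = dirDeriv V f x + dirDeriv V g x :=
  congrArg (fun L : TangentSpace (𝓡 (2 * n)) x →L[ℝ] ℝ => L (V x)) (mfderiv_add hf hg)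

theorem dirDeriv_mul {V : ∀ x : M, TangentSpace (𝓡 (2 * n)) x} {f g : M → ℝ} {x : M}
    (hf : MDifferentiableAt (𝓡 (2 * n)) 𝓘(ℝ, ℝ) f x)
    (hg : MDifferentiableAt (𝓡 (2 * n)) 𝓘(ℝ, ℝ) g x) :
    dirDeriv V (fun y => f y * g y) x = f x * dirDeriv V g x + g x * dirDeriv V f x :=
  congrArg (fun L : TangentSpace (𝓡 (2 * n)) x →L[ℝ] ℝ => L (V x)) (hf.hasMFDerivAt.mul hg.hasMFDerivAt).mfderiv

theorem dirDeriv_const (V : ∀ x : M, TangentSpace (𝓡 (2 * n)) x) (c : ℝ) (x : M) :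
    dirDeriv V (fun _ => c) x = 0 :=
  congrArg (fun L : TangentSpace (𝓡 (2 * n)) x →L[ℝ] ℝ => L (V x)) mfderiv_const

theorem dirDeriv_const_mul {V : ∀ x : M, TangentSpace (𝓡 (2 * n)) x} {f : M → ℝ} {x : M} (c : ℝ)
    (hf : MDifferentiableAt (𝓡 (2 * n)) 𝓘(ℝ, ℝ) f x) :
    dirDeriv V (fun y => c * f y) x = c * dirDeriv V f x := by
  rw [dirDeriv_mul mdifferentiableAt_const hf, dirDeriv_const]
  ring

theorem dirDeriv_sum {ι : Type*} {V : ∀ x : M, TangentSpace (𝓡 (2 * n)) x} {s : Finset ι}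
    {f : ι → M → ℝ} {x : M} (hf : ∀ i ∈ s, ContMDiffAt (𝓡 (2 * n)) 𝓘(ℝ, ℝ) ∞ (f i) x) :
    dirDeriv V (fun y => ∑ i ∈ s, f i y) x = ∑ i ∈ s, dirDeriv V (f i) x := by
  classical
  induction s using Finset.induction_on with
  | empty => simpa using dirDeriv_const V 0 x
  | insert i s hi ih =>
    simp only [Finset.sum_insert hi]
    rw [dirDeriv_add ((hf i (by simp)).mdifferentiableAt (by simp))
      ((contMDiffAt_finsetSum fun k hk => hf k (by simp [hk])).mdifferentiableAt (by simp)),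
      ih fun k hk => hf k (by simp [hk])]

theorem dirDeriv_congr {V : ∀ x : M, TangentSpace (𝓡 (2 * n)) x} {f g : M → ℝ} {x : M}
    (h : f =ᶠ[𝓝 x] g) : dirDeriv V f x = dirDeriv V g x :=
  congrArg (fun L : TangentSpace (𝓡 (2 * n)) x →L[ℝ] ℝ => L (V x)) h.mfderiv_eq

variable [IsManifold (𝓡 (2 * n)) ∞ M]

/-- A vector field is smooth at a point. -/
def SmoothFieldAt (V : ∀ x : M, TangentSpace (𝓡 (2 * n)) x) (x : M) : Prop :=
  ContMDiffAt (𝓡 (2 * n)) (𝓡 (2 * n)).tangent ∞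
    (fun x => (⟨x, V x⟩ : TangentBundle (𝓡 (2 * n)) M)) x

theorem SmoothFieldAt.mdifferentiableAt {V : ∀ x : M, TangentSpace (𝓡 (2 * n)) x} {x : M}
    (hV : SmoothFieldAt V x) : MDifferentiableAt (𝓡 (2 * n)) (𝓡 (2 * n)).tangent
      (fun x => (⟨x, V x⟩ : TangentBundle (𝓡 (2 * n)) M)) x :=
  ContMDiffAt.mdifferentiableAt hV (by simp)

theorem contMDiffAt_dirDeriv {V : ∀ x : M, TangentSpace (𝓡 (2 * n)) x} {f : M → ℝ} {x : M}
    (hV : SmoothFieldAt V x) (hf : ContMDiffAt (𝓡 (2 * n)) 𝓘(ℝ, ℝ) ∞ f x) :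
    ContMDiffAt (𝓡 (2 * n)) 𝓘(ℝ, ℝ) ∞ (dirDeriv V f) x := by
  have h1 := ContMDiffAt.mfderiv_const (m := ∞) hf (by simp)
  have h2 := ContMDiffAt.clm_apply_of_inCoordinates h1 hV hf
  exact (contMDiff_snd_tangentBundle_modelSpace ℝ 𝓘(ℝ, ℝ)).contMDiffAt.comp x h2

theorem contMDiff_dirDeriv {V : ∀ x : M, TangentSpace (𝓡 (2 * n)) x} {f : M → ℝ}
    (hV : SmoothField V) (hf : ContMDiff (𝓡 (2 * n)) 𝓘(ℝ, ℝ) ∞ f) :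
    ContMDiff (𝓡 (2 * n)) 𝓘(ℝ, ℝ) ∞ (dirDeriv V f) :=
  fun x => contMDiffAt_dirDeriv (hV x) (hf x)

theorem contMDiff_iterDirDeriv {V : ∀ x : M, TangentSpace (𝓡 (2 * n)) x} {f : M → ℝ}
    (hV : SmoothField V) (hf : ContMDiff (𝓡 (2 * n)) 𝓘(ℝ, ℝ) ∞ f) (p : ℕ) :
    ContMDiff (𝓡 (2 * n)) 𝓘(ℝ, ℝ) ∞ (iterDirDeriv V p f) := by
  unfold iterDirDeriv
  induction p with
  | zero => exact hf
  | succ p ih =>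
    rw [Function.iterate_succ_apply']
    exact contMDiff_dirDeriv hV ih

variable (K : KahlerStructure n M)

theorem KahlerStructure.contMDiffAt_form {V W : ∀ x : M, TangentSpace (𝓡 (2 * n)) x} {x : M}
    (hV : SmoothFieldAt V x) (hW : SmoothFieldAt W x) :
    ContMDiffAt (𝓡 (2 * n)) 𝓘(ℝ, ℝ) ∞ (fun y => K.form y (V y) (W y)) x := by
  have h := ContMDiffAt.clm_bundle_apply₂ (F₁ := EuclideanSpace ℝ (Fin (2 * n)))
    (F₂ := EuclideanSpace ℝ (Fin (2 * n))) (F₃ := ℝ) (E₃ := Bundle.Trivial M ℝ)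
    (E₁ := fun x : M => TangentSpace (𝓡 (2 * n)) x) (E₂ := fun x : M => TangentSpace (𝓡 (2 * n)) x)
    (b := fun y : M => y) (ψ := K.form) (K.smooth_form x) hV hW
  simpa using (Bundle.contMDiffAt_totalSpace.1 h).2

theorem KahlerStructure.smoothFieldAt_J {V : ∀ x : M, TangentSpace (𝓡 (2 * n)) x} {x : M}
    (hV : SmoothFieldAt V x) : SmoothFieldAt (fun y => K.J y (V y)) x :=
  ContMDiffAt.clm_bundle_apply (F₁ := EuclideanSpace ℝ (Fin (2 * n)))
    (F₂ := EuclideanSpace ℝ (Fin (2 * n)))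
    (E₁ := fun x : M => TangentSpace (𝓡 (2 * n)) x) (E₂ := fun x : M => TangentSpace (𝓡 (2 * n)) x)
    (b := fun y : M => y) (ϕ := K.J) (K.smooth_J x) hV

theorem KahlerStructure.eq_of_metric_eq {x : M} {v w : TangentSpace (𝓡 (2 * n)) x}
    (h : ∀ u, K.metric x v u = K.metric x w u) : v = w := by
  by_contra hne
  have h1 := K.pos x (v - w) (sub_ne_zero.2 hne)
  have h2 := h (v - w)
  simp only [KahlerStructure.metric] at h2
  rw [map_sub, _root_.sub_apply, h2, sub_self] at h1
  exact lt_irrefl _ h1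

theorem KahlerStructure.grad_eq_of_metric_eq {f : M → ℝ} {x : M} {v : TangentSpace (𝓡 (2 * n)) x}
    (h : ∀ w, K.metric x v w = mfderiv (𝓡 (2 * n)) 𝓘(ℝ, ℝ) f x w) : K.grad f x = v :=
  K.eq_of_metric_eq fun w => ((K.exists_grad f x).choose_spec w).trans (h w).symm

end Fields

/-! ### The infinitesimal action and the moment map. -/

section Action

variable {n d : ℕ} {M : Type*} [TopologicalSpace M]
  [ChartedSpace (EuclideanSpace ℝ (Fin (2 * n))) M]
  {G : Type*} [Group G] [TopologicalSpace G]
  [ChartedSpace (EuclideanSpace ℝ (Fin d)) G] [MulAction G M]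

theorem infAction_add (ξ η : GroupLieAlgebra (𝓡 d) G) (x : M) :
    infAction (n := n) (ξ + η) x = infAction (n := n) ξ x + infAction (n := n) η x :=
  map_add (mfderiv (𝓡 d) (𝓡 (2 * n)) (fun g : G => g • x) 1) ξ η

theorem infAction_smul (c : ℝ) (ξ : GroupLieAlgebra (𝓡 d) G) (x : M) :
    infAction (n := n) (c • ξ) x = c • infAction (n := n) ξ x :=
  map_smul (mfderiv (𝓡 d) (𝓡 (2 * n)) (fun g : G => g • x) 1) c ξ

variable [IsManifold (𝓡 (2 * n)) ∞ M] (K : KahlerStructure n M)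

theorem imagField_add (ξ η : GroupLieAlgebra (𝓡 d) G) :
    imagField K (ξ + η) = imagField K ξ + imagField K η := by
  funext x
  rw [imagField, infAction_add, map_add]
  rfl

theorem imagField_smul (c : ℝ) (ξ : GroupLieAlgebra (𝓡 d) G) :
    imagField K (c • ξ) = c • imagField K ξ := by
  funext x
  rw [imagField, infAction_smul, map_smul]
  rfl

theorem imagField_zero : imagField K (0 : GroupLieAlgebra (𝓡 d) G) = 0 := by
  have h := imagField_smul K 0 (0 : GroupLieAlgebra (𝓡 d) G)
  rwa [zero_smul, zero_smul] at h

theorem imagField_sum {ι : Type*} (s : Finset ι) (c : ι → ℝ) (ξ : ι → GroupLieAlgebra (𝓡 d) G) :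
    imagField K (∑ i ∈ s, c i • ξ i) = fun x => ∑ i ∈ s, c i • imagField K (ξ i) x := by
  classical
  induction s using Finset.induction_on with
  | empty => simp only [Finset.sum_empty]; exact imagField_zero K
  | insert i s hi ih =>
    simp only [Finset.sum_insert hi]
    rw [imagField_add, ih, imagField_smul]
    rfl

/-- The tangent map of the action `G × M → M` is smooth, and `X^ξ` at `x` is its value at the vector
`(ξ, 0)` over `(1, x)`. -/
theorem smoothField_infAction [IsManifold (𝓡 d) ∞ G] [ContMDiffSMul (𝓡 d) (𝓡 (2 * n)) ∞ G M]
    (ξ : GroupLieAlgebra (𝓡 d) G) :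
    SmoothField (fun x : M => infAction (n := n) ξ x) := by
  let fx : M → TangentBundle (𝓡 (2 * n)) M := fun x => Bundle.TotalSpace.mk' _ x 0
  have sfx : ContMDiff (𝓡 (2 * n)) (𝓡 (2 * n)).tangent ∞ fx := Bundle.contMDiff_zeroSection _ _
  let fξ : M → TangentBundle (𝓡 d) G := fun _ => Bundle.TotalSpace.mk' _ 1 ξ
  have sfξ : ContMDiff (𝓡 (2 * n)) (𝓡 d).tangent ∞ fξ := contMDiff_const
  have S₁ := sfξ.prodMk sfx
  have S₂ := contMDiff_equivTangentBundleProd_symm (𝕜 := ℝ) (I := 𝓡 d) (M := G) (I' := 𝓡 (2 * n))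
    (M' := M) (n := ∞)
  have hsm : ContMDiff ((𝓡 d).prod (𝓡 (2 * n))) (𝓡 (2 * n)) ∞ (fun p : G × M => p.1 • p.2) :=
    contMDiff_smul
  have S₃ := hsm.contMDiff_tangentMap (m := ∞) (by simp)
  have S := (S₃.comp S₂).comp S₁
  unfold SmoothField
  convert! S with x
  · simp [fx, fξ]
  · simp only [Function.comp_apply, tangentMap, fx, fξ]
    rw [mfderiv_prod_eq_add_apply (hsm.mdifferentiableAt (by simp))]
    change _ = mfderiv (𝓡 d) (𝓡 (2 * n)) (fun g : G => g • x) 1 ξ +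
      mfderiv (𝓡 (2 * n)) (𝓡 (2 * n)) (fun y : M => (1 : G) • y) x 0
    rw [map_zero, add_zero]
    rfl

theorem smoothField_imagField [IsManifold (𝓡 d) ∞ G] [ContMDiffSMul (𝓡 d) (𝓡 (2 * n)) ∞ G M]
    (ξ : GroupLieAlgebra (𝓡 d) G) : SmoothField (imagField K ξ) :=
  fun x => K.smoothFieldAt_J (smoothField_infAction ξ x)

variable {K} {Φ : M → Module.Dual ℝ (GroupLieAlgebra (𝓡 d) G)}

/-- The gradient of a component of the moment map is `J X^ξ`. -/
theorem IsHamiltonian.grad_eq (hΦ : IsHamiltonian K Φ) (ξ : GroupLieAlgebra (𝓡 d) G) :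
    K.grad (fun y => Φ y ξ) = imagField K ξ := by
  funext x
  refine K.grad_eq_of_metric_eq fun w => ?_
  rw [hΦ.hamilton, KahlerStructure.metric, imagField, K.form_J]

/-- `dφ_ξ(JX^ξ) = ω(X^ξ, JX^ξ) = |X^ξ|²`. This yields both the convexity of `f` and the value of
`f_0`. -/
theorem IsHamiltonian.dirDeriv_eq (hΦ : IsHamiltonian K Φ) (ξ : GroupLieAlgebra (𝓡 d) G) (x : M) :
    dirDeriv (imagField K ξ) (fun y => Φ y ξ) x = K.length x (infAction ξ x) ^ 2 := by
  have h : dirDeriv (imagField K ξ) (fun y => Φ y ξ) x =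
      K.metric x (infAction ξ x) (infAction ξ x) := hΦ.hamilton ξ x _
  rw [h, KahlerStructure.length, Real.sq_sqrt]
  by_cases h0 : infAction (n := n) ξ x = 0
  · rw [h0, KahlerStructure.metric, map_zero, _root_.zero_apply]
  · exact (K.pos x _ h0).le

/-- The infinitesimal action is injective on the zero set of the moment map. -/
theorem IsHamiltonian.infAction_ne_zero (hΦ : IsHamiltonian K Φ)
    (hreg : ZeroIsRegularValue (n := n) Φ) {x : M} (hx : Φ x = 0) {ξ : GroupLieAlgebra (𝓡 d) G}
    (hξ : ξ ≠ 0) : infAction (n := n) ξ x ≠ 0 := by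
  intro h
  -- If `X^ξ` vanishes at `x`, then every value of `dΦ` vanishes on `ξ`; as `dΦ` is onto, so does
  -- every functional, and `ξ = 0`.
  refine hξ ((Module.forall_dual_apply_eq_zero_iff ℝ (V := EuclideanSpace ℝ (Fin d)) ξ).1 fun α => ?_)
  obtain ⟨v, hv⟩ := hreg x hx α
  have h1 := hv ξ
  rw [hΦ.hamilton, h, map_zero] at h1
  exact h1.symm

end Action

/-! ## Powers of a two-form -/

section Linear

variable {V : Type*} [AddCommGroup V] [Module ℝ V] {n : ℕ}

/-- The index `2 i` in `Fin (2 n)`. -/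
abbrev evenIdx (i : Fin n) : Fin (2 * n) := ⟨2 * (i : ℕ), by omega⟩

/-- The index `2 i + 1` in `Fin (2 n)`. -/
abbrev oddIdx (i : Fin n) : Fin (2 * n) := ⟨2 * (i : ℕ) + 1, by omega⟩

/-- The `j`-th vector enters only the factor with index `⌊j/2⌋`, and there linearly in one of the
two slots. -/
theorem prod_update_eq (B : V →ₗ[ℝ] V →ₗ[ℝ] ℝ) (v : Fin (2 * n) → V) (j : Fin (2 * n)) :
    ∃ L : V →ₗ[ℝ] ℝ, ∀ x : V, ∏ i : Fin n, B (Function.update v j x (evenIdx i))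
      (Function.update v j x (oddIdx i)) = L x := by
  set i₀ : Fin n := ⟨(j : ℕ) / 2, by omega⟩ with hi₀
  set R : ℝ := ∏ i ∈ Finset.univ.erase i₀, B (v (evenIdx i)) (v (oddIdx i)) with hR
  have hrest : ∀ x, ∏ i ∈ Finset.univ.erase i₀, B (Function.update v j x (evenIdx i))
      (Function.update v j x (oddIdx i)) = R := by
    intro x
    refine Finset.prod_congr rfl fun i hi => ?_
    have hne : (i : ℕ) ≠ (j : ℕ) / 2 := fun h => (Finset.ne_of_mem_erase hi) (Fin.ext h)
    rw [Function.update_of_ne (Fin.ne_of_val_ne (show 2 * (i : ℕ) ≠ j by omega)),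
      Function.update_of_ne (Fin.ne_of_val_ne (show 2 * (i : ℕ) + 1 ≠ j by omega))]
  have hsplit : ∀ x, ∏ i : Fin n, B (Function.update v j x (evenIdx i))
      (Function.update v j x (oddIdx i)) = B (Function.update v j x (evenIdx i₀))
      (Function.update v j x (oddIdx i₀)) * R := by
    intro x
    rw [← Finset.mul_prod_erase _ _ (Finset.mem_univ i₀), hrest]
  rcases Nat.mod_two_eq_zero_or_one j with h | h
  · have e1 : evenIdx i₀ = j := Fin.ext (by simp only [hi₀]; omega)
    have e2 : oddIdx i₀ ≠ j := Fin.ne_of_val_ne (by simp only [hi₀]; omega)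
    refine ⟨R • (B.flip (v (oddIdx i₀))), fun x => ?_⟩
    rw [hsplit, Function.update_of_ne e2, e1, Function.update_self]
    simp [mul_comm]
  · have e1 : oddIdx i₀ = j := Fin.ext (by simp only [hi₀]; omega)
    have e2 : evenIdx i₀ ≠ j := Fin.ne_of_val_ne (by simp only [hi₀]; omega)
    refine ⟨R • (B (v (evenIdx i₀))), fun x => ?_⟩
    rw [hsplit, Function.update_of_ne e2, e1, Function.update_self]
    simp [mul_comm]

/-- The multilinear map `v ↦ ∏ B (v_{2i}, v_{2i+1})`. -/
def pairProd (n : ℕ) (B : V →ₗ[ℝ] V →ₗ[ℝ] ℝ) : MultilinearMap ℝ (fun _ : Fin (2 * n) => V) ℝ where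
  toFun v := ∏ i : Fin n, B (v (evenIdx i)) (v (oddIdx i))
  map_update_add' {inst} v j x y := by
    obtain rfl : inst = instDecidableEqFin _ := Subsingleton.elim _ _
    obtain ⟨L, hL⟩ := prod_update_eq B v j
    rw [hL, hL, hL, map_add]
  map_update_smul' {inst} v j c x := by
    obtain rfl : inst = instDecidableEqFin _ := Subsingleton.elim _ _
    obtain ⟨L, hL⟩ := prod_update_eq B v j
    rw [hL, hL, map_smul]

/-- The alternating form `B ^ n = B ∧ ⋯ ∧ B`. -/
def formPow (n : ℕ) (B : V →ₗ[ℝ] V →ₗ[ℝ] ℝ) : V [⋀^Fin (2 * n)]→ₗ[ℝ] ℝ :=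
  (1 / 2 ^ n : ℝ) • MultilinearMap.alternatization (pairProd n B)

theorem formPow_apply (B : V →ₗ[ℝ] V →ₗ[ℝ] ℝ) (v : Fin (2 * n) → V) :
    formPow n B v = (1 / 2 ^ n : ℝ) * ∑ σ : Equiv.Perm (Fin (2 * n)),
      ((Equiv.Perm.sign σ : ℤ) : ℝ) * ∏ i : Fin n, B (v (σ (evenIdx i))) (v (σ (oddIdx i))) := by
  rw [formPow, AlternatingMap.smul_apply, MultilinearMap.alternatization_apply, smul_eq_mul]
  congr 1
  refine Finset.sum_congr rfl fun σ _ => ?_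
  rw [Units.smul_def, zsmul_eq_mul]
  rfl

/-- A permutation of `Fin n × Fin 2` that permutes the fibers over `Fin n` is even up to the
signs on the fibers. -/
theorem sign_mul_prod_eq_one (σ : Equiv.Perm (Fin n × Fin 2))
    (h : ∀ i, (σ (i, 0)).1 = (σ (i, 1)).1) :
    ((Equiv.Perm.sign σ : ℤ) : ℝ) *
      ∏ i : Fin n, (if (σ (i, 0)).2 = 0 then (1 : ℝ) else -1) = 1 := by
  set t : Fin n → Fin n := fun i => (σ (i, 0)).1 with ht
  have h1 : ∀ i a, (σ (i, a)).1 = t i := by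
    intro i a
    fin_cases a
    · rfl
    · exact (h i).symm
  have ts : Function.Surjective t := by
    intro k
    obtain ⟨⟨i, a⟩, hia⟩ := σ.surjective (k, 0)
    exact ⟨i, by rw [← h1 i a, hia]⟩
  let τ : Equiv.Perm (Fin n) := Equiv.ofBijective t (Finite.surjective_iff_bijective.1 ts)
  have pi : ∀ i, Function.Injective fun a => (σ (i, a)).2 := by
    intro i a b hab
    have : σ (i, a) = σ (i, b) := Prod.ext ((h1 i a).trans (h1 i b).symm) hab
    exact (Prod.ext_iff.1 (σ.injective this)).2
  let π : Fin n → Equiv.Perm (Fin 2) := fun i =>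
    Equiv.ofBijective _ (Finite.injective_iff_bijective.1 (pi i))
  have hσ : σ = Equiv.prodCongrLeft (fun _ : Fin 2 => τ) * Equiv.prodCongrRight π := by
    ext ⟨i, a⟩
    · exact congrArg Fin.val (h1 i a)
    · rfl
  have hs : ∀ p : Equiv.Perm (Fin 2), (if p 0 = 0 then (1 : ℝ) else -1) =
      ((Equiv.Perm.sign p : ℤ) : ℝ) := by
    have : ∀ p : Equiv.Perm (Fin 2), (if p 0 = 0 then (1 : ℤ) else -1) = Equiv.Perm.sign p := by
      decide
    intro p
    rw [← this p]
    split_ifs <;> simp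
  -- The permutation `τ` of the fibers acts on two copies of `Fin n`, so its sign is squared away.
  have e1 : Equiv.Perm.sign σ = ∏ i, Equiv.Perm.sign (π i) := by
    rw [hσ, Equiv.Perm.sign_mul, Equiv.Perm.sign_prodCongrLeft, Equiv.Perm.sign_prodCongrRight]
    simp
  have e2 : ∀ i, (if (σ (i, 0)).2 = 0 then (1 : ℝ) else -1) =
      ((Equiv.Perm.sign (π i) : ℤ) : ℝ) := fun i => hs (π i)
  simp only [e1, e2]
  push_cast
  rw [← Finset.prod_mul_distrib]
  refine Finset.prod_eq_one fun i _ => ?_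
  rw [← Int.cast_mul, ← Units.val_mul, Int.units_mul_self]
  simp

/-- The equivalence `(i, a) ↦ 2 i + a`. -/
def pairEquiv (n : ℕ) : Fin n × Fin 2 ≃ Fin (2 * n) :=
  finProdFinEquiv.trans (finCongr (mul_comm n 2))

theorem pairEquiv_zero (i : Fin n) : pairEquiv n (i, 0) = evenIdx i := by
  ext; simp [pairEquiv]

theorem pairEquiv_one (i : Fin n) : pairEquiv n (i, 1) = oddIdx i := by
  ext; simp [pairEquiv, add_comm]

/-- On a symplectic basis nothing cancels: a permutation contributes `1` if it permutes the pairs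
and `0` otherwise, and the identity contributes `1`. -/
theorem formPow_ne_zero_of_standard (B : V →ₗ[ℝ] V →ₗ[ℝ] ℝ) (u : Fin n × Fin 2 → V)
    (hu : ∀ p q, B (u p) (u q) =
      if p.1 = q.1 ∧ p.2 ≠ q.2 then (if p.2 = 0 then 1 else -1) else 0) :
    formPow n B ≠ 0 := by
  intro h0
  have h1 := formPow_apply B fun k => u ((pairEquiv n).symm k)
  rw [h0, AlternatingMap.zero_apply] at h1
  have hpos : (0 : ℝ) < 1 / 2 ^ n := by positivity
  have h2 := (mul_eq_zero.1 h1.symm).resolve_left hpos.ne'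
  set T : Equiv.Perm (Fin (2 * n)) → ℝ := fun σ => ((Equiv.Perm.sign σ : ℤ) : ℝ) *
    ∏ i : Fin n, B (u ((pairEquiv n).symm (σ (evenIdx i)))) (u ((pairEquiv n).symm (σ (oddIdx i))))
    with hT
  have hnn : ∀ σ ∈ Finset.univ, 0 ≤ T σ := by
    intro σ _
    set s : Equiv.Perm (Fin n × Fin 2) := (pairEquiv n).symm.permCongr σ with hs
    have e1 : ∀ i, (pairEquiv n).symm (σ (evenIdx i)) = s (i, 0) := fun i => by
      simp [hs, Equiv.permCongr_apply, pairEquiv_zero]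
    have e2 : ∀ i, (pairEquiv n).symm (σ (oddIdx i)) = s (i, 1) := fun i => by
      simp [hs, Equiv.permCongr_apply, pairEquiv_one]
    have e3 : Equiv.Perm.sign σ = Equiv.Perm.sign s := by
      rw [hs, Equiv.Perm.sign_permCongr]
    simp only [hT, e1, e2, e3, hu]
    by_cases hc : ∀ i, (s (i, 0)).1 = (s (i, 1)).1
    · have hne : ∀ i, (s (i, 0)).2 ≠ (s (i, 1)).2 := by
        intro i hi
        have := s.injective (Prod.ext (hc i) hi)
        simp at this
      have e4 : ∀ i, (if (s (i, 0)).1 = (s (i, 1)).1 ∧ (s (i, 0)).2 ≠ (s (i, 1)).2 then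
          (if (s (i, 0)).2 = 0 then (1 : ℝ) else -1) else 0) =
          if (s (i, 0)).2 = 0 then (1 : ℝ) else -1 := fun i => if_pos ⟨hc i, hne i⟩
      simp only [e4]
      rw [sign_mul_prod_eq_one s hc]
      exact zero_le_one
    · push Not at hc
      obtain ⟨i, hi⟩ := hc
      rw [Finset.prod_eq_zero (Finset.mem_univ i) (if_neg fun h => hi h.1), mul_zero]
  have h3 := (Finset.sum_eq_zero_iff_of_nonneg hnn).1 h2 1 (Finset.mem_univ _)
  have h4 : T 1 = 1 := by
    simp [hT, ← pairEquiv_zero, ← pairEquiv_one, hu]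
  rw [h4] at h3
  exact one_ne_zero h3

/-- Unitary frames for a form that is positive with respect to a complex structure. -/
theorem exists_unitary [FiniteDimensional ℝ V] (B : V →ₗ[ℝ] V →ₗ[ℝ] ℝ) (J : V →ₗ[ℝ] V)
    (hdim : Module.finrank ℝ V = 2 * n) (hself : ∀ v, B v v = 0) (hJ : ∀ v, J (J v) = -v)
    (hBJ : ∀ v w, B (J v) (J w) = B v w) (hpos : ∀ v, v ≠ 0 → 0 < B v (J v)) (k : ℕ) (hk : k ≤ n) :
    ∃ e : Fin k → V, (∀ i j, B (e i) (e j) = 0) ∧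
      ∀ i j, B (e i) (J (e j)) = if i = j then 1 else 0 := by
  have hswap : ∀ v w, B v w = -B w v := by
    intro v w
    have := hself (v + w)
    simp only [map_add, LinearMap.add_apply, hself] at this
    linarith
  have hsymm : ∀ v w, B v (J w) = B w (J v) := by
    intro v w
    rw [← hBJ v (J w), hJ, map_neg, hswap, neg_neg]
  induction k with
  | zero => exact ⟨Fin.elim0, fun i => i.elim0, fun i => i.elim0⟩
  | succ k ih =>
    obtain ⟨e, he1, he2⟩ := ih (by omega)
    -- Orthogonality to the `e_i` and the `J e_i` amounts to `2k < 2n` linear conditions, so some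
    -- nonzero vector satisfies them; normalised, it extends the frame.
    let L : V →ₗ[ℝ] (Fin k → ℝ) × (Fin k → ℝ) :=
      (LinearMap.pi fun i => B (e i)).prod (LinearMap.pi fun i => B (J (e i)))
    have hlt : Module.finrank ℝ ((Fin k → ℝ) × (Fin k → ℝ)) < Module.finrank ℝ V := by
      rw [hdim, Module.finrank_prod, Module.finrank_fin_fun]
      omega
    obtain ⟨w, hw, hw0⟩ := (Submodule.ne_bot_iff _).1 (LinearMap.ker_ne_bot_of_finrank_lt (f := L) hlt)
    have hw1 : ∀ i, B (e i) w = 0 := fun i => congrFun (Prod.ext_iff.1 hw).1 i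
    have hw2 : ∀ i, B (e i) (J w) = 0 := by
      intro i
      have : B (J (e i)) w = 0 := congrFun (Prod.ext_iff.1 hw).2 i
      rw [hsymm, hswap, this, neg_zero]
    set c := B w (J w) with hc
    have hcpos : 0 < c := hpos w hw0
    set w' := (Real.sqrt c)⁻¹ • w with hw'
    have hcc : B w' (J w') = 1 := by
      have : Real.sqrt c ≠ 0 := (Real.sqrt_pos.2 hcpos).ne'
      simp only [hw', map_smul, LinearMap.smul_apply, smul_eq_mul]
      rw [← hc, ← mul_assoc, ← mul_inv, Real.mul_self_sqrt hcpos.le, inv_mul_cancel₀ hcpos.ne']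
    refine ⟨Fin.snoc e w', fun i j => ?_, fun i j => ?_⟩
    · refine Fin.lastCases ?_ (fun i => ?_) i <;> refine Fin.lastCases ?_ (fun j => ?_) j
      · simp [hself]
      · rw [hswap]; simp [hw', hw1]
      · simp [hw', hw1]
      · simp [he1]
    · refine Fin.lastCases ?_ (fun i => ?_) i <;> refine Fin.lastCases ?_ (fun j => ?_) j
      · simp [hcc]
      · rw [hsymm]
        simp [hw', hw2, (Fin.castSucc_lt_last j).ne']
      · simp [hw', hw2, (Fin.castSucc_lt_last i).ne]
      · simp [he2]

theorem formPow_ne_zero [FiniteDimensional ℝ V] (B : V →ₗ[ℝ] V →ₗ[ℝ] ℝ) (J : V →ₗ[ℝ] V)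
    (hdim : Module.finrank ℝ V = 2 * n) (hself : ∀ v, B v v = 0) (hJ : ∀ v, J (J v) = -v)
    (hBJ : ∀ v w, B (J v) (J w) = B v w) (hpos : ∀ v, v ≠ 0 → 0 < B v (J v)) :
    formPow n B ≠ 0 := by
  obtain ⟨e, he1, he2⟩ := exists_unitary B J hdim hself hJ hBJ hpos n le_rfl
  have hswap : ∀ v w, B v w = -B w v := by
    intro v w
    have := hself (v + w)
    simp only [map_add, LinearMap.add_apply, hself] at this
    linarith
  refine formPow_ne_zero_of_standard B (fun p => if p.2 = 0 then e p.1 else J (e p.1)) ?_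
  rintro ⟨i, a⟩ ⟨j, b⟩
  fin_cases a <;> fin_cases b
  · simp [he1]
  · simp [he2]
  · simp only [Fin.mk_one, Fin.zero_eta, one_ne_zero, if_false, if_true]
    rw [hswap, he2]
    by_cases hij : i = j
    · simp [hij]
    · simp [hij, Ne.symm hij]
  · simp [hBJ, he1]

/-- The two arguments differ by the transposition of `i` and `j`. This cancels the two bracket terms
that remain when `L_X ω^n` is evaluated on a family with a repeated vector. -/
theorem AlternatingMap.update_add_update_eq_zero {ι : Type*} [DecidableEq ι]
    (A : V [⋀^ι]→ₗ[ℝ] ℝ) (v : ι → V) {i j : ι} (hij : i ≠ j) (hv : v i = v j) (b : V) :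
    A (Function.update v i b) + A (Function.update v j b) = 0 := by
  have e : Function.update v j b = Function.update v i b ∘ Equiv.swap i j := by
    funext k
    rcases eq_or_ne k i with rfl | hki
    · simp [Function.update_of_ne hij, Function.update_of_ne hij.symm, hv]
    · rcases eq_or_ne k j with rfl | hkj
      · simp
      · simp [Equiv.swap_apply_of_ne_of_ne hki hkj, hki, hkj]
  rw [e, A.map_swap _ hij, add_neg_cancel]

/-- Top degree forms are multiples of one determinant, so the quotient of two of them does not
depend on the frame. -/
theorem AlternatingMap.mul_eq_mul {ι : Type*} [Fintype ι] [DecidableEq ι] (b : Module.Basis ι ℝ V)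
    (A D : V [⋀^ι]→ₗ[ℝ] ℝ) (v w : ι → V) : A v * D w = A w * D v := by
  rw [A.eq_smul_basis_det b, D.eq_smul_basis_det b]
  simp only [AlternatingMap.smul_apply, smul_eq_mul]
  ring

end Linear

/-! ## The divergence -/

section Divergence

variable {n : ℕ} {M : Type*} [TopologicalSpace M]
  [ChartedSpace (EuclideanSpace ℝ (Fin (2 * n))) M] [IsManifold (𝓡 (2 * n)) ∞ M]

/-- A vector field is differentiable at a point. -/
abbrev DiffFieldAt (V : ∀ x : M, TangentSpace (𝓡 (2 * n)) x) (x : M) : Prop :=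
  MDifferentiableAt (𝓡 (2 * n)) (𝓡 (2 * n)).tangent
    (fun x => (⟨x, V x⟩ : TangentBundle (𝓡 (2 * n)) M)) x

omit [IsManifold (𝓡 (2 * n)) ∞ M] in
theorem mdifferentiableAt_finset_sum {ι : Type*} {s : Finset ι} {f : ι → M → ℝ} {x : M}
    (hf : ∀ i ∈ s, MDifferentiableAt (𝓡 (2 * n)) 𝓘(ℝ, ℝ) (f i) x) :
    MDifferentiableAt (𝓡 (2 * n)) 𝓘(ℝ, ℝ) (fun y => ∑ i ∈ s, f i y) x := by
  classical
  induction s using Finset.induction_on with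
  | empty => simpa using mdifferentiableAt_const
  | insert i s hi ih =>
    simp only [Finset.sum_insert hi]
    exact (hf i (by simp)).add (ih fun j hj => hf j (by simp [hj]))

omit [IsManifold (𝓡 (2 * n)) ∞ M] in
theorem mdifferentiableAt_finset_prod {ι : Type*} {s : Finset ι} {f : ι → M → ℝ} {x : M}
    (hf : ∀ i ∈ s, MDifferentiableAt (𝓡 (2 * n)) 𝓘(ℝ, ℝ) (f i) x) :
    MDifferentiableAt (𝓡 (2 * n)) 𝓘(ℝ, ℝ) (fun y => ∏ i ∈ s, f i y) x := by
  classical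
  induction s using Finset.induction_on with
  | empty => simpa using mdifferentiableAt_const
  | insert i s hi ih =>
    simp only [Finset.prod_insert hi]
    exact (hf i (by simp)).mul (ih fun j hj => hf j (by simp [hj]))

namespace KahlerStructure

variable (K : KahlerStructure n M)

/-- The symplectic form at `x` as a bilinear map. -/
def bilin (x : M) : TangentSpace (𝓡 (2 * n)) x →ₗ[ℝ] TangentSpace (𝓡 (2 * n)) x →ₗ[ℝ] ℝ :=
  LinearMap.mk₂ ℝ (fun v w => K.form x v w)
    (fun v v' w => congrArg (fun L => L w) (map_add (K.form x) v v'))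
    (fun c v w => congrArg (fun L => L w) (map_smul (K.form x) c v))
    (fun v w w' => map_add (K.form x v) w w') (fun c v w => map_smul (K.form x v) c w)

/-- The form `ω ^ n` at `x` as an alternating map. -/
def omegaAlt (x : M) : TangentSpace (𝓡 (2 * n)) x [⋀^Fin (2 * n)]→ₗ[ℝ] ℝ := formPow n (K.bilin x)

theorem omegaPow_eq (x : M) (v : Fin (2 * n) → TangentSpace (𝓡 (2 * n)) x) :
    K.omegaPow x v = K.omegaAlt x v := by
  rw [omegaAlt, formPow_apply]
  rfl

theorem omegaAlt_ne_zero (x : M) : K.omegaAlt x ≠ 0 := by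
  have : FiniteDimensional ℝ (TangentSpace (𝓡 (2 * n)) x) :=
    inferInstanceAs (FiniteDimensional ℝ (EuclideanSpace ℝ (Fin (2 * n))))
  refine formPow_ne_zero (K.bilin x) (K.J x).toLinearMap ?_ (K.form_self x) (K.J_sq x) (K.form_J x)
    (K.pos x)
  exact (finrank_euclideanSpace (𝕜 := ℝ) (ι := Fin (2 * n))).trans (Fintype.card_fin _)

theorem omegaAlt_basis_ne_zero (x : M)
    (b : Module.Basis (Fin (2 * n)) ℝ (TangentSpace (𝓡 (2 * n)) x)) : K.omegaAlt x b ≠ 0 := by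
  rw [AlternatingMap.map_basis_ne_zero_iff]
  exact K.omegaAlt_ne_zero x

theorem mdifferentiableAt_form {V W : ∀ x : M, TangentSpace (𝓡 (2 * n)) x} {x : M}
    (hV : DiffFieldAt V x) (hW : DiffFieldAt W x) :
    MDifferentiableAt (𝓡 (2 * n)) 𝓘(ℝ, ℝ) (fun y => K.form y (V y) (W y)) x := by
  have h := MDifferentiableAt.clm_bundle_apply₂ (F₁ := EuclideanSpace ℝ (Fin (2 * n)))
    (F₂ := EuclideanSpace ℝ (Fin (2 * n))) (F₃ := ℝ) (E₃ := Bundle.Trivial M ℝ)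
    (E₁ := fun x : M => TangentSpace (𝓡 (2 * n)) x) (E₂ := fun x : M => TangentSpace (𝓡 (2 * n)) x)
    (b := fun y : M => y) (ψ := K.form) ((K.smooth_form x).mdifferentiableAt (by simp)) hV hW
  simpa using ((mdifferentiableAt_totalSpace ..).1 h).2

theorem mdifferentiableAt_omegaAlt {Y : Fin (2 * n) → ∀ x : M, TangentSpace (𝓡 (2 * n)) x} {x : M}
    (hY : ∀ i, DiffFieldAt (Y i) x) :
    MDifferentiableAt (𝓡 (2 * n)) 𝓘(ℝ, ℝ) (fun y => K.omegaAlt y fun i => Y i y) x := by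
  simp only [← omegaPow_eq, omegaPow]
  refine mdifferentiableAt_const.mul (mdifferentiableAt_finset_sum fun σ _ =>
    mdifferentiableAt_const.mul (mdifferentiableAt_finset_prod fun i _ =>
      K.mdifferentiableAt_form (hY _) (hY _)))

theorem contMDiffAt_omegaAlt {Y : Fin (2 * n) → ∀ x : M, TangentSpace (𝓡 (2 * n)) x} {x : M}
    (hY : ∀ i, SmoothFieldAt (Y i) x) :
    ContMDiffAt (𝓡 (2 * n)) 𝓘(ℝ, ℝ) ∞ (fun y => K.omegaAlt y fun i => Y i y) x := by
  simp only [← omegaPow_eq, omegaPow]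
  refine contMDiffAt_const.mul (contMDiffAt_finsetSum fun σ _ => contMDiffAt_const.mul
    (contMDiffAt_finsetProd fun i _ => K.contMDiffAt_form (hY _) (hY _)))

theorem lieDerivOmegaPow_update (X : ∀ x : M, TangentSpace (𝓡 (2 * n)) x)
    (Y : Fin (2 * n) → ∀ x : M, TangentSpace (𝓡 (2 * n)) x) (i : Fin (2 * n))
    (τ : ∀ x : M, TangentSpace (𝓡 (2 * n)) x) (x : M) :
    K.lieDerivOmegaPow X (Function.update Y i τ) x =
      dirDeriv X (fun y => K.omegaAlt y (Function.update (fun j => Y j y) i (τ y))) x -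
      (K.omegaAlt x (Function.update (fun j => Y j x) i (VectorField.mlieBracket (𝓡 (2 * n)) X τ x))
        + ∑ k ∈ Finset.univ.erase i, K.omegaAlt x (Function.update (Function.update
          (fun j => Y j x) k (VectorField.mlieBracket (𝓡 (2 * n)) X (Y k) x)) i (τ x))) := by
  have e : ∀ y, (fun j => Function.update Y i τ j y) = Function.update (fun j => Y j y) i (τ y) := by
    intro y
    funext j
    rcases eq_or_ne j i with rfl | h
    · simp
    · simp [h]
  simp only [lieDerivOmegaPow, omegaPow_eq, e]
  rw [← Finset.add_sum_erase _ _ (Finset.mem_univ i)]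
  congr 2
  · simp
  · refine Finset.sum_congr rfl fun k hk => ?_
    have hki := Finset.ne_of_mem_erase hk
    rw [Function.update_of_ne hki, Function.update_comm hki]

/-- When a slot is multiplied by a function `f`, the term with `X f` from the derivative of `ω^n(Y)`
cancels the one from `[X, fτ]`. Hence only the values of the fields at `x` matter. -/
theorem tensorialAt_lieDerivOmegaPow (X : ∀ x : M, TangentSpace (𝓡 (2 * n)) x)
    {Y : Fin (2 * n) → ∀ x : M, TangentSpace (𝓡 (2 * n)) x} {x : M}
    (hY : ∀ i, DiffFieldAt (Y i) x) (i : Fin (2 * n)) :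
    TensorialAt (𝓡 (2 * n)) (EuclideanSpace ℝ (Fin (2 * n)))
      (fun τ => K.lieDerivOmegaPow X (Function.update Y i τ) x) x := by
  have hup : ∀ τ : ∀ x : M, TangentSpace (𝓡 (2 * n)) x, DiffFieldAt τ x →
      MDifferentiableAt (𝓡 (2 * n)) 𝓘(ℝ, ℝ)
        (fun y => K.omegaAlt y (Function.update (fun j => Y j y) i (τ y))) x := by
    intro τ hτ
    convert! K.mdifferentiableAt_omegaAlt (Y := Function.update Y i τ) (x := x) ?_ with y j
    · rcases eq_or_ne j i with rfl | h
      · simp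
      · simp [h]
    · intro j
      rcases eq_or_ne j i with rfl | h
      · simpa using hτ
      · simpa [h] using hY j
  constructor
  · intro f τ hf hτ
    simp only [lieDerivOmegaPow_update, Pi.smul_apply', AlternatingMap.map_update_smul, smul_eq_mul,
      VectorField.mlieBracket_smul_right hf hτ, AlternatingMap.map_update_add]
    rw [dirDeriv_mul hf (hup τ hτ), ← Finset.mul_sum]
    have : mvfderiv (𝓡 (2 * n)) f x (X x) = dirDeriv X f x := rfl
    rw [this]
    ring
  · intro τ τ' hτ hτ'
    simp only [lieDerivOmegaPow_update, Pi.add_apply,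
      VectorField.mlieBracket_add_right hτ hτ', AlternatingMap.map_update_add]
    rw [dirDeriv_add (hup τ hτ) (hup τ' hτ'), Finset.sum_add_distrib]
    ring

theorem lieDerivOmegaPow_congr (X : ∀ x : M, TangentSpace (𝓡 (2 * n)) x)
    {Y Z : Fin (2 * n) → ∀ x : M, TangentSpace (𝓡 (2 * n)) x} {x : M}
    (hY : ∀ i, DiffFieldAt (Y i) x) (hZ : ∀ i, DiffFieldAt (Z i) x) (h : ∀ i, Y i x = Z i x) :
    K.lieDerivOmegaPow X Y x = K.lieDerivOmegaPow X Z x := by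
  classical
  -- The fields are exchanged one slot at a time, since tensoriality is known in each slot
  -- separately.
  have key : ∀ s : Finset (Fin (2 * n)),
      K.lieDerivOmegaPow X (s.piecewise Y Z) x = K.lieDerivOmegaPow X Z x := by
    intro s
    have hp : ∀ s : Finset (Fin (2 * n)), ∀ i, DiffFieldAt (s.piecewise Y Z i) x := by
      intro s i
      by_cases hi : i ∈ s
      · simpa [hi] using hY i
      · simpa [hi] using hZ i
    induction s using Finset.induction_on with
    | empty => simp
    | insert i s hi ih =>
      rw [Finset.piecewise_insert, ← ih]
      have := (K.tensorialAt_lieDerivOmegaPow X (hp s) i).pointwise (hY i) (hZ i) (h i)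
      rw [this]
      congr 1
      rw [Function.update_eq_self_iff]
      simp [hi]
  simpa using key Finset.univ

/-- The form `L_X ω ^ n` at `x`. -/
def lieDerivAlt (X : ∀ x : M, TangentSpace (𝓡 (2 * n)) x) (x : M) :
    TangentSpace (𝓡 (2 * n)) x [⋀^Fin (2 * n)]→ₗ[ℝ] ℝ where
  toFun v := K.lieDerivOmegaPow X
    (fun i => FiberBundle.extend (EuclideanSpace ℝ (Fin (2 * n))) (v i)) x
  map_update_add' {inst} v i a b := by
    obtain rfl : inst = instDecidableEqFin _ := Subsingleton.elim _ _
    have hd : ∀ v : TangentSpace (𝓡 (2 * n)) x,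
      DiffFieldAt (FiberBundle.extend (EuclideanSpace ℝ (Fin (2 * n))) v) x :=
      fun v => FiberBundle.mdifferentiableAt_extend ..
    have e : ∀ c : TangentSpace (𝓡 (2 * n)) x, (fun j => FiberBundle.extend
        (EuclideanSpace ℝ (Fin (2 * n))) (Function.update v i c j)) = Function.update
        (fun j => FiberBundle.extend (EuclideanSpace ℝ (Fin (2 * n))) (v j)) i
        (FiberBundle.extend (EuclideanSpace ℝ (Fin (2 * n))) c) := by
      intro c
      funext j
      rcases eq_or_ne j i with rfl | h
      · simp
      · simp [h]
    have hT := K.tensorialAt_lieDerivOmegaPow X (fun j => hd (v j)) i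
    simp only [e]
    rw [← hT.add (hd a) (hd b)]
    exact hT.pointwise (hd _) (mdifferentiableAt_add_section (hd a) (hd b)) (by simp)
  map_update_smul' {inst} v i c a := by
    obtain rfl : inst = instDecidableEqFin _ := Subsingleton.elim _ _
    have hd : ∀ v : TangentSpace (𝓡 (2 * n)) x,
      DiffFieldAt (FiberBundle.extend (EuclideanSpace ℝ (Fin (2 * n))) v) x :=
      fun v => FiberBundle.mdifferentiableAt_extend ..
    have e : ∀ c : TangentSpace (𝓡 (2 * n)) x, (fun j => FiberBundle.extend
        (EuclideanSpace ℝ (Fin (2 * n))) (Function.update v i c j)) = Function.update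
        (fun j => FiberBundle.extend (EuclideanSpace ℝ (Fin (2 * n))) (v j)) i
        (FiberBundle.extend (EuclideanSpace ℝ (Fin (2 * n))) c) := by
      intro c
      funext j
      rcases eq_or_ne j i with rfl | h
      · simp
      · simp [h]
    have hT := K.tensorialAt_lieDerivOmegaPow X (fun j => hd (v j)) i
    simp only [e]
    rw [← hT.smul (f := fun _ => c) mdifferentiableAt_const (hd a)]
    exact hT.pointwise (hd _) (mdifferentiableAt_const.smul_section (hd a)) (by simp)
  map_eq_zero_of_eq' v i j hv hij := by
    -- Equal vectors have equal extensions, so the differentiated function is identically zero.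
    -- Brackets in slots other than `i`, `j` leave a repeated entry, and those in `i` and `j`
    -- cancel.
    have h0 : ∀ y, K.omegaAlt y (fun k => FiberBundle.extend (EuclideanSpace ℝ (Fin (2 * n)))
        (v k) y) = 0 := fun y => (K.omegaAlt y).map_eq_zero_of_eq _ (by simp only [hv]) hij
    simp only [lieDerivOmegaPow, omegaPow_eq, h0]
    rw [dirDeriv_const, zero_sub, neg_eq_zero,
      ← Finset.add_sum_erase _ _ (Finset.mem_univ i),
      ← Finset.add_sum_erase _ _ (Finset.mem_erase.2 ⟨hij.symm, Finset.mem_univ j⟩),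
      Finset.sum_eq_zero, add_zero, hv, AlternatingMap.update_add_update_eq_zero _ _ hij]
    · simp only [hv]
    · intro k hk
      simp only [Finset.mem_erase] at hk
      refine (K.omegaAlt x).map_eq_zero_of_eq _ ?_ hij
      rw [Function.update_of_ne (Ne.symm hk.2.1), Function.update_of_ne (Ne.symm hk.1)]
      simp only [hv]

theorem lieDerivOmegaPow_eq (X : ∀ x : M, TangentSpace (𝓡 (2 * n)) x)
    {Y : Fin (2 * n) → ∀ x : M, TangentSpace (𝓡 (2 * n)) x} {x : M}
    (hY : ∀ i, DiffFieldAt (Y i) x) :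
    K.lieDerivOmegaPow X Y x = K.lieDerivAlt X x fun i => Y i x :=
  K.lieDerivOmegaPow_congr X hY (fun _ => FiberBundle.mdifferentiableAt_extend ..) (by simp)

theorem smoothFieldAt_coordFrame {x y : M}
    (hy : y ∈ (trivializationAt (EuclideanSpace ℝ (Fin (2 * n)))
      (TangentSpace (𝓡 (2 * n)) : M → Type _) x).baseSet) (i : Fin (2 * n)) :
    SmoothFieldAt (coordFrame x i) y :=
  contMDiffAt_localFrame_of_mem ∞ _ _ i hy

theorem omegaAlt_coordFrame_ne_zero {x y : M}
    (hy : y ∈ (trivializationAt (EuclideanSpace ℝ (Fin (2 * n)))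
      (TangentSpace (𝓡 (2 * n)) : M → Type _) x).baseSet) :
    K.omegaAlt y (fun i => coordFrame x i y) ≠ 0 := by
  have := K.omegaAlt_basis_ne_zero y ((trivializationAt (EuclideanSpace ℝ (Fin (2 * n)))
      (TangentSpace (𝓡 (2 * n)) : M → Type _) x).basisAt
      (EuclideanSpace.basisFun (Fin (2 * n)) ℝ).toBasis hy)
  convert this using 2
  funext i
  exact Bundle.Trivialization.localFrame_apply_of_mem_baseSet _ _ hy

/-- The divergence can be computed on the coordinate frame of any chart. -/
theorem divergence_eq (X : ∀ x : M, TangentSpace (𝓡 (2 * n)) x) {x y : M}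
    (hy : y ∈ (trivializationAt (EuclideanSpace ℝ (Fin (2 * n)))
      (TangentSpace (𝓡 (2 * n)) : M → Type _) x).baseSet) :
    K.divergence X y =
      K.lieDerivOmegaPow X (coordFrame x) y / K.omegaAlt y fun i => coordFrame x i y := by
  have hyy := FiberBundle.mem_baseSet_trivializationAt (EuclideanSpace ℝ (Fin (2 * n)))
      (TangentSpace (𝓡 (2 * n)) : M → Type _) y
  rw [divergence, omegaPow_eq, div_eq_div_iff (K.omegaAlt_coordFrame_ne_zero hyy)
    (K.omegaAlt_coordFrame_ne_zero hy),
    K.lieDerivOmegaPow_eq X fun i => (smoothFieldAt_coordFrame hyy i).mdifferentiableAt,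
    K.lieDerivOmegaPow_eq X fun i => (smoothFieldAt_coordFrame hy i).mdifferentiableAt]
  exact AlternatingMap.mul_eq_mul ((trivializationAt (EuclideanSpace ℝ (Fin (2 * n)))
      (TangentSpace (𝓡 (2 * n)) : M → Type _) x).basisAt
      (EuclideanSpace.basisFun (Fin (2 * n)) ℝ).toBasis hy) _ _ _ _

theorem contMDiffAt_lieDerivOmegaPow {X : ∀ x : M, TangentSpace (𝓡 (2 * n)) x}
    {Y : Fin (2 * n) → ∀ x : M, TangentSpace (𝓡 (2 * n)) x} {x : M} (hX : SmoothFieldAt X x)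
    (hY : ∀ i, SmoothFieldAt (Y i) x) :
    ContMDiffAt (𝓡 (2 * n)) 𝓘(ℝ, ℝ) ∞ (K.lieDerivOmegaPow X Y) x := by
  unfold lieDerivOmegaPow
  simp only [omegaPow_eq]
  refine (contMDiffAt_dirDeriv hX (K.contMDiffAt_omegaAlt hY)).sub
    (contMDiffAt_finsetSum fun i _ => ?_)
  have e : ∀ y, Function.update (fun j => Y j y) i (VectorField.mlieBracket (𝓡 (2 * n)) X (Y i) y) =
      fun j => Function.update Y i (VectorField.mlieBracket (𝓡 (2 * n)) X (Y i)) j y := by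
    intro y
    funext j
    rcases eq_or_ne j i with rfl | h
    · simp
    · simp [h]
  simp only [e]
  refine K.contMDiffAt_omegaAlt fun j => ?_
  rcases eq_or_ne j i with rfl | h
  · simp only [Function.update_self]
    have : IsManifold (𝓡 (2 * n)) (minSmoothness ℝ 2) M := by
      rw [minSmoothness_of_isRCLikeNormedField]
      infer_instance
    have : IsManifold (𝓡 (2 * n)) (((⊤ : ℕ∞) : WithTop ℕ∞) + 1) M :=
      inferInstanceAs (IsManifold (𝓡 (2 * n)) ∞ M)
    exact ContMDiffAt.mlieBracket_vectorField (m := ⊤) (n := ⊤) hX (hY j) (by simp)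
  · simpa [h] using hY j

/-- By definition the frame changes with the point, which hides smoothness. Near `x`,
`divergence_eq` allows the frame at `x` to be used throughout, and the divergence becomes a quotient
of smooth functions. -/
theorem contMDiff_divergence {X : ∀ x : M, TangentSpace (𝓡 (2 * n)) x} (hX : SmoothField X) :
    ContMDiff (𝓡 (2 * n)) 𝓘(ℝ, ℝ) ∞ (K.divergence X) := by
  intro x
  have hx := FiberBundle.mem_baseSet_trivializationAt (EuclideanSpace ℝ (Fin (2 * n)))
      (TangentSpace (𝓡 (2 * n)) : M → Type _) x
  have h1 := K.contMDiffAt_lieDerivOmegaPow (hX x) fun i => smoothFieldAt_coordFrame hx i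
  have h2 := K.contMDiffAt_omegaAlt fun i => smoothFieldAt_coordFrame hx i
  refine (h1.div₀ h2 (K.omegaAlt_coordFrame_ne_zero hx)).congr_of_eventuallyEq ?_
  filter_upwards [(Bundle.Trivialization.open_baseSet _).mem_nhds hx] with y hy
  exact K.divergence_eq X hy

theorem divergence_add {X X' : ∀ x : M, TangentSpace (𝓡 (2 * n)) x} (hX : SmoothField X)
    (hX' : SmoothField X') (x : M) :
    K.divergence (X + X') x = K.divergence X x + K.divergence X' x := by
  simp only [divergence, lieDerivOmegaPow, omegaPow_eq]
  simp only [VectorField.mlieBracket_add_left (SmoothFieldAt.mdifferentiableAt (hX x))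
    (SmoothFieldAt.mdifferentiableAt (hX' x)), AlternatingMap.map_update_add, dirDeriv_add_field,
    Finset.sum_add_distrib]
  ring

theorem divergence_smul (c : ℝ) {X : ∀ x : M, TangentSpace (𝓡 (2 * n)) x} (hX : SmoothField X)
    (x : M) : K.divergence (c • X) x = c * K.divergence X x := by
  simp only [divergence, lieDerivOmegaPow, omegaPow_eq]
  simp only [VectorField.mlieBracket_const_smul_left (SmoothFieldAt.mdifferentiableAt (hX x)),
    AlternatingMap.map_update_smul, dirDeriv_smul_field, smul_eq_mul, ← Finset.mul_sum]
  ring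

end KahlerStructure

end Divergence

/-! ### The Laplacian of the components of the moment map. -/

section LapMoment

variable {n d : ℕ} {M : Type*} [TopologicalSpace M]
  [ChartedSpace (EuclideanSpace ℝ (Fin (2 * n))) M] [IsManifold (𝓡 (2 * n)) ∞ M]
  {G : Type*} [Group G] [TopologicalSpace G] [ChartedSpace (EuclideanSpace ℝ (Fin d)) G]
  [IsManifold (𝓡 d) ∞ G] [MulAction G M] [ContMDiffSMul (𝓡 d) (𝓡 (2 * n)) ∞ G M]
  {K : KahlerStructure n M} {Φ : M → Module.Dual ℝ (GroupLieAlgebra (𝓡 d) G)}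

omit [IsManifold (𝓡 d) ∞ G] [ContMDiffSMul (𝓡 d) (𝓡 (2 * n)) ∞ G M] in
theorem IsHamiltonian.lapMoment_eq (hΦ : IsHamiltonian K Φ) (ξ : GroupLieAlgebra (𝓡 d) G) :
    lapMoment K Φ ξ = K.divergence (imagField K ξ) := by
  funext x
  rw [lapMoment, KahlerStructure.laplacian, hΦ.grad_eq]

theorem IsHamiltonian.contMDiff_lapMoment (hΦ : IsHamiltonian K Φ) (ξ : GroupLieAlgebra (𝓡 d) G) :
    ContMDiff (𝓡 (2 * n)) 𝓘(ℝ, ℝ) ∞ (lapMoment K Φ ξ) := by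
  rw [hΦ.lapMoment_eq]
  exact K.contMDiff_divergence (smoothField_imagField K ξ)

theorem IsHamiltonian.lapMoment_add (hΦ : IsHamiltonian K Φ) (ξ η : GroupLieAlgebra (𝓡 d) G)
    (x : M) : lapMoment K Φ (ξ + η) x = lapMoment K Φ ξ x + lapMoment K Φ η x := by
  simp only [hΦ.lapMoment_eq, imagField_add]
  exact K.divergence_add (smoothField_imagField K ξ) (smoothField_imagField K η) x

theorem IsHamiltonian.lapMoment_smul (hΦ : IsHamiltonian K Φ) (c : ℝ)
    (ξ : GroupLieAlgebra (𝓡 d) G) (x : M) : lapMoment K Φ (c • ξ) x = c * lapMoment K Φ ξ x := by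
  simp only [hΦ.lapMoment_eq, imagField_smul]
  exact K.divergence_smul c (smoothField_imagField K ξ) x

theorem IsHamiltonian.lapMoment_sum (hΦ : IsHamiltonian K Φ) {ι : Type*} (s : Finset ι) (c : ι → ℝ)
    (ξ : ι → GroupLieAlgebra (𝓡 d) G) (x : M) :
    lapMoment K Φ (∑ i ∈ s, c i • ξ i) x = ∑ i ∈ s, c i * lapMoment K Φ (ξ i) x := by
  have h : ∀ y z, lapMoment K Φ (y + z) x = lapMoment K Φ y x + lapMoment K Φ z x :=
    fun y z => hΦ.lapMoment_add y z x
  exact (map_sum (AddMonoidHom.mk' (fun y => lapMoment K Φ y x) h) _ s).trans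
    (Finset.sum_congr rfl fun i _ => hΦ.lapMoment_smul _ _ _)

end LapMoment

/-! ## Integral curves -/

section Flow

open Set

variable {E : Type*} [NormedAddCommGroup E] [NormedSpace ℝ E] [CompleteSpace E]
  {H : Type*} [TopologicalSpace H] {I : ModelWithCorners ℝ E H}
  {M : Type*} [TopologicalSpace M] [ChartedSpace H M] [IsManifold I 1 M]
  {v : (x : M) → TangentSpace I x}

omit [CompleteSpace E] [IsManifold I 1 M] in
theorem hasMFDerivAt_of_hasDerivAt {γ : ℝ → M} {s : ℝ} (hγ : ContinuousAt γ s)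
    {w : TangentSpace I (γ s)} (h : HasDerivAt (extChartAt I (γ s) ∘ γ) (w : E) s) :
    HasMFDerivAt 𝓘(ℝ, ℝ) I γ s ((1 : ℝ →L[ℝ] ℝ).smulRight w) := by
  have h' : HasFDerivAt (extChartAt I (γ s) ∘ γ) ((1 : ℝ →L[ℝ] ℝ).smulRight (w : E)) s :=
    h.hasFDerivAt.congr_fderiv (by ext; rfl)
  refine ⟨hγ, ?_⟩
  exact h'.hasFDerivWithinAt

/-- Local existence of integral curves, on a time interval that is uniform in the starting point. -/
theorem exists_isMIntegralCurveOn_nhds {x₀ : M}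
    (hv : ContMDiffAt I I.tangent 1 (fun x ↦ (⟨x, v x⟩ : TangentBundle I M)) x₀)
    (hx : I.IsInteriorPoint x₀) :
    ∃ ε > 0, ∃ U ∈ 𝓝 x₀, ∀ x ∈ U, ∃ γ : ℝ → M, γ 0 = x ∧
      IsMIntegralCurveOn γ v (Ioo (-ε) ε) := by
  rw [contMDiffAt_iff] at hv
  obtain ⟨_, hv⟩ := hv
  obtain ⟨ε, hε, a, r, L, C, hr, hpl⟩ := IsPicardLindelof.of_contDiffAt_one
    (hv.contDiffAt (range_mem_nhds_isInteriorPoint hx)).snd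
  obtain ⟨α, hα, hcont⟩ :=
    (hpl 0).exists_forall_mem_closedBall_eq_hasDerivWithinAt_continuousOn
  simp only [zero_sub, zero_add] at hα hcont
  set p := extChartAt I x₀ x₀ with hp
  have hnhds : Metric.closedBall p r ×ˢ Icc (-ε) ε ∈ 𝓝 (p, (0 : ℝ)) :=
    prod_mem_nhds (Metric.closedBall_mem_nhds _ hr) (Icc_mem_nhds (by linarith) hε)
  have hca : ContinuousAt α (p, 0) := hcont.continuousAt hnhds
  have hα0 : α (p, 0) = p := (hα p (Metric.mem_closedBall_self hr.le)).1
  -- Joint continuity of the local flow keeps the solutions inside the chart for a time that serves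
  -- all nearby starting points.
  have hpre : α ⁻¹' (interior (extChartAt I x₀).target) ∈ 𝓝 (p, (0 : ℝ)) :=
    hca.preimage_mem_nhds (by
      rw [hα0]; exact isOpen_interior.mem_nhds ((I.isInteriorPoint_iff).mp hx))
  obtain ⟨W, hW, T, hT, hWT⟩ := mem_nhds_prod_iff.1 (Filter.inter_mem hnhds hpre)
  obtain ⟨δ, hδ, hδT⟩ := Metric.mem_nhds_iff.1 hT
  refine ⟨min δ ε, lt_min hδ hε, (extChartAt I x₀) ⁻¹' W ∩ (extChartAt I x₀).source,
    Filter.inter_mem ((continuousAt_extChartAt x₀).preimage_mem_nhds hW)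
      (extChartAt_source_mem_nhds x₀), ?_⟩
  rintro x ⟨hxW, hxs⟩
  set y := extChartAt I x₀ x with hy
  have hmem : ∀ t ∈ Ioo (-min δ ε) (min δ ε), (y ∈ Metric.closedBall p r ∧ t ∈ Icc (-ε) ε) ∧
      α (y, t) ∈ interior (extChartAt I x₀).target := by
    intro t ht
    refine hWT (mk_mem_prod hxW (hδT ?_))
    rw [Metric.mem_ball, Real.dist_eq, sub_zero, abs_lt]
    exact ⟨by linarith [ht.1, min_le_left δ ε], by linarith [ht.2, min_le_left δ ε]⟩
  have h0 := hmem 0 ⟨by linarith [lt_min hδ hε], lt_min hδ hε⟩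
  obtain ⟨hinit, hder⟩ := hα y h0.1.1
  refine ⟨fun t => (extChartAt I x₀).symm (α (y, t)), ?_, ?_⟩
  · simp only [hinit]
    exact (extChartAt I x₀).left_inv hxs
  intro t ht
  obtain ⟨⟨-, -⟩, hf3⟩ := hmem t ht
  have hIcc : Icc (-ε) ε ∈ 𝓝 t :=
    Icc_mem_nhds (by linarith [ht.1, min_le_right δ ε]) (by linarith [ht.2, min_le_right δ ε])
  set f : ℝ → E := fun t => α (y, t) with hf
  let xₜ : M := (extChartAt I x₀).symm (f t)
  have h : HasDerivAt f (x := t) <| fderivWithin ℝ (extChartAt I x₀ ∘ (extChartAt I xₜ).symm)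
    (range I) (extChartAt I xₜ xₜ) (v xₜ) := (hder t (mem_of_mem_nhds hIcc)).hasDerivAt hIcc
  rw [← tangentCoordChange_def] at h
  have hf3' := mem_of_mem_of_subset hf3 interior_subset
  have hft1 := mem_preimage.mp <|
    mem_of_mem_of_subset hf3' (extChartAt I x₀).target_subset_preimage_source
  have hft2 := mem_extChartAt_source (I := I) xₜ
  apply HasMFDerivAt.hasMFDerivWithinAt
  refine hasMFDerivAt_of_hasDerivAt
    (ContinuousAt.comp (f := f) (continuousAt_extChartAt_symm'' hf3') h.continuousAt) ?_
  change HasDerivAt ((extChartAt I xₜ ∘ (extChartAt I x₀).symm) ∘ f) (v xₜ) t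
  have hv' : tangentCoordChange I x₀ xₜ xₜ (tangentCoordChange I xₜ x₀ xₜ (v xₜ)) = v xₜ :=
    (tangentCoordChange_comp ⟨⟨hft2, hft1⟩, hft2⟩).trans (tangentCoordChange_self hft2)
  refine HasDerivAt.congr_deriv ?_ hv'
  apply HasFDerivAt.comp_hasDerivAt _ _ h
  apply HasFDerivWithinAt.hasFDerivAt (s := range I) _ <|
    mem_nhds_iff.mpr ⟨interior (extChartAt I x₀).target,
      subset_trans interior_subset (extChartAt_target_subset_range ..),
      isOpen_interior, hf3⟩
  rw [← (extChartAt I x₀).right_inv hf3']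
  exact hasFDerivWithinAt_tangentCoordChange ⟨hft1, hft2⟩

/-- Vector fields on compact manifolds without boundary are complete. -/
theorem exists_isMIntegralCurve_of_compactSpace [CompactSpace M] [T2Space M]
    [BoundarylessManifold I M]
    (hv : ContMDiff I I.tangent 1 (fun x ↦ (⟨x, v x⟩ : TangentBundle I M))) (x : M) :
    ∃ γ : ℝ → M, γ 0 = x ∧ IsMIntegralCurve γ v := by
  choose ε hε U hU h using fun x : M =>
    exists_isMIntegralCurveOn_nhds (hv x) BoundarylessManifold.isInteriorPoint
  obtain ⟨s, hs⟩ := finite_cover_nhds hU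
  have hne : s.Nonempty := by
    obtain ⟨i, hi, -⟩ := mem_iUnion₂.1 (hs ▸ mem_univ x)
    exact ⟨i, hi⟩
  -- The least existence time over a finite cover serves every starting point, and a uniform
  -- existence time lets curves be continued forever.
  refine exists_isMIntegralCurve_of_isMIntegralCurveOn hv (ε := s.inf' hne ε)
    ((Finset.lt_inf'_iff hne).2 fun i _ => hε i) (fun y => ?_) x
  obtain ⟨i, hi, hy⟩ := mem_iUnion₂.1 (hs ▸ mem_univ y)
  obtain ⟨γ, h0, hγ⟩ := h i y hy
  have hle : s.inf' hne ε ≤ ε i := Finset.inf'_le _ hi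
  exact ⟨γ, h0, hγ.mono (Ioo_subset_Ioo (by linarith) hle)⟩

end Flow

/-! ### Flows: uniqueness, change of time, continuous dependence on parameters. -/

section

variable {n : ℕ} {M : Type*} [TopologicalSpace M]
  [ChartedSpace (EuclideanSpace ℝ (Fin (2 * n))) M]

/-- The derivative of a function along an integral curve. -/
theorem hasDerivAt_comp_isMIntegralCurve {V : ∀ x : M, TangentSpace (𝓡 (2 * n)) x} {γ : ℝ → M}
    (hγ : IsMIntegralCurve (I := 𝓡 (2 * n)) γ V) {q : M → ℝ}
    (hq : MDifferentiable (𝓡 (2 * n)) 𝓘(ℝ, ℝ) q) (t : ℝ) :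
    HasDerivAt (fun s => q (γ s)) (dirDeriv V q (γ t)) t := by
  have h1 := (hq (γ t)).hasMFDerivAt.comp t (hγ t)
  rw [hasMFDerivAt_iff_hasFDerivAt] at h1
  have h : HasFDerivAt (fun s => q (γ s))
    (((mfderiv (𝓡 (2 * n)) 𝓘(ℝ, ℝ) q (γ t)).comp
      ((1 : ℝ →L[ℝ] ℝ).smulRight (V (γ t))) : ℝ →L[ℝ] ℝ)) t := h1
  convert! h.hasDerivAt using 1
  change mfderiv (𝓡 (2 * n)) 𝓘(ℝ, ℝ) q (γ t) (V (γ t)) =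
    mfderiv (𝓡 (2 * n)) 𝓘(ℝ, ℝ) q (γ t) ((1 : ℝ) • V (γ t))
  rw [one_smul]

variable [IsManifold (𝓡 (2 * n)) ∞ M] [CompactSpace M] [T2Space M]

omit [CompactSpace M] [T2Space M] in
theorem SmoothField.contMDiff_one {V : ∀ x : M, TangentSpace (𝓡 (2 * n)) x} (hV : SmoothField V) :
    ContMDiff (𝓡 (2 * n)) (𝓡 (2 * n)).tangent 1
      (fun x => (⟨x, V x⟩ : TangentBundle (𝓡 (2 * n)) M)) :=
  ContMDiff.of_le hV (by simp)

theorem flow_spec {V : ∀ x : M, TangentSpace (𝓡 (2 * n)) x} (hV : SmoothField V) (x : M) :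
    flow V x 0 = x ∧ IsMIntegralCurve (I := 𝓡 (2 * n)) (flow V x) V := by
  have : IsManifold (𝓡 (2 * n)) 1 M := .of_le (n := ∞) (by simp)
  have h : ∃ γ : ℝ → M, γ 0 = x ∧ IsMIntegralCurve (I := 𝓡 (2 * n)) γ V :=
    exists_isMIntegralCurve_of_compactSpace hV.contMDiff_one x
  rw [flow, dif_pos h]
  exact h.choose_spec

omit [CompactSpace M] in
theorem eq_of_isMIntegralCurve {V : ∀ x : M, TangentSpace (𝓡 (2 * n)) x} (hV : SmoothField V)
    {γ γ' : ℝ → M} (hγ : IsMIntegralCurve (I := 𝓡 (2 * n)) γ V)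
    (hγ' : IsMIntegralCurve (I := 𝓡 (2 * n)) γ' V) (h : γ 0 = γ' 0) : γ = γ' := by
  have : IsManifold (𝓡 (2 * n)) 1 M := .of_le (n := ∞) (by simp)
  exact isMIntegralCurve_Ioo_eq_of_contMDiff_boundaryless (t₀ := 0) hV.contMDiff_one hγ hγ' h

theorem flow_smul_field {V : ∀ x : M, TangentSpace (𝓡 (2 * n)) x} (hV : SmoothField V) {c : ℝ}
    (hcV : SmoothField (c • V)) (x : M) (t : ℝ) : flow (c • V) x t = flow V x (c * t) := by
  have h1 := flow_spec hV x
  have h2 := flow_spec hcV x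
  have := eq_of_isMIntegralCurve hcV h2.2 (h1.2.comp_mul c) (by simp [h1.1, h2.1])
  rw [this, Function.comp_apply, mul_comm]

omit [CompactSpace M] [T2Space M] [IsManifold (𝓡 (2 * n)) ∞ M] in
-- A form of the flow equation without limits: it involves only values of `γ` at two times, so it
-- defines a closed condition for pointwise convergence.
theorem abs_taylor_sub_le {V : ∀ x : M, TangentSpace (𝓡 (2 * n)) x} {γ : ℝ → M}
    (hγ : IsMIntegralCurve (I := 𝓡 (2 * n)) γ V) {q : M → ℝ}
    (hq : MDifferentiable (𝓡 (2 * n)) 𝓘(ℝ, ℝ) q)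
    (hq' : MDifferentiable (𝓡 (2 * n)) 𝓘(ℝ, ℝ) (dirDeriv V q)) {C : ℝ}
    (hC : ∀ x, |dirDeriv V (dirDeriv V q) x| ≤ C) (s t : ℝ) :
    |q (γ t) - q (γ s) - (t - s) * dirDeriv V q (γ s)| ≤ C * |t - s| ^ 2 := by
  have hlip : ∀ a b, |dirDeriv V q (γ b) - dirDeriv V q (γ a)| ≤ C * |b - a| := fun a b =>
    convex_univ.norm_image_sub_le_of_norm_hasDerivWithin_le (f := fun t => dirDeriv V q (γ t))
      (fun τ _ => (hasDerivAt_comp_isMIntegralCurve hγ hq' τ).hasDerivWithinAt)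
      (fun τ _ => hC (γ τ)) (Set.mem_univ a) (Set.mem_univ b)
  have hC0 : 0 ≤ C := (abs_nonneg _).trans (hC (γ s))
  have key := (convex_uIcc s t).norm_image_sub_le_of_norm_hasDerivWithin_le
    (f := fun τ => q (γ τ) - τ * dirDeriv V q (γ s)) (C := C * |t - s|)
    (fun τ _ => (((hasDerivAt_comp_isMIntegralCurve hγ hq τ).sub
      ((hasDerivAt_id τ).mul_const (dirDeriv V q (γ s)))).hasDerivWithinAt))
    (fun τ hτ => by
      rw [one_mul]
      refine (hlip s τ).trans (mul_le_mul_of_nonneg_left ?_ hC0)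
      exact Set.abs_sub_left_of_mem_uIcc hτ) Set.left_mem_uIcc Set.right_mem_uIcc
  rw [Real.norm_eq_abs, Real.norm_eq_abs] at key
  calc _ = |q (γ t) - t * dirDeriv V q (γ s) - (q (γ s) - s * dirDeriv V q (γ s))| := by
        congr 1; ring
    _ ≤ _ := key.trans_eq (by ring)

omit [CompactSpace M] in
-- Smooth functions detect integral curves: bump functions force `γ` to be continuous, and chart
-- coordinates multiplied by a bump function give the derivative.
theorem isMIntegralCurve_of_hasDerivAt {V : ∀ x : M, TangentSpace (𝓡 (2 * n)) x} {γ : ℝ → M}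
    (h : ∀ q : M → ℝ, ContMDiff (𝓡 (2 * n)) 𝓘(ℝ, ℝ) ∞ q → ∀ s,
      HasDerivAt (fun t => q (γ t)) (dirDeriv V q (γ s)) s) :
    IsMIntegralCurve (I := 𝓡 (2 * n)) γ V := by
  have hcont : Continuous γ := by
    refine continuous_iff_continuousAt.2 fun s => ?_
    refine (SmoothBumpFunction.nhds_basis_support (I := 𝓡 (2 * n)) (c := γ s)
      Filter.univ_mem).tendsto_right_iff.2 fun f _ => ?_
    have h1 : ContinuousAt (fun t => f (γ t)) s := (h f f.contMDiff s).continuousAt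
    have h2 : f (γ s) ≠ 0 := by rw [f.eq_one]; exact one_ne_zero
    exact h1.eventually_ne h2
  intro s
  have : IsManifold (𝓡 (2 * n)) 1 M := .of_le (n := ∞) (by simp)
  obtain ⟨w, hw⟩ : ∃ w : EuclideanSpace ℝ (Fin (2 * n)), w = V (γ s) := ⟨_, rfl⟩
  suffices HasDerivAt (chartAt (EuclideanSpace ℝ (Fin (2 * n))) (γ s) ∘ γ) w s by
    rw [hw] at this
    exact hasMFDerivAt_of_hasDerivAt hcont.continuousAt this
  rw [hasDerivAt_iff_hasFDerivAt, ← hasFDerivWithinAt_univ, hasFDerivWithinAt_euclidean]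
  intro i
  rw [hasFDerivWithinAt_univ]
  obtain ⟨f, -⟩ := (SmoothBumpFunction.nhds_basis_tsupport (I := 𝓡 (2 * n)) (γ s)).ex_mem
  let q : M → ℝ := fun y => f y • chartAt (EuclideanSpace ℝ (Fin (2 * n))) (γ s) y i
  have hsm : ContMDiffOn (𝓡 (2 * n)) 𝓘(ℝ, ℝ) ∞
      (fun y => chartAt (EuclideanSpace ℝ (Fin (2 * n))) (γ s) y i)
      (chartAt (EuclideanSpace ℝ (Fin (2 * n))) (γ s)).source := by
    have h1 := contMDiffOn_chart (I := 𝓡 (2 * n)) (n := ∞) (x := γ s)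
    exact (PiLp.proj 2 (fun _ => ℝ) i : EuclideanSpace ℝ (Fin (2 * n)) →L[ℝ] ℝ).contMDiff.comp_contMDiffOn h1
  have hq : ContMDiff (𝓡 (2 * n)) 𝓘(ℝ, ℝ) ∞ q := f.contMDiff_smul hsm
  have hqe : q =ᶠ[𝓝 (γ s)] fun y => chartAt (EuclideanSpace ℝ (Fin (2 * n))) (γ s) y i := by
    filter_upwards [f.eventuallyEq_one] with y hy
    simp [q, hy]
  have hqe' : (fun t => chartAt (EuclideanSpace ℝ (Fin (2 * n))) (γ s) (γ t) i) =ᶠ[𝓝 s]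
      fun t => q (γ t) := by
    filter_upwards [hcont.continuousAt.eventually hqe] with t ht using ht.symm
  have hd := (h q hq s).congr_of_eventuallyEq hqe'
  convert! hd.hasFDerivAt using 1
  have hmd : MDifferentiableAt (𝓡 (2 * n)) (𝓡 (2 * n))
      (chartAt (EuclideanSpace ℝ (Fin (2 * n))) (γ s)) (γ s) :=
    mdifferentiableAt_atlas (ChartedSpace.chart_mem_atlas _) (mem_chart_source _ _)
  have hval : dirDeriv V q (γ s) = w i := by
    rw [dirDeriv_congr hqe, dirDeriv]
    have h2 := ((PiLp.proj 2 (fun _ => ℝ) i :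
      EuclideanSpace ℝ (Fin (2 * n)) →L[ℝ] ℝ).hasMFDerivAt.comp (γ s) hmd.hasMFDerivAt).mfderiv
    have h3 := congrArg (fun L => L (V (γ s))) h2
    refine h3.trans ?_
    rw [mfderiv_chartAt_eq_tangentCoordChange (mem_chart_source _ _)]
    have h4 := tangentCoordChange_self (I := 𝓡 (2 * n)) (x := γ s) (z := γ s) (v := V (γ s))
      (mem_extChartAt_source (γ s))
    rw [hw]
    exact congrArg (fun w : EuclideanSpace ℝ (Fin (2 * n)) => w i) h4
  rw [hval]
  ext
  simp

/-- Continuous dependence of integral curves on parameters. -/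
theorem continuous_flow {P : Type*} [TopologicalSpace P]
    {V : P → ∀ x : M, TangentSpace (𝓡 (2 * n)) x} (hV : ∀ p, SmoothField (V p))
    (hc : ∀ q : M → ℝ, ContMDiff (𝓡 (2 * n)) 𝓘(ℝ, ℝ) ∞ q →
      Continuous fun z : P × M => dirDeriv (V z.1) q z.2)
    (hb : ∀ q : M → ℝ, ContMDiff (𝓡 (2 * n)) 𝓘(ℝ, ℝ) ∞ q → ∃ C : P → ℝ, Continuous C ∧
      ∀ p x, |dirDeriv (V p) (dirDeriv (V p) q) x| ≤ C p) (x : M) (t : ℝ) :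
    Continuous fun p => flow (V p) x t := by
  choose! C hCc hC using hb
  let F : P → ℝ → M := fun p => flow (V p) x
  suffices hF : Continuous F from (continuous_apply t).comp hF
  -- The set `S` is the graph of `p ↦ flow (V p) x`, cut out by closed conditions. As `ℝ → M` is
  -- compact by Tychonoff, a map into it with closed graph is continuous.
  let S : Set (P × (ℝ → M)) := {z | z.2 0 = x ∧ ∀ q : M → ℝ,
    ContMDiff (𝓡 (2 * n)) 𝓘(ℝ, ℝ) ∞ q → ∀ s t,
      |q (z.2 t) - q (z.2 s) - (t - s) * dirDeriv (V z.1) q (z.2 s)| ≤ C q z.1 * |t - s| ^ 2}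
  have hS : IsClosed S := by
    have hev : ∀ t : ℝ, Continuous fun z : P × (ℝ → M) => z.2 t := fun t =>
      (continuous_apply t).comp continuous_snd
    have hSe : S = {z | z.2 0 = x} ∩ ⋂ q : M → ℝ, ⋂ _ : ContMDiff (𝓡 (2 * n)) 𝓘(ℝ, ℝ) ∞ q,
        ⋂ s, ⋂ t, {z | |q (z.2 t) - q (z.2 s) - (t - s) * dirDeriv (V z.1) q (z.2 s)| ≤
          C q z.1 * |t - s| ^ 2} := by
      ext z
      simp [S]
    rw [hSe]
    refine (isClosed_eq (hev 0) continuous_const).inter ?_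
    refine isClosed_iInter fun q => isClosed_iInter fun hq => isClosed_iInter fun s =>
      isClosed_iInter fun t => isClosed_le ?_ (((hCc q hq).comp continuous_fst).mul continuous_const)
    have h1 : Continuous fun z : P × (ℝ → M) => dirDeriv (V z.1) q (z.2 s) :=
      (hc q hq).comp (continuous_fst.prodMk (hev s))
    exact (((hq.continuous.comp (hev t)).sub (hq.continuous.comp (hev s))).sub
      (continuous_const.mul h1)).abs
  have hgraph : ∀ p c, (p, c) ∈ S ↔ c = F p := by
    intro p c
    constructor
    · rintro ⟨h0, h1⟩
      refine eq_of_isMIntegralCurve (hV p) (isMIntegralCurve_of_hasDerivAt fun q hq s => ?_)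
        (flow_spec (hV p) x).2 (h0.trans (flow_spec (hV p) x).1.symm)
      rw [hasDerivAt_iff_isLittleO]
      -- The quadratic bound at all pairs of times recovers the derivative of `q` along `c`.
      have hO : (fun t => q (c t) - q (c s) - (t - s) • dirDeriv (V p) q (c s)) =O[𝓝 s]
          fun t => (t - s) ^ 2 :=
        Asymptotics.IsBigO.of_bound (C q p) (Filter.Eventually.of_forall fun t => by
          simpa using h1 q hq s t)
      refine hO.trans_isLittleO ?_
      have h2 : (fun t : ℝ => (t - s) ^ 2) =o[𝓝 s] fun t => (t - s) ^ 1 := by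
        have := (Asymptotics.isLittleO_pow_pow (𝕜 := ℝ) (m := 1) (n := 2) (by norm_num))
        exact this.comp_tendsto (by
          have : Filter.Tendsto (fun t : ℝ => t - s) (𝓝 s) (𝓝 (s - s)) :=
            (continuous_id.sub continuous_const).tendsto s
          simpa using this)
      simpa using h2
    · rintro rfl
      have hγ := (flow_spec (hV p) x).2
      refine ⟨(flow_spec (hV p) x).1, fun q hq s t => abs_taylor_sub_le hγ
        (hq.mdifferentiable (by simp)) ((contMDiff_dirDeriv (hV p) hq).mdifferentiable (by simp))
        (hC q hq p) s t⟩
  refine continuous_iff_isClosed.2 fun D hD => ?_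
  have : F ⁻¹' D = Prod.fst '' (S ∩ Prod.snd ⁻¹' D) := by
    ext p
    constructor
    · exact fun hp => ⟨(p, F p), ⟨(hgraph p _).2 rfl, hp⟩, rfl⟩
    · rintro ⟨⟨p', c⟩, ⟨h1, h2⟩, rfl⟩
      rw [hgraph] at h1
      subst h1
      exact h2
  rw [this]
  exact isClosedMap_fst_of_compactSpace _ (hS.inter (hD.preimage continuous_snd))

end

/-! ## Taylor expansions -/

section Chain

variable {u : ℕ → ℝ → ℝ}

theorem iteratedDeriv_of_chain (h : ∀ p t, HasDerivAt (u p) (u (p + 1) t) t) (p : ℕ) :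
    iteratedDeriv p (u 0) = u p := by
  induction p with
  | zero => exact iteratedDeriv_zero
  | succ p ih => rw [iteratedDeriv_succ, ih]; exact funext fun t => (h p t).deriv

theorem contDiff_of_chain (h : ∀ p t, HasDerivAt (u p) (u (p + 1) t) t) : ContDiff ℝ ∞ (u 0) :=
  contDiff_of_differentiable_iteratedDeriv fun m _ => by
    rw [iteratedDeriv_of_chain h]
    exact fun t => (h m t).differentiableAt

/-- Induction on `J`: the remainder has as derivative the remainder of the shifted chain. The factor
`1/J!` is not needed and is given up. -/
theorem abs_sub_taylor_le_of_chain (h : ∀ p t, HasDerivAt (u p) (u (p + 1) t) t) {J : ℕ} {C : ℝ}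
    (hC : ∀ t, |u J t| ≤ C) {ε : ℝ} (hε : 0 ≤ ε) :
    |u 0 ε - ∑ j ∈ Finset.range J, u j 0 / (j.factorial : ℝ) * ε ^ j| ≤ C * ε ^ J := by
  have hC0 : 0 ≤ C := (abs_nonneg _).trans (hC 0)
  induction J generalizing u ε with
  | zero => simpa using hC ε
  | succ J ih =>
    have ih' := fun {t : ℝ} (ht : 0 ≤ t) => ih (u := fun p => u (p + 1)) (fun p => h (p + 1)) hC ht
    have hd : ∀ t, HasDerivAt (fun t => u 0 t - ∑ j ∈ Finset.range (J + 1),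
        u j 0 / (j.factorial : ℝ) * t ^ j)
        (u 1 t - ∑ j ∈ Finset.range J, u (j + 1) 0 / (j.factorial : ℝ) * t ^ j) t := by
      intro t
      refine (h 0 t).sub ?_
      simp only [Finset.sum_range_succ' _ J, pow_zero]
      refine (HasDerivAt.fun_sum (A' := fun j => u (j + 1) 0 / (j.factorial : ℝ) * t ^ j)
        fun j _ => ?_).add_const _
      refine ((hasDerivAt_pow (j + 1) t).const_mul _).congr_deriv ?_
      rw [Nat.factorial_succ]
      push_cast
      have : (j.factorial : ℝ) ≠ 0 := by positivity
      have : (j : ℝ) + 1 ≠ 0 := by positivity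
      field_simp
    have key := (convex_Icc 0 ε).norm_image_sub_le_of_norm_hasDerivWithin_le
      (C := C * ε ^ J) (fun t _ => (hd t).hasDerivWithinAt)
      (fun t ht => (ih' ht.1).trans (mul_le_mul_of_nonneg_left
        (pow_le_pow_left₀ ht.1 ht.2 J) hC0)) (Set.left_mem_Icc.2 hε) (Set.right_mem_Icc.2 hε)
    have h0 : ∑ j ∈ Finset.range (J + 1), u j 0 / (j.factorial : ℝ) * (0 : ℝ) ^ j = u 0 0 := by
      rw [Finset.sum_range_succ']
      simp
    rw [h0, sub_self, sub_zero, Real.norm_eq_abs, Real.norm_eq_abs, sub_zero, abs_of_nonneg hε] at key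
    exact key.trans_eq (by ring)

end Chain

/-! ## Homogeneous families of functions -/

section Family

variable {n d : ℕ} {M : Type*} [TopologicalSpace M]
  [ChartedSpace (EuclideanSpace ℝ (Fin (2 * n))) M]

variable (n) in
/-- A family of smooth functions on `M` that is homogeneous of degree `k` in the parameter: a finite
sum of products of continuous homogeneous functions of the parameter and smooth functions on `M`. -/
def IsHomFamily (k : ℕ) (Q : EuclideanSpace ℝ (Fin d) → M → ℝ) : Prop :=
  ∃ (ι : Type) (_ : Fintype ι) (c : ι → EuclideanSpace ℝ (Fin d) → ℝ) (q : ι → M → ℝ),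
    (∀ i, Continuous (c i)) ∧ (∀ i s x, c i (s • x) = s ^ k * c i x) ∧
    (∀ i, ContMDiff (𝓡 (2 * n)) 𝓘(ℝ, ℝ) ∞ (q i)) ∧ ∀ ξ x, Q ξ x = ∑ i, c i ξ * q i x

variable {k : ℕ} {Q : EuclideanSpace ℝ (Fin d) → M → ℝ}

theorem IsHomFamily.const {q : M → ℝ} (hq : ContMDiff (𝓡 (2 * n)) 𝓘(ℝ, ℝ) ∞ q) :
    IsHomFamily (d := d) n 0 (fun _ => q) :=
  ⟨Unit, inferInstance, fun _ _ => 1, fun _ => q, fun _ => continuous_const, by simp, fun _ => hq,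
    by simp⟩

theorem IsHomFamily.linear {q : Fin d → M → ℝ} (hq : ∀ i, ContMDiff (𝓡 (2 * n)) 𝓘(ℝ, ℝ) ∞ (q i))
    (hQ : ∀ ξ x, Q ξ x = ∑ i, ξ i * q i x) : IsHomFamily n 1 Q :=
  ⟨Fin d, inferInstance, fun i ξ => ξ i, q, fun i => by fun_prop, by simp, hq, hQ⟩

theorem IsHomFamily.continuous (hQ : IsHomFamily n k Q) :
    Continuous fun z : EuclideanSpace ℝ (Fin d) × M => Q z.1 z.2 := by
  obtain ⟨ι, _, c, q, hc, hs, hq, h⟩ := hQ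
  simp only [h]
  exact continuous_finsetSum _ fun i _ =>
    ((hc i).comp continuous_fst).mul ((hq i).continuous.comp continuous_snd)

theorem IsHomFamily.continuous_left (hQ : IsHomFamily n k Q) (x : M) : Continuous fun ξ => Q ξ x := by
  obtain ⟨ι, _, c, q, hc, hs, hq, h⟩ := hQ
  simp only [h]
  exact continuous_finsetSum _ fun i _ => (hc i).mul continuous_const

theorem IsHomFamily.smul (hQ : IsHomFamily n k Q) (s : ℝ) (ξ : EuclideanSpace ℝ (Fin d)) (x : M) :
    Q (s • ξ) x = s ^ k * Q ξ x := by
  obtain ⟨ι, _, c, q, hc, hs, hq, h⟩ := hQ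
  simp only [h, hs, Finset.mul_sum, mul_assoc]

theorem exists_abs_le_of_homogeneous {X : Type*} [TopologicalSpace X] [CompactSpace X]
    {Q : EuclideanSpace ℝ (Fin d) → X → ℝ}
    (hc : Continuous fun z : EuclideanSpace ℝ (Fin d) × X => Q z.1 z.2)
    (hs : ∀ (s : ℝ) ξ x, Q (s • ξ) x = s ^ k * Q ξ x) :
    ∃ C, 0 ≤ C ∧ ∀ ξ x, |Q ξ x| ≤ C * ‖ξ‖ ^ k := by
  -- The ball instead of the sphere, so that `‖ξ‖⁻¹ • ξ` stays in the set when `ξ = 0`.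
  obtain ⟨C, hC⟩ := ((isCompact_closedBall (0 : EuclideanSpace ℝ (Fin d)) 1).prod
    (isCompact_univ (X := X))).exists_bound_of_continuousOn hc.continuousOn
  have hb : ∀ ξ x, |Q ξ x| ≤ max C 0 * ‖ξ‖ ^ k := by
    intro ξ x
    have h1 : ξ = ‖ξ‖ • (‖ξ‖⁻¹ • ξ) := by
      rcases eq_or_ne ξ 0 with rfl | h
      · simp
      · rw [smul_inv_smul₀ (norm_ne_zero_iff.2 h)]
    have h2 : ‖ξ‖⁻¹ • ξ ∈ Metric.closedBall (0 : EuclideanSpace ℝ (Fin d)) 1 := by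
      rw [mem_closedBall_zero_iff, norm_smul, norm_inv, norm_norm]
      exact inv_mul_le_one
    have h3 := hC (‖ξ‖⁻¹ • ξ, x) ⟨h2, Set.mem_univ x⟩
    calc |Q ξ x| = ‖ξ‖ ^ k * |Q (‖ξ‖⁻¹ • ξ) x| := by
          conv_lhs => rw [h1, hs, abs_mul, abs_of_nonneg (by positivity)]
      _ ≤ ‖ξ‖ ^ k * max C 0 := by
          gcongr
          exact h3.trans (le_max_left _ _)
      _ = _ := mul_comm _ _
  exact ⟨max C 0, le_max_right _ _, hb⟩

theorem IsHomFamily.exists_abs_le [CompactSpace M] (hQ : IsHomFamily n k Q) :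
    ∃ C, 0 ≤ C ∧ ∀ ξ x, |Q ξ x| ≤ C * ‖ξ‖ ^ k :=
  exists_abs_le_of_homogeneous hQ.continuous hQ.smul

variable [IsManifold (𝓡 (2 * n)) ∞ M] (K : KahlerStructure n M)
  {G : Type*} [Group G] [TopologicalSpace G] [ChartedSpace (EuclideanSpace ℝ (Fin d)) G]
  [MulAction G M] (e : Module.Basis (Fin d) ℝ (GroupLieAlgebra (𝓡 d) G))

omit [TopologicalSpace M] [ChartedSpace (EuclideanSpace ℝ (Fin (2 * n))) M]
  [IsManifold (𝓡 (2 * n)) ∞ M] [MulAction G M] in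
theorem lieVec_smul (s : ℝ) (ξ : EuclideanSpace ℝ (Fin d)) :
    lieVec e (s • ξ) = s • lieVec e ξ := by
  simp only [lieVec, Finset.smul_sum, PiLp.smul_apply, smul_eq_mul, mul_smul]

theorem lieVec_ne_zero {ξ : EuclideanSpace ℝ (Fin d)} (h : ξ ≠ 0) : lieVec e ξ ≠ 0 := by
  intro h0
  refine h (PiLp.ext fun i => ?_)
  exact Fintype.linearIndependent_iff.1 e.linearIndependent (fun i => ξ i) h0 i

theorem dirDeriv_imagField_lieVec (ξ : EuclideanSpace ℝ (Fin d)) (q : M → ℝ) (x : M) :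
    dirDeriv (imagField K (lieVec e ξ)) q x = ∑ i, ξ i * dirDeriv (imagField K (e i)) q x := by
  rw [lieVec, imagField_sum, dirDeriv_sum_field]

variable [IsManifold (𝓡 d) ∞ G] [ContMDiffSMul (𝓡 d) (𝓡 (2 * n)) ∞ G M]

/-- The field `JX^ξ` is linear in `ξ`, so differentiating along it raises the degree in `ξ` by one.
-/
theorem IsHomFamily.dirDeriv (hQ : IsHomFamily n k Q) :
    IsHomFamily n (k + 1) fun ξ => dirDeriv (imagField K (lieVec e ξ)) (Q ξ) := by
  obtain ⟨ι, _, c, q, hc, hs, hq, h⟩ := hQ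
  refine ⟨ι × Fin d, inferInstance, fun z ξ => c z.1 ξ * ξ z.2,
    fun z => KahlerReduction.dirDeriv (imagField K (e z.2)) (q z.1),
    fun z => (hc z.1).mul (by fun_prop), fun z s x => ?_,
    fun z => contMDiff_dirDeriv (smoothField_imagField K (e z.2)) (hq z.1), fun ξ x => ?_⟩
  · simp only [hs, PiLp.smul_apply, smul_eq_mul]
    ring
  · beta_reduce
    rw [funext (h ξ), dirDeriv_sum (f := fun i y => c i ξ * q i y)
      fun i _ => contMDiffAt_const.mul (hq i x), Fintype.sum_prod_type]
    refine Finset.sum_congr rfl fun i _ => ?_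
    rw [dirDeriv_const_mul _ ((hq i).mdifferentiable (by simp) x), dirDeriv_imagField_lieVec,
      Finset.mul_sum]
    exact Finset.sum_congr rfl fun j _ => by ring

theorem IsHomFamily.iterDirDeriv (hQ : IsHomFamily n k Q) (p : ℕ) :
    IsHomFamily n (k + p) fun ξ => iterDirDeriv (imagField K (lieVec e ξ)) p (Q ξ) := by
  induction p with
  | zero => exact hQ
  | succ p ih =>
    have := ih.dirDeriv K e
    simp only [KahlerReduction.iterDirDeriv, Function.iterate_succ_apply'] at this ⊢
    exact this

variable {K} {Φ : M → Module.Dual ℝ (GroupLieAlgebra (𝓡 d) G)}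

omit [IsManifold (𝓡 d) ∞ G] [ContMDiffSMul (𝓡 d) (𝓡 (2 * n)) ∞ G M] in
theorem IsHamiltonian.isHomFamily (hΦ : IsHamiltonian K Φ) :
    IsHomFamily n 1 fun ξ y => Φ y (lieVec e ξ) :=
  IsHomFamily.linear (q := fun i y => Φ y (e i)) (fun i => hΦ.smooth_Φ (e i)) fun ξ x => by
    rw [lieVec, map_sum]
    exact Finset.sum_congr rfl fun i _ => by rw [map_smul, smul_eq_mul]

theorem IsHamiltonian.isHomFamily_lapMoment (hΦ : IsHamiltonian K Φ) :
    IsHomFamily n 1 fun ξ => lapMoment K Φ (lieVec e ξ) :=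
  IsHomFamily.linear (q := fun i => lapMoment K Φ (e i)) (fun i => hΦ.contMDiff_lapMoment (e i))
    fun _ x => hΦ.lapMoment_sum _ _ _ x

end Family

/-! ## The radial functions -/

section Radial

variable {n d : ℕ} {M : Type*} [TopologicalSpace M] [CompactSpace M] [T2Space M]
  [ChartedSpace (EuclideanSpace ℝ (Fin (2 * n))) M] [IsManifold (𝓡 (2 * n)) ∞ M]
  (K : KahlerStructure n M) {G : Type*} [Group G] [TopologicalSpace G]
  [ChartedSpace (EuclideanSpace ℝ (Fin d)) G] [IsManifold (𝓡 d) ∞ G] [MulAction G M]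
  [ContMDiffSMul (𝓡 d) (𝓡 (2 * n)) ∞ G M] (e : Module.Basis (Fin d) ℝ (GroupLieAlgebra (𝓡 d) G))

theorem imagExp_spec (ξ : GroupLieAlgebra (𝓡 d) G) (x : M) : imagExp K ξ x 0 = x ∧
    IsMIntegralCurve (I := 𝓡 (2 * n)) (imagExp K ξ x) (imagField K ξ) :=
  flow_spec (smoothField_imagField K ξ) x

theorem imagExp_smul (c : ℝ) (ξ : GroupLieAlgebra (𝓡 d) G) (x : M) (t : ℝ) :
    imagExp K (c • ξ) x t = imagExp K ξ x (c * t) := by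
  have h := smoothField_imagField (n := n) K (c • ξ)
  rw [imagExp, imagExp]
  rw [imagField_smul] at h ⊢
  exact flow_smul_field (smoothField_imagField K ξ) h x t

/-- The time can be absorbed into `ξ`, so joint continuity reduces to continuity in `ξ` at time `1`.
-/
theorem continuous_imagExp (x : M) : Continuous fun z : EuclideanSpace ℝ (Fin d) × ℝ =>
    imagExp K (lieVec e z.1) x z.2 := by
  have h1 : Continuous fun ξ : EuclideanSpace ℝ (Fin d) => imagExp K (lieVec e ξ) x 1 := by
    refine continuous_flow (V := fun ξ => imagField K (lieVec e ξ))
      (fun ξ => smoothField_imagField K _) (fun q hq => ?_) (fun q hq => ?_) x 1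
    · exact ((IsHomFamily.const hq).dirDeriv K e).continuous
    · obtain ⟨C, -, hC⟩ := (((IsHomFamily.const hq).dirDeriv K e).dirDeriv K e).exists_abs_le
      exact ⟨fun ξ => C * ‖ξ‖ ^ 2, by fun_prop, hC⟩
  have h2 : ∀ z : EuclideanSpace ℝ (Fin d) × ℝ,
      imagExp K (lieVec e z.1) x z.2 = imagExp K (lieVec e (z.2 • z.1)) x 1 := fun z => by
    rw [lieVec_smul, imagExp_smul, mul_one]
  simp only [h2]
  exact h1.comp (continuous_snd.smul continuous_fst)

theorem hasDerivAt_iterDirDeriv_imagExp {q : M → ℝ} (hq : ContMDiff (𝓡 (2 * n)) 𝓘(ℝ, ℝ) ∞ q)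
    (ξ : GroupLieAlgebra (𝓡 d) G) (x : M) (p : ℕ) (t : ℝ) :
    HasDerivAt (fun s => iterDirDeriv (imagField K ξ) p q (imagExp K ξ x s))
      (iterDirDeriv (imagField K ξ) (p + 1) q (imagExp K ξ x t)) t := by
  have h := hasDerivAt_comp_isMIntegralCurve (imagExp_spec K ξ x).2
    ((contMDiff_iterDirDeriv (smoothField_imagField K ξ) hq p).mdifferentiable (by simp)) t
  simp only [iterDirDeriv, Function.iterate_succ_apply'] at h ⊢
  exact h

/-- The successive derivatives of the integral of `q` along the curve `e^{itξ} x`. -/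
def curveChain (ξ : GroupLieAlgebra (𝓡 d) G) (q : M → ℝ) (x : M) : ℕ → ℝ → ℝ
  | 0, ρ => ∫ t in (0 : ℝ)..ρ, q (imagExp K ξ x t)
  | p + 1, ρ => iterDirDeriv (imagField K ξ) p q (imagExp K ξ x ρ)

omit [CompactSpace M] [T2Space M] [IsManifold (𝓡 d) ∞ G] [ContMDiffSMul (𝓡 d) (𝓡 (2 * n)) ∞ G M] in
theorem curveChain_succ (ξ : GroupLieAlgebra (𝓡 d) G) (q : M → ℝ) (x : M) (p : ℕ) (ρ : ℝ) :
    curveChain K ξ q x (p + 1) ρ = iterDirDeriv (imagField K ξ) p q (imagExp K ξ x ρ) := rfl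

theorem hasDerivAt_curveChain {q : M → ℝ} (hq : ContMDiff (𝓡 (2 * n)) 𝓘(ℝ, ℝ) ∞ q)
    (ξ : GroupLieAlgebra (𝓡 d) G) (x : M) (p : ℕ) (t : ℝ) :
    HasDerivAt (curveChain K ξ q x p) (curveChain K ξ q x (p + 1) t) t := by
  cases p with
  | zero =>
    have hc : Continuous fun t => q (imagExp K ξ x t) :=
      hq.continuous.comp (imagExp_spec K ξ x).2.continuous
    exact intervalIntegral.integral_hasDerivAt_right (hc.intervalIntegrable _ _)
      hc.stronglyMeasurable.stronglyMeasurableAtFilter hc.continuousAt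
  | succ p => exact hasDerivAt_iterDirDeriv_imagExp K hq ξ x p t

end Radial

/-! ### Taylor coefficients and uniform expansions of `f` and `h`. -/

section RadialFunctions

variable {n d : ℕ} {M : Type*} [TopologicalSpace M] [CompactSpace M] [T2Space M]
  [ChartedSpace (EuclideanSpace ℝ (Fin (2 * n))) M] [IsManifold (𝓡 (2 * n)) ∞ M]
  {K : KahlerStructure n M} {G : Type*} [Group G] [TopologicalSpace G]
  [ChartedSpace (EuclideanSpace ℝ (Fin d)) G] [IsManifold (𝓡 d) ∞ G] [MulAction G M]
  [ContMDiffSMul (𝓡 d) (𝓡 (2 * n)) ∞ G M] (e : Module.Basis (Fin d) ℝ (GroupLieAlgebra (𝓡 d) G))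
  {Φ : M → Module.Dual ℝ (GroupLieAlgebra (𝓡 d) G)}

omit [CompactSpace M] [T2Space M] [IsManifold (𝓡 d) ∞ G] [ContMDiffSMul (𝓡 d) (𝓡 (2 * n)) ∞ G M] in
theorem radialH_eq_curveChain (ξ : GroupLieAlgebra (𝓡 d) G) (x : M) :
    radialH K Φ ξ x = curveChain K ξ (lapMoment K Φ ξ) x 0 := rfl

omit [CompactSpace M] [T2Space M] [IsManifold (𝓡 d) ∞ G] [ContMDiffSMul (𝓡 d) (𝓡 (2 * n)) ∞ G M] in
theorem radialF_eq_curveChain (ξ : GroupLieAlgebra (𝓡 d) G) (x : M) :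
    radialF K Φ ξ x = fun ρ => 2 * curveChain K ξ (fun y => Φ y ξ) x 0 ρ := rfl

theorem IsHamiltonian.hasDerivAt_chainH (hΦ : IsHamiltonian K Φ) (ξ : GroupLieAlgebra (𝓡 d) G)
    (x : M) (p : ℕ) (t : ℝ) :
    HasDerivAt (curveChain K ξ (lapMoment K Φ ξ) x p)
      (curveChain K ξ (lapMoment K Φ ξ) x (p + 1) t) t :=
  hasDerivAt_curveChain K (hΦ.contMDiff_lapMoment ξ) ξ x p t

theorem IsHamiltonian.hasDerivAt_chainF (hΦ : IsHamiltonian K Φ) (ξ : GroupLieAlgebra (𝓡 d) G)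
    (x : M) (p : ℕ) (t : ℝ) :
    HasDerivAt (fun ρ => 2 * curveChain K ξ (fun y => Φ y ξ) x p ρ)
      (2 * curveChain K ξ (fun y => Φ y ξ) x (p + 1) t) t :=
  (hasDerivAt_curveChain K (hΦ.smooth_Φ ξ) ξ x p t).const_mul 2

theorem IsHamiltonian.contDiff_radialH (hΦ : IsHamiltonian K Φ) (ξ : GroupLieAlgebra (𝓡 d) G)
    (x : M) : ContDiff ℝ ∞ (radialH K Φ ξ x) :=
  contDiff_of_chain (hΦ.hasDerivAt_chainH ξ x)

theorem IsHamiltonian.coeffH_succ (hΦ : IsHamiltonian K Φ) (ξ : GroupLieAlgebra (𝓡 d) G)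
    (x : M) (p : ℕ) : coeffH K Φ ξ x (p + 1) =
      iterDirDeriv (imagField K ξ) p (lapMoment K Φ ξ) x / ((p + 1).factorial : ℝ) := by
  rw [coeffH, radialH_eq_curveChain, iteratedDeriv_of_chain (hΦ.hasDerivAt_chainH ξ x), curveChain_succ,
    (imagExp_spec K ξ x).1]

omit [CompactSpace M] [T2Space M] [IsManifold (𝓡 d) ∞ G] [ContMDiffSMul (𝓡 d) (𝓡 (2 * n)) ∞ G M] in
theorem coeffH_zero (ξ : GroupLieAlgebra (𝓡 d) G) (x : M) : coeffH K Φ ξ x 0 = 0 := by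
  simp [coeffH, radialH]

theorem IsHamiltonian.coeffF_eq (hΦ : IsHamiltonian K Φ) (ξ : GroupLieAlgebra (𝓡 d) G)
    (x : M) (p : ℕ) : coeffF K Φ ξ x p = 2 / ((p + 2).factorial : ℝ) *
      iterDirDeriv (imagField K ξ) (p + 1) (fun y => Φ y ξ) x := by
  rw [coeffF, radialF_eq_curveChain, iteratedDeriv_of_chain (u := fun p ρ =>
    2 * curveChain K ξ (fun y => Φ y ξ) x p ρ) (hΦ.hasDerivAt_chainF ξ x)]
  beta_reduce
  rw [curveChain_succ, (imagExp_spec K ξ x).1]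
  ring

omit [CompactSpace M] [T2Space M] [IsManifold (𝓡 d) ∞ G] [ContMDiffSMul (𝓡 d) (𝓡 (2 * n)) ∞ G M] in
theorem IsHamiltonian.iterDirDeriv_succ (hΦ : IsHamiltonian K Φ) (ξ : GroupLieAlgebra (𝓡 d) G)
    (p : ℕ) : iterDirDeriv (imagField K ξ) (p + 1) (fun y => Φ y ξ) =
      iterDirDeriv (imagField K ξ) p (fun y => K.length y (infAction ξ y) ^ 2) := by
  rw [iterDirDeriv, Function.iterate_succ_apply]
  rw [show dirDeriv (imagField K ξ) (fun y => Φ y ξ) =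
    fun y => K.length y (infAction ξ y) ^ 2 from funext (hΦ.dirDeriv_eq ξ)]
  rfl

theorem IsHamiltonian.coeffF_zero (hΦ : IsHamiltonian K Φ) (ξ : GroupLieAlgebra (𝓡 d) G) (x : M) :
    coeffF K Φ ξ x 0 = K.length x (infAction ξ x) ^ 2 := by
  rw [hΦ.coeffF_eq, hΦ.iterDirDeriv_succ]
  simp [iterDirDeriv]

omit [CompactSpace M] [T2Space M] in
theorem KahlerStructure.length_pos (K : KahlerStructure n M) {x : M}
    {v : TangentSpace (𝓡 (2 * n)) x} (hv : v ≠ 0) : 0 < K.length x v :=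
  Real.sqrt_pos.2 (K.pos x v hv)

/-- `h` vanishes at `ρ = 0`, so the Taylor series of `exp (a h)` is the formal exponential of that
of `a h`. -/
theorem IsHamiltonian.coeffG_eq (hΦ : IsHamiltonian K Φ) (a : ℝ) (ξ : GroupLieAlgebra (𝓡 d) G)
    (x : M) (j : ℕ) : coeffG K Φ a ξ x j =
      PowerSeries.coeff j (expSeries (a • tailSeries (coeffH K Φ ξ x))) := by
  have h1 := taylorSeries_exp (u := fun ρ => a * radialH K Φ ξ x ρ)
    (contDiff_const.mul (hΦ.contDiff_radialH ξ x)) (by simp [radialH])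
  have h2 : taylorSeries (fun ρ => a * radialH K Φ ξ x ρ) = a • tailSeries (coeffH K Φ ξ x) := by
    have hch : ∀ p t, HasDerivAt (fun ρ => a * curveChain K ξ (lapMoment K Φ ξ) x p ρ)
      (a * curveChain K ξ (lapMoment K Φ ξ) x (p + 1) t) t :=
      fun p t => (hΦ.hasDerivAt_chainH ξ x p t).const_mul a
    ext j
    rw [smul_tailSeries, coeff_tailSeries, taylorSeries, PowerSeries.coeff_mk]
    split_ifs with hj
    · subst hj
      simp [radialH]
    · have e1 := iteratedDeriv_of_chain (u := fun p ρ =>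
        a * curveChain K ξ (lapMoment K Φ ξ) x p ρ) hch j
      have e2 := iteratedDeriv_of_chain (hΦ.hasDerivAt_chainH ξ x) j
      rw [coeffH, radialH_eq_curveChain, e1, e2, mul_div_assoc]
  rw [← h2, ← h1]
  simp [taylorSeries, coeffG]

omit [CompactSpace M] [T2Space M] in
theorem IsHamiltonian.isHomFamily_iterDirDeriv (hΦ : IsHamiltonian K Φ) (p : ℕ) :
    IsHomFamily n (1 + p) fun ξ => iterDirDeriv (imagField K (lieVec e ξ)) p
      (fun y => Φ y (lieVec e ξ)) :=
  (hΦ.isHomFamily e).iterDirDeriv K e p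

omit [CompactSpace M] [T2Space M] in
theorem IsHamiltonian.isHomFamily_iterDirDeriv_lapMoment (hΦ : IsHamiltonian K Φ) (p : ℕ) :
    IsHomFamily n (1 + p) fun ξ => iterDirDeriv (imagField K (lieVec e ξ)) p
      (lapMoment K Φ (lieVec e ξ)) :=
  (hΦ.isHomFamily_lapMoment e).iterDirDeriv K e p

theorem IsHamiltonian.continuous_coeffF (hΦ : IsHamiltonian K Φ) (x : M) (j : ℕ) :
    Continuous fun ξ => coeffF K Φ (lieVec e ξ) x j := by
  simp only [hΦ.coeffF_eq]
  exact continuous_const.mul ((hΦ.isHomFamily_iterDirDeriv e (j + 1)).continuous_left x)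

theorem IsHamiltonian.coeffF_smul (hΦ : IsHamiltonian K Φ) (x : M) (j : ℕ) (s : ℝ)
    (ξ : EuclideanSpace ℝ (Fin d)) :
    coeffF K Φ (lieVec e (s • ξ)) x j = s ^ (j + 2) * coeffF K Φ (lieVec e ξ) x j := by
  simp only [hΦ.coeffF_eq]
  rw [(hΦ.isHomFamily_iterDirDeriv e (j + 1)).smul s ξ x]
  ring

theorem IsHamiltonian.continuous_coeffH (hΦ : IsHamiltonian K Φ) (x : M) (j : ℕ) :
    Continuous fun ξ => coeffH K Φ (lieVec e ξ) x j := by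
  cases j with
  | zero => simp only [coeffH_zero]; exact continuous_const
  | succ j =>
    simp only [hΦ.coeffH_succ]
    exact ((hΦ.isHomFamily_iterDirDeriv_lapMoment e j).continuous_left x).div_const _

theorem IsHamiltonian.coeffH_smul (hΦ : IsHamiltonian K Φ) (x : M) (j : ℕ) (s : ℝ)
    (ξ : EuclideanSpace ℝ (Fin d)) :
    coeffH K Φ (lieVec e (s • ξ)) x j = s ^ j * coeffH K Φ (lieVec e ξ) x j := by
  cases j with
  | zero => simp only [coeffH_zero, mul_zero]
  | succ j =>
    simp only [hΦ.coeffH_succ]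
    rw [(hΦ.isHomFamily_iterDirDeriv_lapMoment e j).smul s ξ x]
    ring

/-- The derivative of order `J + 1` is a homogeneous family of that degree evaluated along the
curve; compactness of `M` bounds it wherever the curve goes. -/
theorem IsHamiltonian.exists_abs_radialH_sub_le (hΦ : IsHamiltonian K Φ) (x : M) (J : ℕ) :
    ∃ C, 0 ≤ C ∧ ∀ (ξ : EuclideanSpace ℝ (Fin d)) (ε : ℝ), 0 ≤ ε →
      |radialH K Φ (lieVec e ξ) x ε - ∑ j ∈ Finset.range (J + 1),
        coeffH K Φ (lieVec e ξ) x j * ε ^ j| ≤ C * ‖ξ‖ ^ (J + 1) * ε ^ (J + 1) := by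
  obtain ⟨C, hC0, hC⟩ := (hΦ.isHomFamily_iterDirDeriv_lapMoment e J).exists_abs_le
  refine ⟨C, hC0, fun ξ ε hε => ?_⟩
  have hch := hΦ.hasDerivAt_chainH (lieVec e ξ) x
  have h := abs_sub_taylor_le_of_chain hch (J := J + 1) (C := C * ‖ξ‖ ^ (J + 1))
    (fun t => by rw [curveChain_succ, add_comm J 1]; exact hC ξ _) hε
  convert! h using 5 with j
  rw [coeffH, radialH_eq_curveChain, iteratedDeriv_of_chain hch]

theorem IsHamiltonian.exists_abs_radialF_sub_le (hΦ : IsHamiltonian K Φ) {x : M} (hx : Φ x = 0)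
    (J : ℕ) :
    ∃ C, 0 ≤ C ∧ ∀ (ξ : EuclideanSpace ℝ (Fin d)) (ε : ℝ), 0 ≤ ε →
      |radialF K Φ (lieVec e ξ) x ε - ∑ j ∈ Finset.range J,
        coeffF K Φ (lieVec e ξ) x j * ε ^ (j + 2)| ≤ C * ‖ξ‖ ^ (J + 2) * ε ^ (J + 2) := by
  obtain ⟨C, hC0, hC⟩ := (hΦ.isHomFamily_iterDirDeriv e (J + 1)).exists_abs_le
  refine ⟨2 * C, by positivity, fun ξ ε hε => ?_⟩
  have hch := hΦ.hasDerivAt_chainF (lieVec e ξ) x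
  have h := abs_sub_taylor_le_of_chain (u := fun p ρ =>
    2 * curveChain K (lieVec e ξ) (fun y => Φ y (lieVec e ξ)) x p ρ) hch (J := J + 2)
    (C := 2 * C * ‖ξ‖ ^ (J + 2)) (fun t => by
      have hC' := hC ξ (imagExp K (lieVec e ξ) x t)
      rw [← curveChain_succ, add_comm 1 (J + 1)] at hC'
      rw [abs_mul, abs_two, mul_assoc]
      exact mul_le_mul_of_nonneg_left hC' zero_le_two) hε
  rw [Finset.sum_range_succ', Finset.sum_range_succ'] at h
  -- The terms of degree `0` and `1` vanish: the integral is empty, and `f'(0) = 2 φ_ξ(x)` with `Φ x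
  -- = 0`.
  have e0 : curveChain K (lieVec e ξ) (fun y => Φ y (lieVec e ξ)) x 0 0 = 0 := by simp [curveChain]
  have e1 : curveChain K (lieVec e ξ) (fun y => Φ y (lieVec e ξ)) x (0 + 1) 0 = 0 := by
    simp [curveChain, iterDirDeriv, (imagExp_spec K (lieVec e ξ) x).1, hx]
  rw [e0, e1] at h
  simp only [mul_zero, zero_div, zero_mul, add_zero] at h
  refine le_of_eq_of_le ?_ h
  congr 2
  refine Finset.sum_congr rfl fun j _ => ?_
  rw [coeffF, radialF_eq_curveChain, iteratedDeriv_of_chain (u := fun p ρ =>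
    2 * curveChain K (lieVec e ξ) (fun y => Φ y (lieVec e ξ)) x p ρ) hch]

theorem IsHamiltonian.hasExpansion_radialH (hΦ : IsHamiltonian K Φ) (x : M) :
    HasExpansion (fun ξ : EuclideanSpace ℝ (Fin d) => 1 + ‖ξ‖)
      (fun ξ ε => radialH K Φ (lieVec e ξ) x ε)
      (fun ξ => tailSeries fun i => coeffH K Φ (lieVec e ξ) x i) := by
  have hsum : ∀ (ξ : EuclideanSpace ℝ (Fin d)) (ε : ℝ) (J : ℕ), ∑ j ∈ Finset.range J,
      PowerSeries.coeff j (tailSeries fun i => coeffH K Φ (lieVec e ξ) x i) * ε ^ j =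
      ∑ j ∈ Finset.range J, coeffH K Φ (lieVec e ξ) x j * ε ^ j := by
    intro ξ ε J
    refine Finset.sum_congr rfl fun j _ => ?_
    rw [coeff_tailSeries]
    split_ifs with hj
    · rw [hj, coeffH_zero]
    · rfl
  intro J
  -- `J - 1 + 1` is `J` except for `J = 0`, where the bound of order `1` suffices because `ε ≤ 1`.
  obtain ⟨C, hC0, hC⟩ := hΦ.exists_abs_radialH_sub_le e x (J - 1)
  refine ⟨C, J - 1 + 1, hC0, fun ξ ε hε hε1 => ?_⟩
  have hw : ‖ξ‖ ^ (J - 1 + 1) ≤ (1 + ‖ξ‖) ^ (J - 1 + 1) := by gcongr; linarith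
  have hb : ε ^ (J - 1 + 1) ≤ ε ^ J := pow_le_pow_of_le_one hε.le hε1 (by omega)
  refine le_trans ?_ ((hC ξ ε hε.le).trans (by gcongr))
  rw [hsum]
  rcases Nat.eq_zero_or_pos J with rfl | hJ
  · simp [coeffH_zero]
  · rw [Nat.sub_add_cancel hJ]

theorem IsHamiltonian.hasExpansion_radialF (hΦ : IsHamiltonian K Φ) {x : M} (hx : Φ x = 0) :
    HasExpansion (fun ξ : EuclideanSpace ℝ (Fin d) => 1 + ‖ξ‖)
      (fun ξ ε => radialF K Φ (lieVec e ξ) x ε / ε ^ 2 - coeffF K Φ (lieVec e ξ) x 0)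
      (fun ξ => tailSeries fun i => coeffF K Φ (lieVec e ξ) x i) := by
  intro J
  -- Order at least `1` is taken even for `J = 0`, because the term `f_0` has been moved to the
  -- left-hand side.
  obtain ⟨C, hC0, hC⟩ := hΦ.exists_abs_radialF_sub_le e hx (J - 1 + 1)
  refine ⟨C, J - 1 + 1 + 2, hC0, fun ξ ε hε hε1 => ?_⟩
  have hw : ‖ξ‖ ^ (J - 1 + 1 + 2) ≤ (1 + ‖ξ‖) ^ (J - 1 + 1 + 2) := by gcongr; linarith
  have hb : ε ^ (J - 1 + 1) ≤ ε ^ J := pow_le_pow_of_le_one hε.le hε1 (by omega)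
  have hsum : ∑ j ∈ Finset.range J,
      PowerSeries.coeff j (tailSeries fun i => coeffF K Φ (lieVec e ξ) x i) * ε ^ j +
      coeffF K Φ (lieVec e ξ) x 0 =
      ∑ j ∈ Finset.range (J - 1 + 1), coeffF K Φ (lieVec e ξ) x j * ε ^ j := by
    rw [Finset.sum_range_succ', pow_zero, mul_one]
    congr 1
    cases J with
    | zero => simp
    | succ J =>
      rw [Finset.sum_range_succ']
      simp [coeff_tailSeries]
  have h1 := hC ξ ε hε.le
  have h2 : radialF K Φ (lieVec e ξ) x ε - ∑ j ∈ Finset.range (J - 1 + 1),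
      coeffF K Φ (lieVec e ξ) x j * ε ^ (j + 2) = ε ^ 2 *
      (radialF K Φ (lieVec e ξ) x ε / ε ^ 2 - coeffF K Φ (lieVec e ξ) x 0 - ∑ j ∈ Finset.range J,
      PowerSeries.coeff j (tailSeries fun i => coeffF K Φ (lieVec e ξ) x i) * ε ^ j) := by
    rw [sub_sub, add_comm (coeffF _ _ _ _ _), hsum, mul_sub, mul_div_cancel₀ _ (by positivity),
      Finset.mul_sum]
    congr 1
    exact Finset.sum_congr rfl fun j _ => by ring
  rw [h2, abs_mul, abs_of_nonneg (by positivity : 0 ≤ ε ^ 2)] at h1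
  refine le_of_mul_le_mul_left (h1.trans ?_) (by positivity : 0 < ε ^ 2)
  calc C * ‖ξ‖ ^ (J - 1 + 1 + 2) * ε ^ (J - 1 + 1 + 2)
      = C * ‖ξ‖ ^ (J - 1 + 1 + 2) * (ε ^ 2 * ε ^ (J - 1 + 1)) := by ring
    _ ≤ C * (1 + ‖ξ‖) ^ (J - 1 + 1 + 2) * (ε ^ 2 * ε ^ J) := by gcongr
    _ = _ := by ring

end RadialFunctions

/-! ### Continuity of the integrand on the sphere. -/

section SphereCoeff

variable {X : Type*} [TopologicalSpace X]

theorem continuous_sumOrOne {ι : Type*} {s : Finset ι} {F : ι → X → ℝ}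
    (hF : ∀ i ∈ s, Continuous (F i)) : Continuous fun x => sumOrOne s fun i => F i x := by
  unfold sumOrOne
  split_ifs
  · exact continuous_finsetSum _ hF
  · exact continuous_const

theorem continuous_sphereCoeff {f h : ℕ → X → ℝ} (hf : ∀ j, Continuous (f j))
    (hh : ∀ j, Continuous (h j)) (hpos : ∀ x, 0 < f 0 x) (d j : ℕ) (a : ℝ) :
    Continuous fun x => sphereCoeff d j a (fun i => f i x) fun i => h i x := by
  unfold sphereCoeff
  refine ((hf 0).rpow_const fun x => Or.inl (hpos x).ne').mul
    (continuous_finsetSum _ fun m _ => (continuous_coeff_expSeries (fun i => ?_) _).mul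
      (continuous_sumOrOne fun r _ => continuous_const.mul (Continuous.div ?_ ((hf 0).pow r)
        fun x => (pow_pos (hpos x) r).ne')))
  · simp only [map_smul, smul_eq_mul]
    exact continuous_const.mul (continuous_coeff_tailSeries hh i)
  · unfold compPoly
    exact continuous_finsetSum _ fun q _ => continuous_finsetProd _ fun i _ => hf _

end SphereCoeff

/-! ### Rescaling, the lower bound for the exponent, and the dictionary for the coefficients. -/

section Main

variable {n d : ℕ} {M : Type*} [TopologicalSpace M] [CompactSpace M] [T2Space M]
  [ChartedSpace (EuclideanSpace ℝ (Fin (2 * n))) M] [IsManifold (𝓡 (2 * n)) ∞ M]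
  {K : KahlerStructure n M} {G : Type*} [Group G] [TopologicalSpace G]
  [ChartedSpace (EuclideanSpace ℝ (Fin d)) G] [IsManifold (𝓡 d) ∞ G] [MulAction G M]
  [ContMDiffSMul (𝓡 d) (𝓡 (2 * n)) ∞ G M] (e : Module.Basis (Fin d) ℝ (GroupLieAlgebra (𝓡 d) G))
  {Φ : M → Module.Dual ℝ (GroupLieAlgebra (𝓡 d) G)}

theorem radialF_smul (c : ℝ) (ξ : GroupLieAlgebra (𝓡 d) G) (x : M) (ρ : ℝ) :
    radialF K Φ (c • ξ) x ρ = radialF K Φ ξ x (c * ρ) := by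
  simp only [radialF, imagExp_smul, map_smul, smul_eq_mul]
  rw [intervalIntegral.integral_const_mul,
    intervalIntegral.mul_integral_comp_mul_left (f := fun t => Φ (imagExp K ξ x t) ξ), mul_zero]

theorem IsHamiltonian.radialH_smul (hΦ : IsHamiltonian K Φ) (c : ℝ) (ξ : GroupLieAlgebra (𝓡 d) G)
    (x : M) (ρ : ℝ) : radialH K Φ (c • ξ) x ρ = radialH K Φ ξ x (c * ρ) := by
  simp only [radialH, imagExp_smul, hΦ.lapMoment_smul]
  rw [intervalIntegral.integral_const_mul,
    intervalIntegral.mul_integral_comp_mul_left (f := fun t => lapMoment K Φ ξ (imagExp K ξ x t)),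
    mul_zero]

/-- Scaling `ξ` by `ε` and integrating up to time `1` is the same as integrating up to time `ε`
along the unscaled curve. -/
theorem IsHamiltonian.densityIntegrand_smul (hΦ : IsHamiltonian K Φ) (a k : ℝ) (x : M) (ε : ℝ)
    (ξ : EuclideanSpace ℝ (Fin d)) : densityIntegrand K Φ e a k x (ε • ξ) =
      Real.exp (-(k * radialF K Φ (lieVec e ξ) x ε) + a * radialH K Φ (lieVec e ξ) x ε) := by
  have h1 : radialF K Φ (lieVec e ξ) x ε = radialF K Φ (lieVec e (ε • ξ)) x 1 := by
    rw [lieVec_smul, radialF_smul, mul_one]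
  have h2 : radialH K Φ (lieVec e ξ) x ε = radialH K Φ (lieVec e (ε • ξ)) x 1 := by
    rw [lieVec_smul, hΦ.radialH_smul, mul_one]
  rw [densityIntegrand, h1, h2, radialF, radialH]
  have hγ := (imagExp_spec K (lieVec e (ε • ξ)) x).2.continuous
  rw [intervalIntegral.integral_add, intervalIntegral.integral_const_mul,
    intervalIntegral.integral_const_mul]
  · congr 1
    ring
  · exact (continuous_const.mul ((hΦ.smooth_Φ _).continuous.comp hγ)).intervalIntegrable _ _
  · exact (continuous_const.mul ((hΦ.contMDiff_lapMoment _).continuous.comp hγ)).intervalIntegrable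
      _ _

theorem IsHomFamily.continuous_integral {k : ℕ} {Q : EuclideanSpace ℝ (Fin d) → M → ℝ}
    (hQ : IsHomFamily n k Q) (K : KahlerStructure n M) (x : M) (ε : ℝ) :
    Continuous fun ξ : EuclideanSpace ℝ (Fin d) =>
      ∫ t in (0 : ℝ)..ε, Q ξ (imagExp K (lieVec e ξ) x t) :=
  intervalIntegral.continuous_parametric_intervalIntegral_of_continuous'
    (f := fun ξ t => Q ξ (imagExp K (lieVec e ξ) x t))
    (hQ.continuous.comp (continuous_fst.prodMk (continuous_imagExp K e x))) 0 ε

theorem IsHamiltonian.continuous_radialF (hΦ : IsHamiltonian K Φ) (x : M) (ε : ℝ) :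
    Continuous fun ξ : EuclideanSpace ℝ (Fin d) => radialF K Φ (lieVec e ξ) x ε :=
  continuous_const.mul ((hΦ.isHomFamily e).continuous_integral e K x ε)

theorem IsHamiltonian.continuous_radialH (hΦ : IsHamiltonian K Φ) (x : M) (ε : ℝ) :
    Continuous fun ξ : EuclideanSpace ℝ (Fin d) => radialH K Φ (lieVec e ξ) x ε :=
  (hΦ.isHomFamily_lapMoment e).continuous_integral e K x ε

/-- The second derivative is `2|X^ξ|²` along the curve. Convexity gives growth far from `ρ = 0`,
where Taylor's formula says nothing. -/
theorem IsHamiltonian.convexOn_radialF (hΦ : IsHamiltonian K Φ) (ξ : GroupLieAlgebra (𝓡 d) G)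
    (x : M) : ConvexOn ℝ Set.univ (radialF K Φ ξ x) := by
  have hch := hΦ.hasDerivAt_chainF ξ x
  have h1 := iteratedDeriv_of_chain (u := fun p ρ => 2 * curveChain K ξ (fun y => Φ y ξ) x p ρ) hch
  have e1 : deriv (radialF K Φ ξ x) = fun ρ => 2 * curveChain K ξ (fun y => Φ y ξ) x 1 ρ :=
    funext fun t => (hch 0 t).deriv
  refine convexOn_univ_of_deriv2_nonneg (fun t => (hch 0 t).differentiableAt) ?_ fun t => ?_
  · rw [e1]
    exact fun t => (hch 1 t).differentiableAt
  · rw [← iteratedDeriv_eq_iterate, radialF_eq_curveChain, h1]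
    beta_reduce
    rw [curveChain_succ, iterDirDeriv, Function.iterate_one, hΦ.dirDeriv_eq]
    positivity

/-- Lower bound for the exponent of the density. -/
theorem IsHamiltonian.exists_radialF_lower_bound (hΦ : IsHamiltonian K Φ) {x : M} (hx : Φ x = 0)
    (hd : 0 < d) (hpos : ∀ ξ : EuclideanSpace ℝ (Fin d), ξ ≠ 0 → 0 < coeffF K Φ (lieVec e ξ) x 0) :
    ∃ c, 0 < c ∧ (∀ ξ : EuclideanSpace ℝ (Fin d), c * ‖ξ‖ ^ 2 ≤ coeffF K Φ (lieVec e ξ) x 0) ∧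
      ∀ (ξ : EuclideanSpace ℝ (Fin d)) (ε : ℝ), 0 ≤ ε →
        c * (ε * ‖ξ‖) ^ 2 / (1 + ε * ‖ξ‖) ≤ radialF K Φ (lieVec e ξ) x ε := by
  have : Nonempty (Fin d) := ⟨⟨0, hd⟩⟩
  obtain ⟨Ω₀, hΩ₀, hmin⟩ := (isCompact_sphere (0 : EuclideanSpace ℝ (Fin d)) 1).exists_isMinOn
    (NormedSpace.sphere_nonempty.2 zero_le_one) (hΦ.continuous_coeffF e x 0).continuousOn
  set c := coeffF K Φ (lieVec e Ω₀) x 0 with hc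
  have hc0 : 0 < c := hpos Ω₀ (by rintro rfl; simp at hΩ₀)
  obtain ⟨C, hC0, hC⟩ := hΦ.exists_abs_radialF_sub_le e hx 1
  -- Up to `δ` the cubic error `C s³` consumes at most half of the quadratic term `c s²`.
  set δ := min 1 (c / (2 * (C + 1))) with hδ
  have hδ0 : 0 < δ := lt_min one_pos (by positivity)
  have hδ1 : δ ≤ 1 := min_le_left _ _
  have hCδ : C * δ ≤ c / 2 := by
    calc C * δ ≤ (C + 1) * (c / (2 * (C + 1))) := by
          gcongr
          · linarith
          · exact min_le_right _ _
      _ = c / 2 := by field_simp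
  have hloc : ∀ Ω ∈ Metric.sphere (0 : EuclideanSpace ℝ (Fin d)) 1, ∀ s, 0 ≤ s → s ≤ δ →
      c / 2 * s ^ 2 ≤ radialF K Φ (lieVec e Ω) x s := by
    intro Ω hΩ s hs hsδ
    have h1 := hC Ω s hs
    rw [mem_sphere_zero_iff_norm.1 hΩ, Finset.sum_range_one, one_pow, mul_one, abs_le] at h1
    have h2 : c ≤ coeffF K Φ (lieVec e Ω) x 0 := hmin hΩ
    have h3 : C * s ^ (1 + 2) ≤ c / 2 * s ^ 2 := by
      calc C * s ^ (1 + 2) = C * s * s ^ 2 := by ring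
        _ ≤ C * δ * s ^ 2 := by gcongr
        _ ≤ _ := by gcongr
    have h4 : c * s ^ (0 + 2) ≤ coeffF K Φ (lieVec e Ω) x 0 * s ^ (0 + 2) := by gcongr
    rw [zero_add] at h4 h1
    have h5 : c / 2 * s ^ 2 = c * s ^ 2 - c / 2 * s ^ 2 := by ring
    rw [h5]
    exact (sub_le_sub h4 h3).trans (sub_le_iff_le_add.2 (neg_le_sub_iff_le_add.1 h1.1))
  -- The function `s²/(1+s)` lies below both `s²` and `s`, so one bound covers the quadratic regime
  -- `s ≤ δ` and the linear regime `s ≥ δ`.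
  have hglob : ∀ Ω ∈ Metric.sphere (0 : EuclideanSpace ℝ (Fin d)) 1, ∀ s, 0 ≤ s →
      c * δ / 2 * s ^ 2 / (1 + s) ≤ radialF K Φ (lieVec e Ω) x s := by
    intro Ω hΩ s hs
    rcases le_total s δ with h | h
    · refine le_trans ?_ (hloc Ω hΩ s hs h)
      rw [div_le_iff₀ (by positivity)]
      have : 0 ≤ c / 2 * s ^ 2 := by positivity
      nlinarith
    · have hs0 : 0 < s := hδ0.trans_le h
      -- Writing `δ` as a convex combination of `0` and `s`, with `f(0) = 0`, gives `f(s) ≥ (s/δ)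
      -- f(δ) ≥ (cδ/2) s`.
      have hcv := (hΦ.convexOn_radialF (lieVec e Ω) x).2 (Set.mem_univ 0) (Set.mem_univ s)
        (sub_nonneg.2 ((div_le_one hs0).2 h)) (div_nonneg hδ0.le hs) (by ring)
      have h0 : radialF K Φ (lieVec e Ω) x 0 = 0 := by simp [radialF]
      simp only [smul_eq_mul, mul_zero, zero_add, h0] at hcv
      rw [div_mul_cancel₀ _ hs0.ne'] at hcv
      have h1 := (hloc Ω hΩ δ hδ0.le le_rfl).trans hcv
      have h2 : c * δ / 2 * s ≤ radialF K Φ (lieVec e Ω) x s := by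
        have h3 := mul_le_mul_of_nonneg_left h1 (by positivity : 0 ≤ s / δ)
        calc c * δ / 2 * s = s / δ * (c / 2 * δ ^ 2) := by field_simp
          _ ≤ s / δ * (δ / s * radialF K Φ (lieVec e Ω) x s) := h3
          _ = _ := by field_simp
      refine le_trans ?_ h2
      rw [div_le_iff₀ (by positivity)]
      have : 0 ≤ c * δ / 2 * s := by positivity
      nlinarith
  have hnorm : ∀ ξ : EuclideanSpace ℝ (Fin d), ξ ≠ 0 →
      ‖ξ‖⁻¹ • ξ ∈ Metric.sphere (0 : EuclideanSpace ℝ (Fin d)) 1 := by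
    intro ξ hξ
    rw [mem_sphere_zero_iff_norm, norm_smul, norm_inv, norm_norm,
      inv_mul_cancel₀ (norm_ne_zero_iff.2 hξ)]
  refine ⟨c * δ / 2, by positivity, fun ξ => ?_, fun ξ ε hε => ?_⟩
  · rcases eq_or_ne ξ 0 with rfl | hξ
    · have := hΦ.coeffF_smul e x 0 0 (0 : EuclideanSpace ℝ (Fin d))
      simp only [zero_smul] at this
      rw [this]
      simp
    · have h1 : c ≤ coeffF K Φ (lieVec e (‖ξ‖⁻¹ • ξ)) x 0 := hmin (hnorm ξ hξ)
      have h2 : coeffF K Φ (lieVec e ξ) x 0 =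
          ‖ξ‖ ^ 2 * coeffF K Φ (lieVec e (‖ξ‖⁻¹ • ξ)) x 0 := by
        have := hΦ.coeffF_smul e x 0 ‖ξ‖ (‖ξ‖⁻¹ • ξ)
        rwa [smul_inv_smul₀ (norm_ne_zero_iff.2 hξ)] at this
      rw [h2]
      calc c * δ / 2 * ‖ξ‖ ^ 2 ≤ c * ‖ξ‖ ^ 2 := by
            gcongr
            nlinarith
        _ ≤ _ := by rw [mul_comm]; gcongr
  · rcases eq_or_ne ξ 0 with rfl | hξ
    · have h0 : lieVec e (0 : EuclideanSpace ℝ (Fin d)) =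
          (0 : ℝ) • lieVec e (0 : EuclideanSpace ℝ (Fin d)) := by
        rw [← lieVec_smul, smul_zero]
      rw [h0, radialF_smul]
      simp [radialF]
    · have h1 := hglob _ (hnorm ξ hξ) (‖ξ‖ * ε) (by positivity)
      rw [← radialF_smul, ← lieVec_smul, smul_inv_smul₀ (norm_ne_zero_iff.2 hξ)] at h1
      rwa [mul_comm ε]

omit [CompactSpace M] [T2Space M] [IsManifold (𝓡 d) ∞ G] [ContMDiffSMul (𝓡 d) (𝓡 (2 * n)) ∞ G M] in
theorem coeff_expSeries_coeffH (a : ℝ)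
    (ξ : GroupLieAlgebra (𝓡 d) G) (x : M) (j : ℕ) :
    PowerSeries.coeff j (expSeries (a • tailSeries (coeffH K Φ ξ x))) =
      1 / (j.factorial : ℝ) *
        completeBell j fun p => a * ((p.factorial : ℝ) * coeffH K Φ ξ x p) := by
  rw [completeBell_eq, smul_tailSeries, ← mul_assoc, one_div_mul_cancel (by positivity), one_mul]
  congr 4
  funext p
  have : (p.factorial : ℝ) ≠ 0 := by positivity
  field_simp

/-- The dictionary is `f_0 = |X^ξ|²`, with `f_p` and `h_p` the iterated derivatives along `JX^ξ`
divided by factorials; the powers of `a` and of `2` are spread over the factors. -/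
theorem IsHamiltonian.zetaIntegrand_eq (hΦ : IsHamiltonian K Φ) (a : ℝ) (x : M) (j : ℕ)
    (ξ : GroupLieAlgebra (𝓡 d) G) :
    zetaIntegrand K Φ a x j ξ = sphereCoeff d j a (coeffF K Φ ξ x) (coeffH K Φ ξ x) := by
  set L := K.length x (infAction ξ x) with hL
  have hL0 : 0 ≤ L := Real.sqrt_nonneg _
  have hF0 : coeffF K Φ ξ x 0 = L ^ 2 := hΦ.coeffF_zero ξ x
  rw [zetaIntegrand, sphereCoeff]
  congr 1
  · rw [hF0, ← Real.rpow_natCast L 2, ← Real.rpow_mul hL0, ← Real.rpow_natCast L (d + j),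
      ← Real.rpow_neg hL0]
    congr 1
    push_cast
    ring
  · refine Finset.sum_congr rfl fun m _ => ?_
    congr 1
    · rw [coeff_expSeries_coeffH, completeBell]
      congr 2
      funext l
      rw [partialBell]
      refine Finset.sum_congr rfl fun q _ => ?_
      rw [mul_assoc, ← Finset.prod_pow_eq_pow_sum, ← Finset.prod_mul_distrib]
      congr 1
      refine Finset.prod_congr rfl fun p _ => ?_
      rw [← mul_pow, hΦ.coeffH_succ, mul_div_cancel₀ _ (by positivity)]
    · congr 1
      funext r
      rw [mul_assoc]
      congr 1
      rw [hF0, ← pow_mul, div_eq_inv_mul, compPoly]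
      congr 1
      refine Finset.sum_congr rfl fun q _ => ?_
      simp only [hΦ.coeffF_eq, Finset.prod_mul_distrib, Finset.prod_div_distrib,
        Finset.prod_const, Finset.card_univ, Fintype.card_fin]

end Main

/-! ### The asymptotic expansion of the density. -/

section Density

variable {n d : ℕ} {M : Type*} [TopologicalSpace M] [CompactSpace M] [T2Space M]
  [ChartedSpace (EuclideanSpace ℝ (Fin (2 * n))) M] [IsManifold (𝓡 (2 * n)) ∞ M]
  {K : KahlerStructure n M} {G : Type*} [Group G] [TopologicalSpace G]
  [ChartedSpace (EuclideanSpace ℝ (Fin d)) G] [IsManifold (𝓡 d) ∞ G] [MulAction G M]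
  [ContMDiffSMul (𝓡 d) (𝓡 (2 * n)) ∞ G M] (e : Module.Basis (Fin d) ℝ (GroupLieAlgebra (𝓡 d) G))
  {Φ : M → Module.Dual ℝ (GroupLieAlgebra (𝓡 d) G)}

theorem integrable_exp_neg_mul_of_homogeneous {q g : EuclideanSpace ℝ (Fin d) → ℝ} {B : ℝ} {k : ℕ}
    (hq : Continuous q) (hB : ∀ x, ‖x‖ - B ≤ q x) (hg : Continuous g)
    (hs : ∀ (s : ℝ) x, g (s • x) = s ^ k * g x) :
    MeasureTheory.Integrable fun x => Real.exp (-q x) * g x := by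
  -- The bound for families is applied over a one-point space.
  obtain ⟨C, hC0, hC⟩ := exists_abs_le_of_homogeneous (X := Unit) (Q := fun x _ => g x)
    (hg.comp continuous_fst) (fun s x _ => hs s x)
  refine ((integrable_one_add_norm_pow_mul_exp_neg MeasureTheory.volume k).const_mul
    (C * Real.exp B)).mono' (by fun_prop) (Filter.Eventually.of_forall fun x => ?_)
  rw [norm_mul, Real.norm_eq_abs, Real.norm_eq_abs, abs_of_pos (Real.exp_pos _)]
  calc Real.exp (-q x) * |g x| ≤ Real.exp (B + -‖x‖) * (C * (1 + ‖x‖) ^ k) := by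
        have h1 : |g x| ≤ C * (1 + ‖x‖) ^ k := (hC x ()).trans (by gcongr; linarith)
        gcongr
        linarith [hB x]
    _ = _ := by rw [Real.exp_add]; ring

theorem IsHamiltonian.coeffF_pos (hΦ : IsHamiltonian K Φ) (hreg : ZeroIsRegularValue (n := n) Φ)
    {x : M} (hx : Φ x = 0) {ξ : EuclideanSpace ℝ (Fin d)} (hξ : ξ ≠ 0) :
    0 < coeffF K Φ (lieVec e ξ) x 0 := by
  rw [hΦ.coeffF_zero]
  exact pow_pos (K.length_pos (hΦ.infAction_ne_zero hreg hx (lieVec_ne_zero e hξ))) 2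

/-- The substitution `ξ ↦ εξ` with `ε = k^(-1/2)` has Jacobian `ε ^ d = k^(-d/2)`, and `k = ε^(-2)`.
-/
theorem IsHamiltonian.density_eq (hΦ : IsHamiltonian K Φ) (a : ℝ) (x : M) {k : ℝ} (hk : 0 < k) :
    density K Φ e a k x = k ^ (-(d : ℝ) / 2) * ∫ ξ : EuclideanSpace ℝ (Fin d),
      Real.exp (-(radialF K Φ (lieVec e ξ) x (k ^ (-(1 / 2) : ℝ)) / (k ^ (-(1 / 2) : ℝ)) ^ 2)
        + a * radialH K Φ (lieVec e ξ) x (k ^ (-(1 / 2) : ℝ))) := by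
  set ε : ℝ := k ^ (-(1 / 2) : ℝ) with hε
  have hε0 : 0 < ε := Real.rpow_pos_of_pos hk _
  have hε2 : ε ^ 2 = k⁻¹ := by
    rw [hε, ← Real.rpow_natCast, ← Real.rpow_mul hk.le, ← Real.rpow_neg_one]
    norm_num
  have hεd : ε ^ d = k ^ (-(d : ℝ) / 2) := by
    rw [hε, ← Real.rpow_natCast, ← Real.rpow_mul hk.le]
    congr 1
    ring
  have h := MeasureTheory.Measure.integral_comp_smul
    (MeasureTheory.volume : MeasureTheory.Measure (EuclideanSpace ℝ (Fin d)))
    (densityIntegrand K Φ e a k x) ε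
  rw [finrank_euclideanSpace, Fintype.card_fin, abs_of_pos (by positivity), smul_eq_mul] at h
  have h2 : density K Φ e a k x =
      ε ^ d * ∫ ξ, densityIntegrand K Φ e a k x (ε • ξ) := by
    rw [h, ← mul_assoc, mul_inv_cancel₀ (by positivity), one_mul, density]
  rw [h2, hεd]
  congr 1
  refine MeasureTheory.integral_congr_ae (Filter.Eventually.of_forall fun ξ => ?_)
  beta_reduce
  rw [hΦ.densityIntegrand_smul, hε2, div_inv_eq_mul, mul_comm k]

/-- The coefficient `ζ_j` as a Gaussian type integral, together with the expansion of the density. -/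
theorem IsHamiltonian.density_expansion (hΦ : IsHamiltonian K Φ)
    (hreg : ZeroIsRegularValue (n := n) Φ) {x : M} (hx : Φ x = 0) (hd : 0 < d) (a : ℝ) :
    (∀ᶠ k : ℝ in Filter.atTop, MeasureTheory.Integrable (densityIntegrand K Φ e a k x)) ∧
    (∀ N : ℕ, (fun k : ℝ => density K Φ e a k x -
        k ^ (-(d : ℝ) / 2) * ∑ j ∈ Finset.range (N + 1),
          zeta K Φ e a x (2 * j) * k ^ (-(j : ℝ))) =o[Filter.atTop]
      fun k : ℝ => k ^ (-(d : ℝ) / 2 - N)) ∧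
    (∀ j : ℕ, Odd j → zeta K Φ e a x j = 0) := by
  have : Nonempty (Fin d) := ⟨⟨0, hd⟩⟩
  have : Nontrivial (EuclideanSpace ℝ (Fin d)) := inferInstance
  obtain ⟨c, hc0, hcq, hcf⟩ := hΦ.exists_radialF_lower_bound e hx hd
    fun ξ hξ => hΦ.coeffF_pos e hreg hx hξ
  -- At lowest order, and since `h(0) = 0`, this reads `|h| ≤ C ε‖ξ‖`.
  obtain ⟨C, hC0, hC⟩ := hΦ.exists_abs_radialH_sub_le e x 0
  set D := |a| * C with hD
  have hD0 : 0 ≤ D := by positivity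
  have hDh : ∀ (ξ : EuclideanSpace ℝ (Fin d)) (ε : ℝ), 0 ≤ ε →
      a * radialH K Φ (lieVec e ξ) x ε ≤ D * (ε * ‖ξ‖) := by
    intro ξ ε hε
    have h1 := hC ξ ε hε
    simp only [zero_add, pow_one, Finset.sum_range_one, coeffH_zero, zero_mul, sub_zero] at h1
    calc a * radialH K Φ (lieVec e ξ) x ε ≤ |a| * |radialH K Φ (lieVec e ξ) x ε| := by
          rw [← abs_mul]; exact le_abs_self _
      _ ≤ |a| * (C * ‖ξ‖ * ε) := by gcongr
      _ = _ := by rw [hD]; ring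
  -- The entries serve the range of `HasExpansion` and the two smallness conditions of
  -- `le_sq_div_sub`; `D + 1` avoids dividing by zero.
  set ε₀ := min 1 (min (c / 4) (1 / (D + 1))) with hε₀
  have hε₀0 : 0 < ε₀ := lt_min one_pos (lt_min (by positivity) (by positivity))
  have hε₀1 : ε₀ ≤ 1 := min_le_left _ _
  have hε₀c : ε₀ ≤ c / 4 := (min_le_right _ _).trans (min_le_left _ _)
  have hε₀D : ε₀ ≤ 1 / (D + 1) := (min_le_right _ _).trans (min_le_right _ _)
  set q : EuclideanSpace ℝ (Fin d) → ℝ := fun ξ => coeffF K Φ (lieVec e ξ) x 0 with hq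
  -- What remains of the exponent once the Gaussian part `-f_0` is removed; it has an expansion
  -- without constant term.
  set u : EuclideanSpace ℝ (Fin d) → ℝ → ℝ := fun ξ ε =>
    -1 * (radialF K Φ (lieVec e ξ) x ε / ε ^ 2 - coeffF K Φ (lieVec e ξ) x 0) +
      a * radialH K Φ (lieVec e ξ) x ε with hu
  set s : EuclideanSpace ℝ (Fin d) → PowerSeries ℝ := fun ξ =>
    (-1 : ℝ) • (tailSeries fun i => coeffF K Φ (lieVec e ξ) x i) +
      a • tailSeries fun i => coeffH K Φ (lieVec e ξ) x i with hsdef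
  have hexp : HasExpansion (fun ξ : EuclideanSpace ℝ (Fin d) => 1 + ‖ξ‖) u s :=
    ((hΦ.hasExpansion_radialF e hx).const_mul (-1)).add (fun ξ => by simp)
      ((hΦ.hasExpansion_radialH e x).const_mul a)
  have hs0 : ∀ ξ, PowerSeries.constantCoeff (s ξ) = 0 := fun ξ => by
    simp [hsdef, constantCoeff_tailSeries]
  have hqB : ∀ ξ, ‖ξ‖ - 2 / c ≤ q ξ := by
    intro ξ
    refine le_trans ?_ (hcq ξ)
    rw [sub_le_iff_le_add, ← mul_le_mul_iff_right₀ hc0]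
    have : c * (c * ‖ξ‖ ^ 2 + 2 / c) = (c * ‖ξ‖) ^ 2 + 2 := by field_simp
    rw [this]
    nlinarith [sq_nonneg (c * ‖ξ‖ - 1), sq_nonneg (c * ‖ξ‖)]
  -- The full exponent is bounded below only linearly in `‖ξ‖`, as `s²/(1+s)` grows linearly; what
  -- matters is that the bound is uniform in `ε`.
  have hquB : ∀ ξ ε, 0 < ε → ε ≤ ε₀ → ‖ξ‖ - 2 / c ≤ q ξ - u ξ ε := by
    intro ξ ε hε hεε
    have h1 := le_sq_div_sub (c := c) (D := D) (s := ‖ξ‖) hc0 (norm_nonneg _) hε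
      (hεε.trans hε₀c) (by
        calc D * ε ≤ (D + 1) * (1 / (D + 1)) := by
              gcongr
              · linarith
              · exact hεε.trans hε₀D
          _ = 1 := mul_one_div_cancel (by positivity))
    have h2 : c * ‖ξ‖ ^ 2 / (1 + ε * ‖ξ‖) ≤ radialF K Φ (lieVec e ξ) x ε / ε ^ 2 := by
      rw [le_div_iff₀ (by positivity)]
      refine le_of_eq_of_le ?_ (hcf ξ ε hε.le)
      ring
    have h3 := hDh ξ ε hε.le
    simp only [hq, hu]
    linarith
  have hcq' : Continuous q := hΦ.continuous_coeffF e x 0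
  have hcu : ∀ ε : ℝ, 0 < ε → Continuous fun ξ => u ξ ε := fun ε _ =>
    (continuous_const.mul (((hΦ.continuous_radialF e x ε).div_const _).sub hcq')).add
      (continuous_const.mul (hΦ.continuous_radialH e x ε))
  have hcs : ∀ j, Continuous fun ξ => PowerSeries.coeff j (expSeries (s ξ)) :=
    continuous_coeff_expSeries fun j => by
      simp only [hsdef, map_add, map_smul, smul_eq_mul]
      exact (continuous_const.mul (continuous_coeff_tailSeries (hΦ.continuous_coeffF e x) j)).add
        (continuous_const.mul (continuous_coeff_tailSeries (hΦ.continuous_coeffH e x) j))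
  obtain ⟨hint, -, hbound⟩ := exists_abs_integral_exp_sub_le MeasureTheory.volume hexp hs0 hε₀1
    hqB hquB hcq' hcu hcs
  have huq : ∀ ξ ε, -q ξ + u ξ ε = -(radialF K Φ (lieVec e ξ) x ε / ε ^ 2) +
      a * radialH K Φ (lieVec e ξ) x ε := fun ξ ε => by simp only [hq, hu]; ring
  have hz : ∀ j, ∫ ξ, Real.exp (-q ξ) * PowerSeries.coeff j (expSeries (s ξ)) =
      zeta K Φ e a x j := by
    intro j
    have h := integral_exp_neg_mul_coeff_expSeries MeasureTheory.volume
      (f := fun i ξ => coeffF K Φ (lieVec e ξ) x i) (h := fun i ξ => coeffH K Φ (lieVec e ξ) x i)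
      (hΦ.continuous_coeffF e x) (hΦ.continuous_coeffH e x) (hΦ.coeffF_smul e x)
      (hΦ.coeffH_smul e x) (fun ξ hξ => hΦ.coeffF_pos e hreg hx hξ)
      (fun g k hg hgs => integrable_exp_neg_mul_of_homogeneous hcq' hqB hg hgs) a j
    rw [finrank_euclideanSpace, Fintype.card_fin] at h
    rw [zeta]
    simp only [hΦ.zetaIntegrand_eq]
    exact h
  have hodd : ∀ j : ℕ, Odd j → zeta K Φ e a x j = 0 := fun j hj => by
    rw [← hz]
    exact integral_exp_neg_mul_coeff_expSeries_odd MeasureTheory.volume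
      (f := fun i ξ => coeffF K Φ (lieVec e ξ) x i) (h := fun i ξ => coeffH K Φ (lieVec e ξ) x i)
      (hΦ.coeffF_smul e x) (hΦ.coeffH_smul e x) a hj
  refine ⟨?_, fun N => ?_, hodd⟩
  · have hlim : Filter.Tendsto (fun k : ℝ => k ^ (-(1 / 2) : ℝ)) Filter.atTop (𝓝 0) :=
      tendsto_rpow_neg_atTop (by norm_num)
    filter_upwards [hlim.eventually (ge_mem_nhds hε₀0), Filter.eventually_gt_atTop 0] with k hk hk0
    set ε : ℝ := k ^ (-(1 / 2) : ℝ) with hε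
    have hε0 : 0 < ε := Real.rpow_pos_of_pos hk0 _
    have hε2 : ε ^ 2 = k⁻¹ := by
      rw [hε, ← Real.rpow_natCast, ← Real.rpow_mul hk0.le, ← Real.rpow_neg_one]
      norm_num
    rw [← MeasureTheory.integrable_comp_smul_iff _ _ hε0.ne']
    refine (hint ε hε0 hk).congr (Filter.Eventually.of_forall fun ξ => ?_)
    beta_reduce
    rw [hΦ.densityIntegrand_smul, huq, hε2, div_inv_eq_mul, mul_comm k]
  · refine isLittleO_of_expansion (I := fun ε => ∫ ξ : EuclideanSpace ℝ (Fin d),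
      Real.exp (-(radialF K Φ (lieVec e ξ) x ε / ε ^ 2) + a * radialH K Φ (lieVec e ξ) x ε))
      hε₀0 hodd (fun J => ?_) (fun k hk => hΦ.density_eq e a x hk) N
    obtain ⟨C, hC⟩ := hbound J
    refine ⟨C, fun ε hε hεε => ?_⟩
    have := hC ε hε hεε
    simp only [hz, huq] at this
    exact this

end Density

end KahlerReduction

end

theorem mainTheorem2 {n d : ℕ} (hd : 0 < d)
    {M : Type*} [TopologicalSpace M] [T2Space M] [CompactSpace M]
    [ChartedSpace (EuclideanSpace ℝ (Fin (2 * n))) M] [IsManifold (𝓡 (2 * n)) ∞ M]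
    (K : KahlerStructure n M)
    {G : Type*} [Group G] [TopologicalSpace G] [T2Space G] [CompactSpace G]
    [ChartedSpace (EuclideanSpace ℝ (Fin d)) G] [LieGroup (𝓡 d) ∞ G]
    [MulAction G M] [ContMDiffSMul (𝓡 d) (𝓡 (2 * n)) ∞ G M]
    (Φ : M → Module.Dual ℝ (GroupLieAlgebra (𝓡 d) G)) (hΦ : IsHamiltonian K Φ)
    (hreg : ZeroIsRegularValue (n := n) Φ)
    (hfree : ∀ x : M, Φ x = 0 → ∀ g : G, g • x = x → g = 1)
    (e : Module.Basis (Fin d) ℝ (GroupLieAlgebra (𝓡 d) G))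
    (x₀ : M) (hx₀ : Φ x₀ = 0) (a : ℝ) :
    -- the curves `t ↦ e^{itξ} x₀` exist for all times
    (∀ ξ : GroupLieAlgebra (𝓡 d) G, imagExp K ξ x₀ 0 = x₀ ∧
      IsMIntegralCurve (I := 𝓡 (2 * n)) (imagExp K ξ x₀) (imagField K ξ)) ∧
    -- the integrals converge absolutely
    (∀ᶠ k : ℝ in Filter.atTop,
      MeasureTheory.Integrable (densityIntegrand K Φ e a k x₀)) ∧
    (∀ j : ℕ, MeasureTheory.Integrable
      (fun Ω : Metric.sphere (0 : EuclideanSpace ℝ (Fin d)) 1 =>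
        zetaIntegrand K Φ a x₀ j (lieVec e Ω))
      (MeasureTheory.volume : MeasureTheory.Measure (EuclideanSpace ℝ (Fin d))).toSphere) ∧
    (∀ ξ : GroupLieAlgebra (𝓡 d) G, ξ ≠ 0 → 0 < K.length x₀ (infAction ξ x₀)) ∧
    -- the complete asymptotic expansion
    (∀ N : ℕ, (fun k : ℝ => density K Φ e a k x₀ -
        k ^ (-(d : ℝ) / 2) * ∑ j ∈ Finset.range (N + 1),
          zeta K Φ e a x₀ (2 * j) * k ^ (-(j : ℝ))) =o[Filter.atTop]
      fun k : ℝ => k ^ (-(d : ℝ) / 2 - N)) ∧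
    -- the odd coefficients vanish
    (∀ j : ℕ, Odd j → zeta K Φ e a x₀ j = 0) ∧
    -- the concise forms of the coefficients
    (∀ j : ℕ, zeta K Φ e a x₀ j = (1 / 2) * Real.Gamma (((d : ℝ) + j) / 2) *
      ∫ Ω : Metric.sphere (0 : EuclideanSpace ℝ (Fin d)) 1,
        coeffF K Φ (lieVec e Ω) x₀ 0 ^ (-(((d : ℝ) + j) / 2)) *
          ∑ m ∈ Finset.range (j + 1), coeffG K Φ a (lieVec e Ω) x₀ (j - m) *
            sumOrOne (Finset.Icc 1 m) (fun r => genBinom (-(((d : ℝ) + j) / 2)) r *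
              (compPoly m r (coeffF K Φ (lieVec e Ω) x₀) / coeffF K Φ (lieVec e Ω) x₀ 0 ^ r))
        ∂(MeasureTheory.volume : MeasureTheory.Measure (EuclideanSpace ℝ (Fin d))).toSphere) ∧
    (∀ j : ℕ, zeta K Φ e a x₀ j = (1 / 2) * Real.Gamma (((d : ℝ) + j) / 2) *
      ∫ Ω : Metric.sphere (0 : EuclideanSpace ℝ (Fin d)) 1,
        coeffF K Φ (lieVec e Ω) x₀ 0 ^ (-(((d : ℝ) + j) / 2)) *
          ∑ m ∈ Finset.range (j + 1), (1 / ((j - m).factorial : ℝ)) *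
            completeBell (j - m)
              (fun p => a * ((p.factorial : ℝ) * coeffH K Φ (lieVec e Ω) x₀ p)) *
            sumOrOne (Finset.Icc 1 m) (fun r => genBinom (-(((d : ℝ) + j) / 2)) r *
              (compPoly m r (coeffF K Φ (lieVec e Ω) x₀) / coeffF K Φ (lieVec e Ω) x₀ 0 ^ r))
        ∂(MeasureTheory.volume : MeasureTheory.Measure (EuclideanSpace ℝ (Fin d))).toSphere) ∧
    (∀ (Ω : GroupLieAlgebra (𝓡 d) G) (p : ℕ),
      ((p + 1).factorial : ℝ) * coeffH K Φ Ω x₀ (p + 1) =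
          iterDirDeriv (imagField K Ω) p (lapMoment K Φ Ω) x₀ ∧
      coeffF K Φ Ω x₀ p = 2 / ((p + 2).factorial : ℝ) *
          iterDirDeriv (imagField K Ω) (p + 1) (fun y => Φ y Ω) x₀ ∧
      coeffF K Φ Ω x₀ p = 2 / ((p + 2).factorial : ℝ) *
          iterDirDeriv (imagField K Ω) p (fun y => K.length y (infAction Ω y) ^ 2) x₀) := by
  have hz : ∀ ξ : GroupLieAlgebra (𝓡 d) G, ∀ j, zetaIntegrand K Φ a x₀ j ξ =
      sphereCoeff d j a (coeffF K Φ ξ x₀) (coeffH K Φ ξ x₀) := fun ξ j =>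
    hΦ.zetaIntegrand_eq a x₀ j ξ
  obtain ⟨h1, h2, h3⟩ := hΦ.density_expansion e hreg hx₀ hd a
  refine ⟨fun ξ => imagExp_spec K ξ x₀, h1, fun j => ?_, fun ξ hξ =>
    K.length_pos (hΦ.infAction_ne_zero hreg hx₀ hξ), h2, h3, fun j => ?_, fun j => ?_,
    fun Ω p => ⟨?_, hΦ.coeffF_eq Ω x₀ p, ?_⟩⟩
  · simp only [hz]
    -- The sphere is compact and `f_0` has no zero on it, so the integrand is continuous and hence
    -- integrable.
    refine integrable_toSphere_of_continuous _ (continuous_sphereCoeff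
      (f := fun i (Ω : Metric.sphere (0 : EuclideanSpace ℝ (Fin d)) 1) =>
        coeffF K Φ (lieVec e Ω) x₀ i)
      (h := fun i Ω => coeffH K Φ (lieVec e Ω) x₀ i)
      (fun i => (hΦ.continuous_coeffF e x₀ i).comp continuous_subtype_val)
      (fun i => (hΦ.continuous_coeffH e x₀ i).comp continuous_subtype_val)
      (fun Ω => hΦ.coeffF_pos e hreg hx₀ (ne_zero_of_mem_unit_sphere Ω)) d j a)
  · simp only [zeta, hz, hΦ.coeffG_eq]
    rfl
  · simp only [zeta, hz, ← coeff_expSeries_coeffH]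
    rfl
  · rw [hΦ.coeffH_succ, mul_div_cancel₀ _ (by positivity)]
  · rw [hΦ.coeffF_eq, hΦ.iterDirDeriv_succ]
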